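/- **Theorem (image charges for the gradient blow-up term; Dirichlet-type problem).** Identify $\mathbb{R}^2$ with $\mathbb{C}$ by $(x_1,x_2)\leftrightarrow x_1+\mathrm{i}x_2$. Fix $0<r_i<r_e$, let $\Omega_0=\{|\mathbf x-(r_e,0)|<r_e\}$, and let $g_d:\partial\Omega_0\to\mathbb{R}$ be a mean-zero function of class $C^{2,\delta}$ for some $\delta>1/2$. For $0<\epsilon<r_e-r_i$ and $k>0$ put $$c_i=\frac{r_e^2-r_i^2-(r_e-r_i-\epsilon)^2}{2(r_e-r_i-\epsilon)},\quad c_e=c_i+r_e-r_i-\epsilon,\quad x_0=c_e-r_e,\quad \alpha=\frac{\sqrt{\epsilon(2r_i+\epsilon)(2r_e-\epsilon)(2r_e-2r_i-\epsilon)}}{2(r_e-r_i-\epsilon)},$$ $$\xi_i=\tfrac12\ln\frac{c_i+\alpha}{c_i-\alpha},\qquad r_*=\sqrt{\frac{2r_ir_e}{r_e-r_i}},\qquad \tau=\frac{k-1}{k+1},\qquad \beta=\frac{r_*(-\ln|\tau|)}{4\sqrt\epsilon}\ \ (k>1).$$ Let $\Omega=(x_0,0)+\Omega_0$ be the open disk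 of radius $r_e$ centered at $(c_e,0)$ and $D$ the open disk of radius $r_i$ centered at $(c_i,0)$; they are non-concentric, $\overline D\subset\Omega$, and $\epsilon$ is the distance from $D$ to $\partial\Omega$. Let $v$ be the solution of $$\Delta v=0\ \text{in } D\cup(\Omega\setminus\overline D),\quad v|_+=v|_-\ \text{and}\ \frac{\partial v}{\partial\nu}\Big|_+=k\frac{\partial v}{\partial\nu}\Big|_-\ \text{on }\partial D,\quad v=g_d(\cdot-(x_0,0))\ \text{on }\partial\Omega,$$ where $\nu$ is the outward unit normal, the one-sided normal derivatives are $\lim_{t\to0+}\nu\cdot\nabla v(\mathbf x\pm t\nu)$, and $v$ is continuous on $\overline\Omega$. Such a $v$ exists. Let $H_d=2\mathcal D_{\partial\Omega_0}[g_d]$ in $\Omega_0$, where $$\mathcal D_{\partial\Omega_0}[\phi](\mathbf x)=\frac1{2\pi}\int_{\partial\Omega_0}\frac{\partial}{\partial\nu_\zeta}\ln|\mathbf x-\zeta|\,\phi(\zeta)\,d\sigma(\zeta).$$ The gradient of $H_d$ has a limit at the boundary point $(0,0)\in\partial\Omega_0$; let $(C_1,C_2)=\nabla H_d(0,0)$ denote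 this limit. Let $\xi$ be the bipolar coordinate given by $e^{\xi+\mathrm i\theta}=(\alpha+z)/(\alpha-z)$ with $z=x_1+\mathrm ix_2$, and $\mathbf e_\xi=\nabla\xi/|\nabla\xi|$. (a) The gradient of $v$ blows up only in $\Omega\setminus\overline D$, and only if $k\to\infty$ and $\epsilon\to0$. That is: $\|\nabla v\|_{L^\infty(D)}$ is bounded uniformly in $(\epsilon,k)$; for every $K$, $\|\nabla v\|_{L^\infty(\Omega\setminus\overline D)}$ is bounded uniformly over all $(\epsilon,k)$ with $k\le K$; and for every $\epsilon_0>0$ it is bounded uniformly over all $(\epsilon,k)$ with $\epsilon\ge\epsilon_0$. (b) For $k>1$, with $\mathbf s=(s,0)$ and $$\varphi_+(s)=2\alpha\beta e^{2\beta\xi_i}\frac{(s-\alpha)^{\beta-1}}{(s+\alpha)^{\beta+1}},\quad \psi_+(s)=e^{2\beta\xi_i}\Big(\frac{s-\alpha}{s+\alpha}\Big)^\beta\qquad(\alpha<s<c_i),$$ $$\varphi_-(s)=-2\alpha\beta e^{2\beta\xi_i}\frac{(-s-\alpha)^{\beta-1}}{(-s+\alpha)^{\beta+1}},\quad \psi_-(s)=-e^{2\beta\xi_i}\Big(\frac{-s-\alpha}{-s+\alpha}\Big)^\beta\qquad(-c_i<s<-\alpha),$$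 one has $v=v_*+r$ in $\Omega\setminus\overline D$, where $$v_*(\mathbf x)=-r_*^2\tau\Big[C_1\int_\alpha^{c_i}\ln|\mathbf x-\mathbf s|\,\varphi_+(s)\,ds+C_2\int_\alpha^{c_i}\Big(\frac{\partial}{\partial x_2}\ln|\mathbf x-\mathbf s|\Big)\psi_+(s)\,ds\Big],$$ $r$ is differentiable in $\Omega\setminus\overline D$, and $\|\mathbf e_\xi\cdot\nabla r\|_{L^\infty(\Omega\setminus\overline D)}$ is bounded independently of $(\epsilon,k)$. Alternatively, $v=\widetilde v_*+\widetilde r$ in $\Omega\setminus\overline D$, where $$\widetilde v_*(\mathbf x)=-r_*^2\tau\Big[C_1\int_{-c_i}^{-\alpha}\ln|\mathbf x-\mathbf s|\,\varphi_-(s)\,ds+C_2\int_{-c_i}^{-\alpha}\Big(\frac{\partial}{\partial x_2}\ln|\mathbf x-\mathbf s|\Big)\psi_-(s)\,ds\Big],$$ $\widetilde r$ is differentiable in $\Omega\setminus\overline D$, and $\|\mathbf e_\xi\cdot\nabla\widetilde r\|_{L^\infty(\Omega\setminus\overline D)}$ is bounded independently of $(\epsilon,k)$. All bounds may depend on $r_e$,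 $r_i$ and $g_d$ (and on $K$, respectively $\epsilon_0$, where indicated), but not on $\epsilon$ and $k$. -/

import Mathlib

open Filter Topology Metric Set
open scoped NNReal

/-!
The Euclidean plane is identified with `ℂ`, the point `(x₁, x₂)` being `x₁ + i x₂`; the real inner
product of `ℂ` is the Euclidean one.

Two circles of radii `0 < rᵢ < rₑ` are given, `ε` is the distance of the inner disk `D` to the outer
circle `∂Ω`, with `0 < ε < rₑ - rᵢ`.
-/

namespace ImageCharge

noncomputable section

/-- `r_* = √(2 rᵢ rₑ / (rₑ - rᵢ))`. -/
def rStar (re ri : ℝ) : ℝ := √(2 * ri * re / (re - ri))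

/-- `τ = (k - 1) / (k + 1)`. -/
def tau (k : ℝ) : ℝ := (k - 1) / (k + 1)

/-- The abscissa `cᵢ` of the centre of `D`. -/
def cI (re ri ε : ℝ) : ℝ :=
  (re ^ 2 - ri ^ 2 - (re - ri - ε) ^ 2) / (2 * (re - ri - ε))

/-- The abscissa `cₑ` of the centre of `Ω`. -/
def cE (re ri ε : ℝ) : ℝ := cI re ri ε + re - ri - ε

/-- The translation distance `x₀` from the disk of centre `(rₑ, 0)` and radius `rₑ`, which does not
depend on `ε`, to `Ω`. -/
def xZero (re ri ε : ℝ) : ℝ := cE re ri ε - re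

/-- The poles of the bipolar coordinates are `(±α, 0)`. -/
def alpha (re ri ε : ℝ) : ℝ :=
  √(ε * (2 * ri + ε) * (2 * re - ε) * (2 * re - 2 * ri - ε)) / (2 * (re - ri - ε))

/-- The value `ξᵢ` of the bipolar coordinate `ξ` on `∂D`. -/
def xiI (re ri ε : ℝ) : ℝ :=
  1 / 2 * Real.log ((cI re ri ε + alpha re ri ε) / (cI re ri ε - alpha re ri ε))

/-- `β = r_* (- ln |τ|) / (4 √ε)`. -/
def beta (re ri ε k : ℝ) : ℝ := rStar re ri * (-Real.log |tau k|) / (4 * √ε)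

/-- The outer disk `Ω`, of centre `(cₑ, 0)` and radius `rₑ`. -/
def Omega (re ri ε : ℝ) : Set ℂ := ball (cE re ri ε : ℂ) re

/-- The inclusion `D`, of centre `(cᵢ, 0)` and radius `rᵢ`. -/
def Incl (re ri ε : ℝ) : Set ℂ := ball (cI re ri ε : ℂ) ri

/-- The bipolar coordinate `ξ` with poles `(±α, 0)`: the logarithm of the modulus of
`(α + z) / (α - z) = exp (ξ + i θ)`. -/
def xiCoord (α : ℝ) (z : ℂ) : ℝ := Real.log ‖((α : ℂ) + z) / ((α : ℂ) - z)‖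

/-- The unit vector field `e_ξ = ∇ξ / |∇ξ|`. -/
def eXi (α : ℝ) (z : ℂ) : ℂ := ‖gradient (xiCoord α) z‖⁻¹ • gradient (xiCoord α) z

/-- The function `g` on the circle of centre `c` and radius `r` is of class `C^{2,δ}`. -/
def C2HolderOnCircle (c : ℂ) (r : ℝ) (δ : ℝ≥0) (g : ℂ → ℝ) : Prop :=
  ContDiff ℝ 2 (fun t : ℝ => g (circleMap c r t)) ∧
    ∃ K : ℝ≥0, HolderWith K δ (iteratedDeriv 2 (fun t : ℝ => g (circleMap c r t)))

/-- The double-layer potential `(1/2π) ∫ ∂/∂ν_ζ (ln |x - ζ|) φ(ζ) dσ(ζ)` of the density `φ` on the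
circle of centre `c` and radius `r`, in the arc-length parametrization `dσ = r dt`. -/
def doubleLayer (c : ℂ) (r : ℝ) (φ : ℂ → ℝ) (x : ℂ) : ℝ :=
  1 / (2 * Real.pi) * ∫ t in (0 : ℝ)..(2 * Real.pi),
    fderiv ℝ (fun ζ : ℂ => Real.log ‖x - ζ‖) (circleMap c r t) (Complex.exp (t * Complex.I))
      * φ (circleMap c r t) * r

/-- `H_d = 2 𝒟[g_d]`, on the disk of centre `(rₑ, 0)` and radius `rₑ`. -/
def Hd (re : ℝ) (g : ℂ → ℝ) (x : ℂ) : ℝ := 2 * doubleLayer (re : ℂ) re g x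

/-- `v` is a solution of the transmission problem with Dirichlet data: `v` is harmonic in
`D ∪ (Ω \ D̄)`, continuous on the closure of `Ω` (so the traces of `v` on both sides of `∂D` agree),
its one-sided normal derivatives `lim_{t → 0+} ν · ∇v (x ± t ν)` exist on `∂D` and satisfy
`∂v/∂ν|₊ = k ∂v/∂ν|₋`, and `v = g_d` on `∂Ω`. The datum `g` lives on the circle of centre `(rₑ, 0)`,
which does not depend on `ε`, and is transported to `∂Ω` by the translation by `(x₀, 0)`. -/
structure IsDirichletSolution (re ri ε k : ℝ) (g : ℂ → ℝ) (v : ℂ → ℝ) : Prop where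
  harmonic : InnerProductSpace.HarmonicOnNhd v
    (Incl re ri ε ∪ (Omega re ri ε \ closure (Incl re ri ε)))
  continuousOn : ContinuousOn v (closure (Omega re ri ε))
  transmission : ∀ x ∈ sphere (cI re ri ε : ℂ) ri, ∀ ν : ℂ, ν = ri⁻¹ • (x - (cI re ri ε : ℂ)) →
    ∃ dPlus dMinus : ℝ,
      Tendsto (fun t : ℝ => inner ℝ ν (gradient v (x + t • ν))) (𝓝[>] 0) (𝓝 dPlus) ∧
      Tendsto (fun t : ℝ => inner ℝ ν (gradient v (x - t • ν))) (𝓝[>] 0) (𝓝 dMinus) ∧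
      dPlus = k * dMinus
  boundary : ∀ x ∈ sphere (cE re ri ε : ℂ) re, v x = g (x - (xZero re ri ε : ℂ))

/-- `φ₊`, on `α < s < cᵢ`. -/
def phiPlus (re ri ε k s : ℝ) : ℝ :=
  2 * alpha re ri ε * beta re ri ε k * Real.exp (2 * beta re ri ε k * xiI re ri ε)
    * ((s - alpha re ri ε) ^ (beta re ri ε k - 1) / (s + alpha re ri ε) ^ (beta re ri ε k + 1))

/-- `ψ₊`, on `α < s < cᵢ`. -/
def psiPlus (re ri ε k s : ℝ) : ℝ :=
  Real.exp (2 * beta re ri ε k * xiI re ri ε)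
    * ((s - alpha re ri ε) / (s + alpha re ri ε)) ^ beta re ri ε k

/-- `φ₋`, on `-cᵢ < s < -α`. -/
def phiMinus (re ri ε k s : ℝ) : ℝ :=
  -(2 * alpha re ri ε * beta re ri ε k * Real.exp (2 * beta re ri ε k * xiI re ri ε)
    * ((-s - alpha re ri ε) ^ (beta re ri ε k - 1) / (-s + alpha re ri ε) ^ (beta re ri ε k + 1)))

/-- `ψ₋`, on `-cᵢ < s < -α`. -/
def psiMinus (re ri ε k s : ℝ) : ℝ :=
  -(Real.exp (2 * beta re ri ε k * xiI re ri ε)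
    * ((-s - alpha re ri ε) / (-s + alpha re ri ε)) ^ beta re ri ε k)

/-- `∂/∂x₂ ln |x - s|` for the point `s = (s, 0)`. -/
def dLog (s : ℝ) (x : ℂ) : ℝ :=
  fderiv ℝ (fun y : ℂ => Real.log ‖y - (s : ℂ)‖) x Complex.I

/-- The potential `v_*` of the charges on `[α, cᵢ]`. -/
def vStar (re ri ε k C₁ C₂ : ℝ) (x : ℂ) : ℝ :=
  -(rStar re ri ^ 2 * tau k) *
    (C₁ * (∫ s in (alpha re ri ε)..(cI re ri ε), Real.log ‖x - (s : ℂ)‖ * phiPlus re ri ε k s) +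
     C₂ * (∫ s in (alpha re ri ε)..(cI re ri ε), dLog s x * psiPlus re ri ε k s))

/-- The potential `ṽ_*` of the charges on `[-cᵢ, -α]`. -/
def vStarTilde (re ri ε k C₁ C₂ : ℝ) (x : ℂ) : ℝ :=
  -(rStar re ri ^ 2 * tau k) *
    (C₁ * (∫ s in (-cI re ri ε)..(-alpha re ri ε),
        Real.log ‖x - (s : ℂ)‖ * phiMinus re ri ε k s) +
     C₂ * (∫ s in (-cI re ri ε)..(-alpha re ri ε), dLog s x * psiMinus re ri ε k s))

end

end ImageCharge

/-! The problem is solved exactly by image charges, and the images are then summed. Since `g` is of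
class `C^{2,δ}` with `δ > 1/2`, Bernstein's theorem makes `∑ n² |ĝ(n)|` finite. Hence `H_d` is the
real part of a function `F`, holomorphic in the disk and continuous up to the circle with `Re F = g`
there, whose derivative `f` is bounded and Lipschitz (`exists_isHolomorphicExtension`). The gradient
of `H_d` at `0` is encoded in `f 0 = C₁ - i C₂`.

Both circles are level lines of `ξ`. The Möbius maps `flow α y`, which multiply `(α + z) / (α - z)`
by `1/y`, obey a semigroup law, move points along the lines `θ = const` towards `α` as `y` decreases
from `1` to `0`, and map each disk into itself. The reflection in `∂D` moves points along the same
lines, so it is a flow whose parameter `σ(z)` (`reflPar`) depends on the point: it is `1` on `∂D`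
and a constant `κ` on `∂Ω`. Put `A(z) = (1-τ) ∑ τⁿ F(flow (κⁿ) z - x₀)`. Then `A - τ A ∘ flow κ =
(1-τ) F(· - x₀)`. The function equal to `Re A` in `D` and to `Re (A - τ conj (A ∘ refl)) / (1-τ)`
outside takes the right values on `∂Ω`, is continuous across `∂D`, and its normal derivatives there
have ratio `(1+τ)/(1-τ) = k`. Every solution coincides with it, by a maximum principle with `ξ` as
barrier (`IsDirichletSolution.eqOn`).

For (a), the flow and its derivative have bounded total variation along a flow line, uniformly in
`α` (`norm_flow_sub_le`, `norm_flowD_sub_le`); summation by parts bounds `A'` for all `|τ| < 1`.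
Outside `D` only the factor `1/(1-τ) = (k+1)/2` is lost. Alternatively, `|flowD| ≤ 4 κⁿ` gives a
bound by `1/(1-κ)`, which is controlled when `ε ≥ ε₀`.

For (b), the reflection reverses `e_ξ`, so the `ξ`-derivative of `v` is the real part of `e_ξ` times
two series of images that add up, started at the parameters `1` and `σ(z)`
(`inner_xiDir_outerPotD`). Up to bounded errors, `f` is frozen at `0` (`norm_imgSum_sub_le`), the
starting parameter is replaced by any `s ≥ κ^m` with `m` bounded (`norm_flowSum_sub_le`), the series
by an integral with weight `y^b`, where `κ^b = τ` (`norm_flowInt_sub_flowSum_le`), and finally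
`1/(-log κ)` by `r_*²/(4α)` in the prefactor and by `r_*/(4√ε)` in the exponent, which makes it `β`.
On the other side, integration by parts and a Möbius substitution turn the gradients of `v_*` and
`ṽ_*` into the same integral, with `s = σ(z)` and `s = (cᵢ-α)/(cᵢ+α)` respectively, plus the field
of one point charge at `±cᵢ`, at distance at least `rᵢ`. When `ε ≥ (rₑ-rᵢ)/2` all terms are bounded
separately. -/

namespace ImageCharge

noncomputable section

/-! ### Fourier coefficients on the line -/

/-- The `n`-th Fourier coefficient of a `2π`-periodic function on the line. -/
def fc (φ : ℝ → ℂ) (n : ℤ) : ℂ :=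
  (1 / (2 * Real.pi) : ℂ) * ∫ t in (0 : ℝ)..(2 * Real.pi), Complex.exp (-(n * t * Complex.I)) * φ t

lemma fourierCoeffOn_eq_fc (φ : ℝ → ℂ) (n : ℤ) :
    fourierCoeffOn Real.two_pi_pos φ n = fc φ n := by
  rw [fourierCoeffOn_eq_integral, fc, Complex.real_smul]
  congr 1
  · push_cast; simp
  · apply intervalIntegral.integral_congr
    intro t _
    have : (Real.pi : ℂ) ≠ 0 := by exact_mod_cast Real.pi_ne_zero
    simp only [fourier_coe_apply, smul_eq_mul]
    congr 2
    push_cast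
    field_simp
    ring

/-- Bessel's inequality, in the form in which it is applied to the increment of a Hölder function.
-/
lemma sum_sq_norm_fc_le {φ : ℝ → ℂ} (hφ : Continuous φ) {C : ℝ} (hC : ∀ t, ‖φ t‖ ≤ C)
    (s : Finset ℤ) : ∑ n ∈ s, ‖fc φ n‖ ^ 2 ≤ C ^ 2 := by
  have hL2 : MeasureTheory.MemLp φ 2
      (MeasureTheory.volume.restrict (Ioc (0 : ℝ) (2 * Real.pi))) :=
    MeasureTheory.MemLp.of_bound hφ.aestronglyMeasurable C (Eventually.of_forall hC)
  have h := hasSum_sq_fourierCoeffOn Real.two_pi_pos hL2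
  have h1 := sum_le_hasSum s (fun i _ => by positivity) h
  simp only [fourierCoeffOn_eq_fc] at h1
  refine h1.trans ?_
  have h2 : ∫ x in (0 : ℝ)..(2 * Real.pi), ‖φ x‖ ^ 2 ≤ ∫ x in (0 : ℝ)..(2 * Real.pi), C ^ 2 := by
    apply intervalIntegral.integral_mono_on Real.two_pi_pos.le
    · exact (by fun_prop : Continuous fun x => ‖φ x‖ ^ 2).intervalIntegrable _ _
    · exact intervalIntegrable_const
    · intro x _
      exact pow_le_pow_left₀ (norm_nonneg _) (hC x) 2
  rw [intervalIntegral.integral_const, smul_eq_mul, sub_zero] at h2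
  rw [smul_eq_mul, sub_zero]
  have hp := Real.two_pi_pos
  calc (2 * Real.pi)⁻¹ * ∫ x in (0 : ℝ)..(2 * Real.pi), ‖φ x‖ ^ 2
      ≤ (2 * Real.pi)⁻¹ * (2 * Real.pi * C ^ 2) := by gcongr
    _ = C ^ 2 := by field_simp

lemma exp_neg_periodic (n : ℤ) :
    Function.Periodic (fun t : ℝ => Complex.exp (-(n * t * Complex.I))) (2 * Real.pi) := by
  intro t
  have : -((n : ℂ) * ((t + 2 * Real.pi : ℝ) : ℂ) * Complex.I)
      = -(n * t * Complex.I) + ((-n : ℤ) : ℂ) * (2 * Real.pi * Complex.I) := by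
    push_cast; ring
  simp only [this, Complex.exp_add, Complex.exp_int_mul_two_pi_mul_I, mul_one]

lemma fc_shift {φ : ℝ → ℂ} (hp : Function.Periodic φ (2 * Real.pi)) (h : ℝ) (n : ℤ) :
    fc (fun t => φ (t + h)) n = Complex.exp (n * h * Complex.I) * fc φ n := by
  have key : ∫ t in (0 : ℝ)..(2 * Real.pi), Complex.exp (-(n * t * Complex.I)) * φ (t + h)
      = Complex.exp (n * h * Complex.I) *
        ∫ t in (0 : ℝ)..(2 * Real.pi), Complex.exp (-(n * t * Complex.I)) * φ t := by
    have h1 : ∀ t : ℝ, Complex.exp (-(n * t * Complex.I)) * φ (t + h)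
        = Complex.exp (n * h * Complex.I) *
          (fun x : ℝ => Complex.exp (-(n * x * Complex.I)) * φ x) (t + h) := by
      intro t
      simp only [← mul_assoc, ← Complex.exp_add]
      congr 2
      push_cast; ring
    simp only [h1]
    rw [intervalIntegral.integral_const_mul,
      intervalIntegral.integral_comp_add_right
        (fun x : ℝ => Complex.exp (-(n * x * Complex.I)) * φ x) h]
    congr 1
    have hper : Function.Periodic (fun x : ℝ => Complex.exp (-(n * x * Complex.I)) * φ x)
        (2 * Real.pi) := (exp_neg_periodic n).mul hp
    have := hper.intervalIntegral_add_eq h 0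
    simpa [add_comm] using this
  rw [fc, key, fc]; ring

lemma fc_sub {φ ψ : ℝ → ℂ} (hφ : Continuous φ) (hψ : Continuous ψ) (n : ℤ) :
    fc (fun t => φ t - ψ t) n = fc φ n - fc ψ n := by
  simp only [fc, mul_sub]
  rw [intervalIntegral.integral_sub]
  · ring
  all_goals exact (by fun_prop : Continuous _).intervalIntegrable _ _

lemma fc_deriv {φ φ' : ℝ → ℂ} (hp : Function.Periodic φ (2 * Real.pi))
    (hd : ∀ t, HasDerivAt φ (φ' t) t) (hc : Continuous φ') (n : ℤ) :
    fc φ' n = n * Complex.I * fc φ n := by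
  have hcφ : Continuous φ := continuous_iff_continuousAt.2 fun t => (hd t).continuousAt
  have hder : ∀ t : ℝ, HasDerivAt (fun t : ℝ => Complex.exp (-(n * t * Complex.I)) * φ t)
      (Complex.exp (-(n * t * Complex.I)) * φ' t
        - n * Complex.I * (Complex.exp (-(n * t * Complex.I)) * φ t)) t := by
    intro t
    have h1 : HasDerivAt (fun t : ℝ => -((n : ℂ) * t * Complex.I)) (-(n * Complex.I)) t := by
      exact (((Complex.ofRealCLM.hasDerivAt (x := t)).const_mul (n : ℂ)).mul_const
        Complex.I).neg.congr_deriv (by simp)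
    convert! h1.cexp.mul (hd t) using 1
    ring
  have h0 := intervalIntegral.integral_eq_sub_of_hasDerivAt (a := 0) (b := 2 * Real.pi)
    (fun t _ => hder t) ((by fun_prop : Continuous _).intervalIntegrable _ _)
  have hz : Complex.exp (-(n * ((2 * Real.pi : ℝ) : ℂ) * Complex.I)) * φ (2 * Real.pi)
      - Complex.exp (-(n * ((0 : ℝ) : ℂ) * Complex.I)) * φ 0 = 0 := by
    have h1 := exp_neg_periodic n 0
    have h2 := hp 0
    simp only [zero_add] at h1 h2
    rw [h1, h2, sub_self]
  rw [hz, intervalIntegral.integral_sub ((by fun_prop : Continuous _).intervalIntegrable _ _)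
    ((by fun_prop : Continuous _).intervalIntegrable _ _), intervalIntegral.integral_const_mul] at h0
  simp only [fc]
  rw [sub_eq_zero.1 h0]
  ring

lemma one_le_norm_exp_sub_one {x : ℝ} (h1 : 2 * Real.pi / 3 ≤ x) (h2 : x ≤ 4 * Real.pi / 3) :
    1 ≤ ‖Complex.exp (x * Complex.I) - 1‖ := by
  have hpi := Real.pi_pos
  have hc : Real.cos x ≤ 0 := Real.cos_nonpos_of_pi_div_two_le_of_le (by linarith) (by linarith)
  have hr : (Complex.exp (x * Complex.I) - 1).re = Real.cos x - 1 := by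
    simp [Complex.exp_ofReal_mul_I_re]
  have := Complex.abs_re_le_norm (Complex.exp (x * Complex.I) - 1)
  rw [hr, abs_of_nonpos (by linarith)] at this
  linarith

/-- Bernstein's theorem: the Fourier coefficients of a periodic function which is Hölder continuous
of exponent `> 1/2` are absolutely summable. -/
lemma summable_norm_fc {φ : ℝ → ℂ} (hp : Function.Periodic φ (2 * Real.pi)) (hc : Continuous φ)
    {K δ : ℝ} (hK : 0 ≤ K) (hδ : 1 / 2 < δ)
    (hH : ∀ t h : ℝ, 0 ≤ h → ‖φ (t + h) - φ t‖ ≤ K * h ^ δ) :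
    Summable fun n : ℕ => ‖fc φ n‖ := by
  have hpi := Real.pi_pos
  -- With this shift, `n h` lies in `[2π/3, 4π/3]` for all `n` of the dyadic block `[2^j, 2^(j+1))`.
  -- There `|e^{inh} - 1| ≥ 1`, so Bessel's inequality for `φ(· + h) - φ` controls the whole block.
  set H : ℕ → ℝ := fun j => 2 * Real.pi / 3 / 2 ^ j with hHdef
  have hHpos : ∀ j, 0 < H j := fun j => by positivity
  have block2 : ∀ j : ℕ, ∑ n ∈ Finset.Ico ((2 : ℕ) ^ j) (2 ^ (j + 1)), ‖fc φ (n : ℤ)‖ ^ 2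
      ≤ (K * H j ^ δ) ^ 2 := by
    intro j
    have hb := sum_sq_norm_fc_le (φ := fun t => φ (t + H j) - φ t) (by fun_prop)
      (fun t => hH t (H j) (hHpos j).le)
      ((Finset.Ico (2 ^ j) (2 ^ (j + 1))).map (Nat.castEmbedding (R := ℤ)))
    rw [Finset.sum_map] at hb
    refine le_trans (Finset.sum_le_sum fun n hn => ?_) hb
    rw [Finset.mem_Ico] at hn
    have e : fc (fun t => φ (t + H j) - φ t) (n : ℤ)
        = (Complex.exp (((n * H j : ℝ) : ℂ) * Complex.I) - 1) * fc φ n := by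
      rw [fc_sub (by fun_prop) hc, fc_shift hp]
      push_cast; ring
    simp only [Nat.castEmbedding_apply]
    rw [e, norm_mul, mul_pow]
    have h2j : (0 : ℝ) < 2 ^ j := by positivity
    have hn1 : (2 : ℝ) ^ j ≤ n := by exact_mod_cast hn.1
    have hn2 : (n : ℝ) ≤ 2 ^ j * 2 := by
      have := hn.2.le; rw [pow_succ] at this; exact_mod_cast this
    have h1 : 1 ≤ ‖Complex.exp (((n * H j : ℝ) : ℂ) * Complex.I) - 1‖ := by
      apply one_le_norm_exp_sub_one
      · calc 2 * Real.pi / 3 = 2 ^ j * H j := by simp only [hHdef]; field_simp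
          _ ≤ n * H j := by gcongr
      · calc n * H j ≤ (2 ^ j * 2) * H j := by gcongr
          _ = 4 * Real.pi / 3 := by simp only [hHdef]; field_simp; norm_num
    have h3 : (0 : ℝ) ≤ ‖fc φ (n : ℤ)‖ ^ 2 := by positivity
    nlinarith [one_le_pow₀ (n := 2) h1]
  -- The Cauchy–Schwarz inequality on a block of `2^j` terms costs `2^(j/2)` and the Hölder
  -- condition gains `2^(-jδ)`: the ratio `q` is below `1` because `δ > 1/2`.
  set q : ℝ := 2 ^ (1 / 2 - δ) with hq
  have hq0 : 0 < q := by positivity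
  have hq1 : q < 1 := Real.rpow_lt_one_of_one_lt_of_neg (by norm_num) (by linarith)
  have block1 : ∀ j : ℕ, ∑ n ∈ Finset.Ico ((2 : ℕ) ^ j) (2 ^ (j + 1)), ‖fc φ (n : ℤ)‖
      ≤ K * (2 * Real.pi / 3) ^ δ * q ^ j := by
    intro j
    have hcs := sq_sum_le_card_mul_sum_sq (s := Finset.Ico (2 ^ j) (2 ^ (j + 1)))
      (f := fun n : ℕ => ‖fc φ (n : ℤ)‖)
    have hcard : ((Finset.Ico (2 ^ j) (2 ^ (j + 1)) : Finset ℕ).card : ℝ) = 2 ^ j := by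
      rw [Nat.card_Ico, pow_succ, mul_two, Nat.add_sub_cancel]; push_cast; rfl
    rw [hcard] at hcs
    have hq2 : K * (2 * Real.pi / 3) ^ δ * q ^ j = √(2 ^ j) * (K * H j ^ δ) := by
      have e1 : q ^ j = √(2 ^ j) * (((2 : ℝ) ^ j) ^ δ)⁻¹ := by
        rw [hq, Real.sqrt_eq_rpow, ← Real.rpow_natCast, ← Real.rpow_natCast, ← Real.rpow_mul (by norm_num),
          ← Real.rpow_mul (by norm_num), ← Real.rpow_mul (by norm_num),
          ← Real.rpow_neg (by norm_num), ← Real.rpow_add (by norm_num)]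
        congr 1; ring
      have e2 : H j ^ δ = (2 * Real.pi / 3) ^ δ * (((2 : ℝ) ^ j) ^ δ)⁻¹ := by
        simp only [hHdef]
        rw [Real.div_rpow (by positivity) (by positivity), div_eq_mul_inv]
      rw [e1, e2]; ring
    rw [hq2]
    apply le_of_sq_le_sq _ (by positivity)
    rw [mul_pow, Real.sq_sqrt (by positivity)]
    exact hcs.trans (by gcongr; exact block2 j)
  have hgeo : Summable fun j => K * (2 * Real.pi / 3) ^ δ * q ^ j :=
    (summable_geometric_of_lt_one hq0.le hq1).mul_left _
  have hdy : ∀ J : ℕ, ∑ n ∈ Finset.range (2 ^ J), ‖fc φ (n : ℤ)‖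
      ≤ ‖fc φ 0‖ + ∑ j ∈ Finset.range J, K * (2 * Real.pi / 3) ^ δ * q ^ j := by
    intro J
    induction J with
    | zero => simp
    | succ J ih =>
      rw [Finset.sum_range_succ, ← add_assoc,
        ← Finset.sum_range_add_sum_Ico _ (Nat.pow_le_pow_right (by norm_num) (Nat.le_succ J))]
      exact add_le_add ih (block1 J)
  refine summable_of_sum_range_le (c := ‖fc φ 0‖ + ∑' j, K * (2 * Real.pi / 3) ^ δ * q ^ j)
    (fun n => norm_nonneg _) fun n => ?_
  calc ∑ i ∈ Finset.range n, ‖fc φ (i : ℤ)‖ ≤ ∑ i ∈ Finset.range (2 ^ n), ‖fc φ (i : ℤ)‖ :=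
        Finset.sum_le_sum_of_subset_of_nonneg
          (Finset.range_subset_range.2 Nat.lt_two_pow_self.le) (fun _ _ _ => norm_nonneg _)
    _ ≤ _ := (hdy n).trans (by
        gcongr
        exact hgeo.sum_le_tsum _ (fun j _ => by positivity))

/-! ### Power series with coefficients `O(n⁻²)` in the summable sense -/

lemma norm_pow_sub_pow_le {z w : ℂ} (hz : ‖z‖ ≤ 1) (hw : ‖w‖ ≤ 1) (n : ℕ) :
    ‖z ^ n - w ^ n‖ ≤ n * ‖z - w‖ := by
  induction n with
  | zero => simp
  | succ n ih =>
    have e : z ^ (n + 1) - w ^ (n + 1) = z * (z ^ n - w ^ n) + (z - w) * w ^ n := by ring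
    rw [e]
    refine (norm_add_le _ _).trans ?_
    rw [norm_mul, norm_mul, norm_pow]
    have h1 : ‖z‖ * ‖z ^ n - w ^ n‖ ≤ 1 * (n * ‖z - w‖) := by gcongr
    have h2 : ‖z - w‖ * ‖w‖ ^ n ≤ ‖z - w‖ * 1 := by
      gcongr; exact pow_le_one₀ (norm_nonneg _) hw
    push_cast
    linarith

lemma summable_norm_of_sq {a : ℕ → ℂ} (ha : Summable fun n : ℕ => (n : ℝ) ^ 2 * ‖a n‖) :
    Summable fun n : ℕ => ‖a n‖ := by
  -- The weight `n²` gives no information at `n = 0`, so the comparison starts at `n = 1`.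
  refine (summable_nat_add_iff 1).1 ?_
  refine Summable.of_nonneg_of_le (fun _ => norm_nonneg _) (fun n => ?_)
    ((summable_nat_add_iff 1).2 ha)
  have : (1 : ℝ) ≤ ((n + 1 : ℕ) : ℝ) := by push_cast; linarith [(n.cast_nonneg : (0 : ℝ) ≤ n)]
  nlinarith [norm_nonneg (a (n + 1)), one_le_pow₀ (n := 2) this]

lemma summable_nat_mul_norm_of_sq {a : ℕ → ℂ} (ha : Summable fun n : ℕ => (n : ℝ) ^ 2 * ‖a n‖) :
    Summable fun n : ℕ => (n : ℝ) * ‖a n‖ := by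
  refine Summable.of_nonneg_of_le (fun _ => by positivity) (fun n => ?_) ha
  have : (n : ℝ) ≤ (n : ℝ) ^ 2 := by exact_mod_cast Nat.le_self_pow two_ne_zero n
  gcongr

lemma continuousOn_powerSum {a : ℕ → ℂ} (ha : Summable fun n : ℕ => ‖a n‖) :
    ContinuousOn (fun z : ℂ => ∑' n, a n * z ^ n) (closedBall 0 1) := by
  refine continuousOn_tsum (fun n => by fun_prop) ha fun n z hz => ?_
  rw [mem_closedBall_zero_iff] at hz
  rw [norm_mul, norm_pow]
  exact mul_le_of_le_one_right (norm_nonneg _) (pow_le_one₀ (norm_nonneg _) hz)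

lemma norm_derivTerm_le (a : ℕ → ℂ) {z : ℂ} (hz : ‖z‖ ≤ 1) (n : ℕ) :
    ‖a n * (n * z ^ (n - 1))‖ ≤ n * ‖a n‖ := by
  rw [norm_mul, norm_mul, norm_pow, Complex.norm_natCast, mul_comm]
  gcongr
  exact mul_le_of_le_one_right (by positivity) (pow_le_one₀ (norm_nonneg _) hz)

lemma hasDerivAt_powerSum {a : ℕ → ℂ} (ha : Summable fun n : ℕ => ‖a n‖)
    (ha1 : Summable fun n : ℕ => (n : ℝ) * ‖a n‖) {z : ℂ} (hz : ‖z‖ < 1) :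
    HasDerivAt (fun z : ℂ => ∑' n, a n * z ^ n) (∑' n, a n * (n * z ^ (n - 1))) z := by
  refine hasDerivAt_tsum_of_isPreconnected (t := ball (0 : ℂ) 1) ha1 isOpen_ball
    (convex_ball _ _).isPreconnected (fun n y _ => (hasDerivAt_pow n y).const_mul _)
    (fun n y hy => norm_derivTerm_le a (mem_ball_zero_iff.1 hy).le n)
    (y₀ := 0) (mem_ball_self one_pos) ?_ (mem_ball_zero_iff.2 hz)
  refine Summable.of_norm_bounded ha fun n => ?_
  rw [norm_mul, norm_pow]
  exact mul_le_of_le_one_right (norm_nonneg _) (pow_le_one₀ (norm_nonneg _) (by simp))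

lemma norm_derivSum_le {a : ℕ → ℂ} (ha1 : Summable fun n : ℕ => (n : ℝ) * ‖a n‖)
    {z : ℂ} (hz : ‖z‖ ≤ 1) :
    ‖∑' n, a n * (n * z ^ (n - 1))‖ ≤ ∑' n : ℕ, (n : ℝ) * ‖a n‖ :=
  tsum_of_norm_bounded ha1.hasSum (norm_derivTerm_le a hz)

/-- Boundedness of the derivative costs one factor `n`; its Lipschitz continuity up to the circle
costs a second one. -/
lemma norm_derivSum_sub_le {a : ℕ → ℂ} (ha : Summable fun n : ℕ => (n : ℝ) ^ 2 * ‖a n‖)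
    {z w : ℂ} (hz : ‖z‖ ≤ 1) (hw : ‖w‖ ≤ 1) :
    ‖(∑' n, a n * (n * z ^ (n - 1))) - ∑' n, a n * (n * w ^ (n - 1))‖
      ≤ (∑' n : ℕ, (n : ℝ) ^ 2 * ‖a n‖) * ‖z - w‖ := by
  have ha1 := summable_nat_mul_norm_of_sq ha
  rw [← Summable.tsum_sub (.of_norm_bounded ha1 (norm_derivTerm_le a hz))
    (.of_norm_bounded ha1 (norm_derivTerm_le a hw)), ← tsum_mul_right]
  refine tsum_of_norm_bounded (ha.mul_right _).hasSum fun n => ?_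
  rw [← mul_sub, ← mul_sub, norm_mul, norm_mul, Complex.norm_natCast]
  have h1 := norm_pow_sub_pow_le hz hw (n - 1)
  have h2 : ((n - 1 : ℕ) : ℝ) ≤ n := by exact_mod_cast Nat.sub_le n 1
  calc ‖a n‖ * (n * ‖z ^ (n - 1) - w ^ (n - 1)‖) ≤ ‖a n‖ * (n * (n * ‖z - w‖)) := by
        gcongr; exact h1.trans (by gcongr)
    _ = _ := by ring

/-! ### Fourier inversion and the double layer potential on a circle -/

lemma fc_ofReal_neg (G : ℝ → ℝ) (n : ℤ) :
    fc (fun t => (G t : ℂ)) (-n) = (starRingEnd ℂ) (fc (fun t => (G t : ℂ)) n) := by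
  simp only [fc, map_mul]
  congr 1
  · simp [Complex.conj_ofNat]
  · rw [intervalIntegral.integral_of_le Real.two_pi_pos.le,
      intervalIntegral.integral_of_le Real.two_pi_pos.le, ← integral_conj]
    congr 1
    ext t
    rw [map_mul, ← Complex.exp_conj]
    simp

lemma hasSum_fc {φ : ℝ → ℂ} (hp : Function.Periodic φ (2 * Real.pi)) (hc : Continuous φ)
    (hs : Summable fun n : ℤ => ‖fc φ n‖) (t : ℝ) :
    HasSum (fun n : ℤ => fc φ n * Complex.exp (n * t * Complex.I)) (φ t) := by
  have : Fact (0 < 2 * Real.pi) := ⟨Real.two_pi_pos⟩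
  have hlc : Continuous hp.lift := hc.quotient_liftOn' _
  let f : C(AddCircle (2 * Real.pi), ℂ) := ⟨hp.lift, hlc⟩
  have hco : ∀ n, fourierCoeff f n = fc φ n := by
    intro n
    rw [fourierCoeff_eq_intervalIntegral _ n 0, fc, Complex.real_smul]
    congr 1
    · push_cast; simp
    · rw [zero_add]
      apply intervalIntegral.integral_congr
      intro x _
      have : (Real.pi : ℂ) ≠ 0 := by exact_mod_cast Real.pi_ne_zero
      simp only [fourier_coe_apply, smul_eq_mul]
      congr 2
      push_cast
      field_simp
  have hsum : Summable (fourierCoeff f) := by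
    refine Summable.of_norm ?_
    simpa only [hco] using hs
  have h := has_pointwise_sum_fourier_series_of_summable hsum (t : AddCircle (2 * Real.pi))
  simp only [hco, smul_eq_mul] at h
  convert! h using 1
  ext n
  congr 1
  have : (Real.pi : ℂ) ≠ 0 := by exact_mod_cast Real.pi_ne_zero
  rw [fourier_coe_apply]
  congr 1
  push_cast
  field_simp

/-- The coefficients of a real function at `n` and `-n` are conjugate, so the Fourier series is the
real part of twice its nonnegative half. The coefficient at `0` would be counted twice; the
mean-zero condition removes it. -/
lemma re_tsum_fc {G : ℝ → ℝ} (hp : Function.Periodic G (2 * Real.pi)) (hc : Continuous G)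
    (h0 : fc (fun t => (G t : ℂ)) 0 = 0)
    (hs : Summable fun n : ℕ => ‖fc (fun t => (G t : ℂ)) n‖) (t : ℝ) :
    (∑' n : ℕ, 2 * fc (fun t => (G t : ℂ)) n * Complex.exp (t * Complex.I) ^ n).re = G t := by
  set φ : ℝ → ℂ := fun t => (G t : ℂ) with hφ
  have hpφ : Function.Periodic φ (2 * Real.pi) := fun t => by simp [hφ, hp t]
  have hsZ : Summable fun n : ℤ => ‖fc φ n‖ := by
    refine Summable.of_nat_of_neg hs ?_
    simpa only [hφ, fc_ofReal_neg, RCLike.norm_conj] using hs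
  have h := (hasSum_fc hpφ (by fun_prop) hsZ t).nat_add_neg
  rw [h0, zero_mul, add_zero] at h
  have hre := Complex.hasSum_re h
  have hsum : Summable fun n : ℕ => 2 * fc φ n * Complex.exp (t * Complex.I) ^ n := by
    refine Summable.of_norm_bounded (hs.mul_left 2) fun n => ?_
    rw [norm_mul, norm_pow, Complex.norm_exp_ofReal_mul_I]
    simp
  have hre2 := Complex.hasSum_re hsum.hasSum
  refine hre2.unique ?_
  convert! hre using 1
  ext n
  rw [hφ, fc_ofReal_neg, ← hφ]
  have e1 : Complex.exp (t * Complex.I) ^ n = Complex.exp ((n : ℤ) * t * Complex.I) := by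
    rw [← Complex.exp_nat_mul]; congr 1; push_cast; ring
  have e2 : Complex.exp ((-(n : ℤ) : ℤ) * t * Complex.I)
      = (starRingEnd ℂ) (Complex.exp ((n : ℤ) * t * Complex.I)) := by
    rw [← Complex.exp_conj]; simp
  rw [e1, e2, ← map_mul, Complex.add_re, Complex.conj_re, mul_assoc]
  simp only [Complex.mul_re, Complex.re_ofNat, Complex.im_ofNat]
  ring

lemma fderiv_log_norm_sub {x ζ : ℂ} (h : x ≠ ζ) (v : ℂ) :
    fderiv ℝ (fun ζ : ℂ => Real.log ‖x - ζ‖) ζ v = (v / (ζ - x)).re := by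
  have hne : ζ - x ≠ 0 := sub_ne_zero.2 (Ne.symm h)
  have hn : ‖ζ - x‖ ^ 2 ≠ 0 := by positivity
  have e : (fun ζ : ℂ => Real.log ‖x - ζ‖) = fun ζ : ℂ => (1 / 2) * Real.log (‖ζ - x‖ ^ 2) := by
    ext ζ; rw [Real.log_pow, norm_sub_rev]; push_cast; ring
  rw [e]
  have h1 : HasFDerivAt (fun ζ : ℂ => ‖ζ - x‖ ^ 2) (2 • (innerSL ℝ (ζ - x))) ζ := by
    simpa using ((hasFDerivAt_id ζ).sub_const x).norm_sq
  have h2 := (h1.log hn).const_mul (1 / 2 : ℝ)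
  rw [h2.fderiv]
  simp only [smul_apply, innerSL_apply_apply, smul_eq_mul, Complex.inner,
    nsmul_eq_mul]
  rw [Complex.div_re, ← Complex.normSq_eq_norm_sq]
  have : Complex.normSq (ζ - x) ≠ 0 := by simpa using hne
  simp only [Complex.mul_re, Complex.conj_re, Complex.conj_im]
  field_simp
  push_cast
  ring

/-- At `x = re + re w` the kernel times `dσ` is `Re (1 - e^{-it} w)⁻¹ dt`, a geometric series whose
integration against `g` produces the Fourier coefficients. The factor `2` in `Hd` then restores the
full harmonic extension of a mean-zero datum. -/
lemma doubleLayer_eq {re : ℝ} (hre : 0 < re) {g : ℂ → ℝ}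
    (hc : Continuous fun t : ℝ => g (circleMap re re t)) {w : ℂ} (hw : ‖w‖ < 1) :
    doubleLayer (re : ℂ) re g (re + re * w)
      = (∑' n : ℕ, fc (fun t => (g (circleMap re re t) : ℂ)) n * w ^ n).re := by
  set G : ℝ → ℝ := fun t => g (circleMap re re t) with hG
  obtain ⟨B, hB⟩ : ∃ B, ∀ t ∈ uIcc (0 : ℝ) (2 * Real.pi), ‖G t‖ ≤ B :=
    isCompact_uIcc.exists_bound_of_continuousOn hc.continuousOn
  have hre' : (re : ℂ) ≠ 0 := by exact_mod_cast hre.ne'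
  have key : HasSum (fun n : ℕ => ∫ t in (0 : ℝ)..(2 * Real.pi),
      Complex.exp (-(n * t * Complex.I)) * w ^ n * G t)
      (∫ t in (0 : ℝ)..(2 * Real.pi),
        (1 - Complex.exp (-(t * Complex.I)) * w)⁻¹ * (G t : ℂ)) := by
    refine intervalIntegral.hasSum_integral_of_dominated_convergence
      (fun n t => ‖w‖ ^ n * B) (fun n => ?_) (fun n => ?_) ?_ ?_ ?_
    · exact (by fun_prop : Continuous _).aestronglyMeasurable
    · refine Eventually.of_forall fun t ht => ?_
      rw [norm_mul, norm_mul, norm_pow]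
      have : ‖Complex.exp (-(n * t * Complex.I))‖ = 1 := by
        rw [Complex.norm_exp]; simp
      rw [this, one_mul]
      gcongr
      simpa using hB t (uIoc_subset_uIcc ht)
    · exact Eventually.of_forall fun t _ =>
        (summable_geometric_of_lt_one (norm_nonneg _) hw).mul_right _
    · exact intervalIntegrable_const
    · refine Eventually.of_forall fun t _ => ?_
      have h1 : ‖Complex.exp (-(t * Complex.I)) * w‖ < 1 := by
        rw [norm_mul, Complex.norm_exp]; simpa using hw
      refine ((hasSum_geometric_of_norm_lt_one h1).mul_right (G t : ℂ)).congr_fun ?_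
      intro n
      rw [mul_pow, ← Complex.exp_nat_mul]
      congr 3
      ring
  have hterm : ∀ t : ℝ, fderiv ℝ (fun ζ : ℂ => Real.log ‖(re + re * w : ℂ) - ζ‖)
      (circleMap re re t) (Complex.exp (t * Complex.I)) * g (circleMap re re t) * re
      = ((1 - Complex.exp (-(t * Complex.I)) * w)⁻¹ * (G t : ℂ)).re := by
    intro t
    have hne : Complex.exp (t * Complex.I) - w ≠ 0 := by
      intro h
      rw [← sub_eq_zero.1 h, Complex.norm_exp_ofReal_mul_I] at hw
      exact lt_irrefl _ hw
    have e1 : circleMap (re : ℂ) re t - (re + re * w) = re * (Complex.exp (t * Complex.I) - w) := by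
      rw [circleMap]; ring
    have hx : (re + re * w : ℂ) ≠ circleMap re re t := by
      intro h
      rw [← h, sub_self] at e1
      exact mul_ne_zero hre' hne e1.symm
    rw [fderiv_log_norm_sub hx, e1, Complex.re_mul_ofReal, Complex.exp_neg]
    have e2 : Complex.exp (t * Complex.I) / (re * (Complex.exp (t * Complex.I) - w))
        = ((re⁻¹ : ℝ) : ℂ) * (1 - (Complex.exp (t * Complex.I))⁻¹ * w)⁻¹ := by
      have h0 := Complex.exp_ne_zero (t * Complex.I)
      have h3 : (1 - (Complex.exp (t * Complex.I))⁻¹ * w)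
          = (Complex.exp (t * Complex.I) - w) / Complex.exp (t * Complex.I) := by
        field_simp
      rw [h3]
      push_cast
      field_simp
    rw [e2, Complex.re_ofReal_mul]
    field_simp
    rfl
  have hsum : (∑' n : ℕ, fc (fun t => (G t : ℂ)) n * w ^ n)
      = (1 / (2 * Real.pi) : ℂ) * ∫ t in (0 : ℝ)..(2 * Real.pi),
        (1 - Complex.exp (-(t * Complex.I)) * w)⁻¹ * (G t : ℂ) := by
    rw [← (key.mul_left _).tsum_eq]
    congr 1
    ext n
    rw [fc, mul_assoc, ← intervalIntegral.integral_mul_const]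
    congr 2
    ext t
    push_cast
    ring
  have hcont : Continuous fun t : ℝ =>
      (1 - Complex.exp (-(t * Complex.I)) * w)⁻¹ * (G t : ℂ) := by
    refine Continuous.mul (Continuous.inv₀ (by fun_prop) fun t h => ?_) (by fun_prop)
    have h1 : ‖Complex.exp (-(t * Complex.I)) * w‖ < 1 := by
      rw [norm_mul, Complex.norm_exp]; simpa using hw
    rw [← sub_eq_zero.1 h] at h1
    simp at h1
  rw [hsum, doubleLayer]
  simp only [hterm]
  have e3 : (1 / (2 * Real.pi) : ℂ) = ((1 / (2 * Real.pi) : ℝ) : ℂ) := by push_cast; rfl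
  rw [e3, Complex.re_ofReal_mul]
  congr 1
  exact Complex.reCLM.intervalIntegral_comp_comm (hcont.intervalIntegrable _ _)

/-- `F` is a holomorphic function on the disk of centre `re` and radius `re`, continuous up to the
boundary, with real part `g` there, whose derivative `f` is bounded by `M` and `M`-Lipschitz. -/
structure IsHolomorphicExtension (re : ℝ) (g : ℂ → ℝ) (F f : ℂ → ℂ) (M : ℝ) : Prop where
  continuousOn : ContinuousOn F (closedBall (re : ℂ) re)
  hasDerivAt : ∀ z ∈ ball (re : ℂ) re, HasDerivAt F (f z) z
  norm_le : ∀ z ∈ closedBall (re : ℂ) re, ‖f z‖ ≤ M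
  lipschitz : ∀ z ∈ closedBall (re : ℂ) re, ∀ w ∈ closedBall (re : ℂ) re, ‖f z - f w‖ ≤ M * ‖z - w‖
  re_eq : ∀ z ∈ sphere (re : ℂ) re, (F z).re = g z
  Hd_eq : ∀ z ∈ ball (re : ℂ) re, Hd re g z = (F z).re

/-- Two integrations by parts identify `n² |ĝ(n)|` with the modulus of the coefficient of the second
derivative, to which Bernstein's theorem applies. -/
lemma summable_sq_mul_norm_fc {re : ℝ} {δ : ℝ≥0} (hδ : 1 / 2 < δ) {g : ℂ → ℝ}
    (hg : C2HolderOnCircle (re : ℂ) re δ g) :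
    Summable fun n : ℕ => (n : ℝ) ^ 2 * ‖fc (fun t => (g (circleMap re re t) : ℂ)) n‖ := by
  obtain ⟨hC2, K, hK⟩ := hg
  set G : ℝ → ℝ := fun t => g (circleMap re re t) with hG
  have hper : Function.Periodic G (2 * Real.pi) := fun t => by
    simp only [hG, periodic_circleMap re re t]
  have perd : ∀ {u : ℝ → ℝ}, Function.Periodic u (2 * Real.pi) →
      Function.Periodic (deriv u) (2 * Real.pi) := by
    intro u hu t
    rw [← deriv_comp_add_const]
    congr 1
    ext s
    exact hu s
  have h1 : ContDiff ℝ 1 (deriv G) := by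
    have := (contDiff_succ_iff_deriv (n := 1) (f := G)).1 (by simpa [one_add_one_eq_two] using hC2)
    exact this.2.2
  have hd0 : Differentiable ℝ G := hC2.differentiable (by norm_num)
  have hd1 : Differentiable ℝ (deriv G) := h1.differentiable (by norm_num)
  have hc2 : Continuous (deriv (deriv G)) := h1.continuous_deriv le_rfl
  have e2 : iteratedDeriv 2 G = deriv (deriv G) := by
    rw [iteratedDeriv_succ, iteratedDeriv_one]
  rw [e2] at hK
  have hsum := summable_norm_fc (φ := fun t => ((deriv (deriv G) t : ℝ) : ℂ)) (K := K) (δ := δ)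
    (fun t => by simp only [perd (perd hper) t]) (by fun_prop) K.2
    (by exact_mod_cast hδ) (fun t h hh => by
      rw [← Complex.ofReal_sub, Complex.norm_real, ← dist_eq_norm]
      have := hK.dist_le (t + h) t
      rwa [Real.dist_eq (t + h), add_sub_cancel_left, abs_of_nonneg hh] at this)
  refine hsum.congr fun n => ?_
  have f1 := fc_deriv (φ := fun t => (G t : ℂ)) (φ' := fun t => ((deriv G t : ℝ) : ℂ))
    (fun t => by simp only [hper t]) (fun t => (hd0 t).hasDerivAt.ofReal_comp)
    (by have := h1.continuous; fun_prop) n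
  have f2 := fc_deriv (φ := fun t => ((deriv G t : ℝ) : ℂ))
    (φ' := fun t => ((deriv (deriv G) t : ℝ) : ℂ))
    (fun t => by simp only [perd hper t]) (fun t => (hd1 t).hasDerivAt.ofReal_comp)
    (by fun_prop) n
  rw [f2, f1]
  simp only [norm_mul, Complex.norm_I]
  simp
  ring

theorem exists_isHolomorphicExtension {re : ℝ} (hre : 0 < re) {δ : ℝ≥0} (hδ : 1 / 2 < δ)
    {g : ℂ → ℝ} (hg : C2HolderOnCircle (re : ℂ) re δ g)
    (hmean : ∫ t in (0 : ℝ)..(2 * Real.pi), g (circleMap (re : ℂ) re t) = 0) :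
    ∃ F f : ℂ → ℂ, ∃ M : ℝ, IsHolomorphicExtension re g F f M := by
  have hs := summable_sq_mul_norm_fc hδ hg
  have hcG : Continuous fun t : ℝ => g (circleMap re re t) := hg.1.continuous
  set c : ℕ → ℂ := fun n => fc (fun t => (g (circleMap re re t) : ℂ)) n with hcdef
  have h0 : fc (fun t => (g (circleMap re re t) : ℂ)) 0 = 0 := by
    simp only [fc, Int.cast_zero, zero_mul, neg_zero, Complex.exp_zero, one_mul]
    rw [intervalIntegral.integral_ofReal, hmean]
    simp
  have hsc : Summable fun n : ℕ => ‖c n‖ := summable_norm_of_sq hs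
  set a : ℕ → ℂ := fun n => 2 * c n with hadef
  have ha2 : Summable fun n : ℕ => (n : ℝ) ^ 2 * ‖a n‖ := by
    refine (hs.mul_left 2).congr fun n => ?_
    simp only [hadef, hcdef, norm_mul, Complex.norm_ofNat]; ring
  have ha : Summable fun n : ℕ => ‖a n‖ := summable_norm_of_sq ha2
  have ha1 := summable_nat_mul_norm_of_sq ha2
  have hre' : (re : ℂ) ≠ 0 := by exact_mod_cast hre.ne'
  set W : ℂ → ℂ := fun z => (z - re) / re with hW
  have hWn : ∀ z, ‖W z‖ = ‖z - re‖ / re := fun z => by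
    simp only [hW, norm_div, Complex.norm_real, Real.norm_of_nonneg hre.le]
  have hWc : ∀ z ∈ closedBall (re : ℂ) re, ‖W z‖ ≤ 1 := fun z hz => by
    rw [hWn, div_le_one hre, ← dist_eq_norm]; exact hz
  have hWb : ∀ z ∈ ball (re : ℂ) re, ‖W z‖ < 1 := fun z hz => by
    rw [hWn, div_lt_one hre, ← dist_eq_norm]; exact hz
  have hWeq : ∀ z, z = re + re * W z := fun z => by simp only [hW]; field_simp; ring
  set F : ℂ → ℂ := fun z => ∑' n, a n * W z ^ n with hF
  set S1 : ℝ := ∑' n : ℕ, (n : ℝ) * ‖a n‖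
  set S2 : ℝ := ∑' n : ℕ, (n : ℝ) ^ 2 * ‖a n‖
  have hS1 : 0 ≤ S1 := tsum_nonneg fun n => by positivity
  have hS2 : 0 ≤ S2 := tsum_nonneg fun n => by positivity
  -- In the variable `w = (z - re) / re` the derivative gains a factor `1/re` and its Lipschitz
  -- constant `1/re²`; the sum of the two constants serves for both bounds.
  refine ⟨F, fun z => (re : ℂ)⁻¹ * ∑' n, a n * (n * W z ^ (n - 1)), S1 / re + S2 / re ^ 2,
    ?_, ?_, ?_, ?_, ?_, ?_⟩
  · exact (continuousOn_powerSum ha).comp (f := W) (by fun_prop)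
      (fun z hz => mem_closedBall_zero_iff.2 (hWc z hz))
  · intro z hz
    have h1 := hasDerivAt_powerSum ha ha1 (hWb z hz)
    have h2 : HasDerivAt W (re : ℂ)⁻¹ z := by
      simpa [hW, div_eq_mul_inv] using ((hasDerivAt_id z).sub_const (re : ℂ)).div_const (re : ℂ)
    exact (h1.comp z h2).congr_deriv (mul_comm _ _)
  · intro z hz
    have := norm_derivSum_le ha1 (hWc z hz)
    rw [norm_mul, norm_inv, Complex.norm_real, Real.norm_of_nonneg hre.le]
    calc re⁻¹ * _ ≤ re⁻¹ * S1 := by gcongr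
      _ ≤ _ := by rw [div_eq_inv_mul]; linarith [show 0 ≤ S2 / re ^ 2 by positivity]
  · intro z hz w hw
    have := norm_derivSum_sub_le ha2 (hWc z hz) (hWc w hw)
    rw [← mul_sub, norm_mul, norm_inv, Complex.norm_real, Real.norm_of_nonneg hre.le]
    have e : ‖W z - W w‖ = ‖z - w‖ / re := by
      simp only [hW]; rw [← sub_div, norm_div, Complex.norm_real, Real.norm_of_nonneg hre.le]
      congr 2; ring
    rw [e] at this
    calc re⁻¹ * _ ≤ re⁻¹ * (S2 * (‖z - w‖ / re)) := by gcongr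
      _ = S2 / re ^ 2 * ‖z - w‖ := by field_simp
      _ ≤ _ := by gcongr; linarith [show 0 ≤ S1 / re by positivity]
  · intro z hz
    obtain ⟨t, rfl⟩ : ∃ t : ℝ, circleMap (re : ℂ) re t = z := by
      have := range_circleMap (re : ℂ) re
      rw [abs_of_pos hre] at this
      rw [← this] at hz
      exact hz
    have hWt : W (circleMap re re t) = Complex.exp (t * Complex.I) := by
      simp only [hW, circleMap]; field_simp; ring
    simp only [hF, hWt, hadef, hcdef]
    exact re_tsum_fc (G := fun t => g (circleMap re re t))
      (fun t => by simp only [periodic_circleMap re re t]) hcG h0 hsc t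
  · intro z hz
    rw [Hd, hWeq z, doubleLayer_eq hre hcG (hWb z hz), ← hWeq z]
    simp only [hF, hadef]
    rw [show (fun n => 2 * c n * W z ^ n) = fun n => 2 * (c n * W z ^ n) from by ext; ring,
      tsum_mul_left]
    simp [hcdef]

/-! ### The hyperbolic flow with fixed points `±α` -/

/-- The Möbius map with fixed points `±α` multiplying `(α + z) / (α - z)` by `y⁻¹`. -/
def flow (α y : ℝ) (z : ℂ) : ℂ := α * ((α + z) - y * (α - z)) / ((α + z) + y * (α - z))

/-- The derivative of `flow α y`. -/
def flowD (α y : ℝ) (z : ℂ) : ℂ := 4 * y * α ^ 2 / ((α + z) + y * (α - z)) ^ 2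

/-- The Cayley transform of the flow parameter. -/
def cay (y : ℝ) : ℝ := (1 - y) / (1 + y)

section Flow

variable {α y : ℝ} {z : ℂ}

/-- Written as `α (1 + y) + z (1 - y)`, the denominator can only move away from `0` when `Re z ≥ 0`.
The absence of poles and the size of `flowD` in the right half-plane both come from this. -/
lemma re_flow_den (hz : 0 ≤ z.re) (hy : y ≤ 1) :
    α * (1 + y) ≤ ((α + z) + y * (α - z) : ℂ).re := by
  have : ((α + z) + y * (α - z) : ℂ).re = α * (1 + y) + z.re * (1 - y) := by
    simp; ring
  rw [this]
  nlinarith [mul_nonneg hz (sub_nonneg.2 hy)]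

lemma le_norm_flow_den (hz : 0 ≤ z.re) (hy : y ≤ 1) :
    α * (1 + y) ≤ ‖((α + z) + y * (α - z) : ℂ)‖ :=
  (re_flow_den hz hy).trans (Complex.re_le_norm _)

lemma flow_den_ne_zero (hα : 0 < α) (hz : 0 ≤ z.re) (hy0 : 0 ≤ y) (hy : y ≤ 1) :
    ((α + z) + y * (α - z) : ℂ) ≠ 0 := by
  rw [← norm_pos_iff]
  exact lt_of_lt_of_le (by positivity) (le_norm_flow_den hz hy)

lemma hasDerivAt_flow (hα : 0 < α) (hz : 0 ≤ z.re) (hy0 : 0 ≤ y) (hy : y ≤ 1) :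
    HasDerivAt (flow α y) (flowD α y z) z := by
  have hne := flow_den_ne_zero hα hz hy0 hy
  have h1 : HasDerivAt (fun z : ℂ => (α : ℂ) * ((α + z) - y * (α - z))) (α * (1 - y * (0 - 1))) z :=
    ((((hasDerivAt_id z).const_add (α : ℂ)).sub
      (((hasDerivAt_const z (α : ℂ)).sub (hasDerivAt_id z)).const_mul (y : ℂ))).const_mul (α : ℂ))
  have h2 : HasDerivAt (fun z : ℂ => ((α + z) + y * (α - z) : ℂ)) (1 + y * (0 - 1)) z :=
    ((hasDerivAt_id z).const_add (α : ℂ)).add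
      (((hasDerivAt_const z (α : ℂ)).sub (hasDerivAt_id z)).const_mul (y : ℂ))
  refine (h1.div h2 hne).congr_deriv ?_
  rw [flowD]
  congr 1
  ring

lemma norm_flowD_le (hα : 0 < α) (hz : 0 ≤ z.re) (hy0 : 0 ≤ y) (hy : y ≤ 1) :
    ‖flowD α y z‖ ≤ 4 * y / (1 + y) ^ 2 := by
  have h1 := le_norm_flow_den (α := α) hz hy
  have e : ‖(4 * y * α ^ 2 : ℂ)‖ = 4 * y * α ^ 2 := by
    simp [abs_of_nonneg hy0]
  rw [flowD, norm_div, norm_pow, e]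
  calc 4 * y * α ^ 2 / ‖((α + z) + y * (α - z) : ℂ)‖ ^ 2
      ≤ 4 * y * α ^ 2 / (α * (1 + y)) ^ 2 := by gcongr
    _ = _ := by field_simp

lemma norm_flowD_le_mul (hα : 0 < α) (hz : 0 ≤ z.re) (hy0 : 0 ≤ y) (hy : y ≤ 1) :
    ‖flowD α y z‖ ≤ 4 * y := by
  refine (norm_flowD_le hα hz hy0 hy).trans (div_le_self (by positivity) ?_)
  exact one_le_pow₀ (by linarith)

lemma norm_flowD_le_one (hα : 0 < α) (hz : 0 ≤ z.re) (hy0 : 0 ≤ y) (hy : y ≤ 1) :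
    ‖flowD α y z‖ ≤ 1 := by
  refine (norm_flowD_le hα hz hy0 hy).trans ?_
  rw [div_le_one (by positivity)]
  nlinarith [sq_nonneg (1 - y)]

lemma add_flow (h : ((α + z) + y * (α - z) : ℂ) ≠ 0) :
    α + flow α y z = 2 * α * (α + z) / ((α + z) + y * (α - z)) := by
  rw [flow]; field_simp; ring

lemma sub_flow (h : ((α + z) + y * (α - z) : ℂ) ≠ 0) :
    α - flow α y z = 2 * α * y * (α - z) / ((α + z) + y * (α - z)) := by
  rw [flow]; field_simp; ring

/-- The vector field `α² - z²` generates the flow up to a factor, so the flow carries it to itself.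
It is also the direction of `∇ξ`, whence its role for the `ξ`-derivative of the image series. -/
lemma sq_sub_flow_sq (h : ((α + z) + y * (α - z) : ℂ) ≠ 0) :
    α ^ 2 - flow α y z ^ 2 = flowD α y z * (α ^ 2 - z ^ 2) := by
  rw [show α ^ 2 - flow α y z ^ 2 = (α + flow α y z) * (α - flow α y z) by ring,
    add_flow h, sub_flow h, flowD]
  field_simp
  ring

lemma flow_one (hα : 0 < α) : flow α 1 z = z := by
  have : (α : ℂ) ≠ 0 := by exact_mod_cast hα.ne'
  rw [flow, div_eq_iff]
  · push_cast; ring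
  · have e : (α + z + (1 : ℝ) * (α - z) : ℂ) = 2 * α := by push_cast; ring
    rw [e]; simpa using hα.ne'

/-- The semigroup law of the flow. -/
lemma flow_flow {y' : ℝ} (h : ((α + z) + y * (α - z) : ℂ) ≠ 0) (hα : 0 < α) :
    flow α y' (flow α y z) = flow α (y' * y) z := by
  have hα' : (α : ℂ) ≠ 0 := by exact_mod_cast hα.ne'
  have e1 := add_flow h
  have e2 := sub_flow h
  rw [flow, e1, e2, flow]
  set D : ℂ := (α + z) + y * (α - z)
  have n1 : (2 * α * (α + z) / D - y' * (2 * α * y * (α - z) / D) : ℂ)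
      = (2 * α / D) * ((α + z) - (y' * y : ℝ) * (α - z)) := by push_cast; ring
  have n2 : (2 * α * (α + z) / D + y' * (2 * α * y * (α - z) / D) : ℂ)
      = (2 * α / D) * ((α + z) + (y' * y : ℝ) * (α - z)) := by push_cast; ring
  rw [n1, n2, mul_left_comm, mul_div_mul_left _ _ (by simp [hα.ne', h])]

/-- The dominating function of the total variation of `flowD` along the flow. -/
def varD (q y : ℝ) : ℝ := cay y ^ 2 - 4 / (1 + cay y * q)

/-- The dominating function of the length of the flow lines. -/
def varF (q y : ℝ) : ℝ := (1 + q) * cay y / (1 + cay y * q)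

lemma cay_nonneg (hy0 : 0 ≤ y) (hy : y ≤ 1) : 0 ≤ cay y := div_nonneg (by linarith) (by linarith)

lemma cay_le_one (hy0 : 0 ≤ y) : cay y ≤ 1 := by
  rw [cay, div_le_one (by linarith)]; linarith

lemma cay_anti {y' : ℝ} (hy0 : 0 ≤ y) (h : y ≤ y') : cay y' ≤ cay y := by
  rw [cay, cay, div_le_div_iff₀ (by linarith) (by linarith)]
  nlinarith

/-- In the right half-plane `1` and `a p` make an angle of at most a right one, so no cancellation
occurs and `p` may be replaced by its modulus up to `√2`. This is what allows real monotone
functions to dominate the complex ones. -/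
lemma norm_one_add_mul {a : ℝ} {p : ℂ} (ha : 0 ≤ a) (hp : 0 ≤ p.re) :
    (1 + a * ‖p‖) ^ 2 ≤ 2 * ‖1 + a * p‖ ^ 2 := by
  rw [← Complex.normSq_eq_norm_sq, Complex.normSq_apply]
  have h1 : ‖p‖ ^ 2 = p.re ^ 2 + p.im ^ 2 := by
    rw [← Complex.normSq_eq_norm_sq, Complex.normSq_apply]; ring
  simp only [Complex.add_re, Complex.one_re, Complex.re_ofReal_mul, Complex.add_im,
    Complex.one_im, Complex.im_ofReal_mul]
  have h2 : (a * ‖p‖) ^ 2 = (a * p.re) ^ 2 + (a * p.im) ^ 2 := by rw [mul_pow, h1]; ring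
  nlinarith [sq_nonneg (1 - a * ‖p‖), mul_nonneg ha hp]

lemma one_le_norm_one_add_mul {a : ℝ} {p : ℂ} (ha : 0 ≤ a) (hp : 0 ≤ p.re) :
    1 ≤ ‖1 + a * p‖ := by
  refine le_trans ?_ (Complex.re_le_norm _)
  simp only [Complex.add_re, Complex.one_re, Complex.re_ofReal_mul]
  nlinarith [mul_nonneg ha hp]

lemma inv_mul_norm_le {a b : ℝ} {p : ℂ} (ha : 0 ≤ a) (hb : 0 ≤ b) (hp : 0 ≤ p.re) :
    1 / (‖1 + a * p‖ * ‖1 + b * p‖) ≤ 2 / ((1 + a * ‖p‖) * (1 + b * ‖p‖)) := by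
  have h1 := norm_one_add_mul ha hp
  have h2 := norm_one_add_mul hb hp
  have p1 := one_le_norm_one_add_mul ha hp
  have p2 := one_le_norm_one_add_mul hb hp
  rw [div_le_div_iff₀ (by positivity) (by positivity), one_mul]
  apply le_of_sq_le_sq _ (by positivity)
  calc ((1 + a * ‖p‖) * (1 + b * ‖p‖)) ^ 2 = (1 + a * ‖p‖) ^ 2 * (1 + b * ‖p‖) ^ 2 := by ring
    _ ≤ (2 * ‖1 + a * p‖ ^ 2) * (2 * ‖1 + b * p‖ ^ 2) := by gcongr
    _ = _ := by ring

/-- With `a = cay y` and `p = z / α` the flow is the addition law `p ↦ (p + a) / (1 + a p)` of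
`tanh`, and its derivative is `(1 - a²) / (1 + a p)²`; the estimates are made in these variables. -/
lemma flow_den_eq (hα : 0 < α) (hy0 : 0 ≤ y) :
    ((α + z) + y * (α - z) : ℂ) = α * (1 + y) * (1 + cay y * (z / α)) := by
  have h1 : (α : ℂ) ≠ 0 := by exact_mod_cast hα.ne'
  have h2 : (1 + y : ℂ) ≠ 0 := by
    have : (1 + y : ℝ) ≠ 0 := by positivity
    exact_mod_cast this
  rw [cay]; push_cast
  field_simp
  ring

lemma flowD_eq_cay (hα : 0 < α) (hy0 : 0 ≤ y) :
    flowD α y z = (1 - cay y ^ 2) / (1 + cay y * (z / α)) ^ 2 := by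
  have h1 : (α : ℂ) ≠ 0 := by exact_mod_cast hα.ne'
  have h2 : (1 + y : ℂ) ≠ 0 := by
    have : (1 + y : ℝ) ≠ 0 := by positivity
    exact_mod_cast this
  rw [flowD, flow_den_eq hα hy0]
  have h3 : (1 - (cay y : ℂ) ^ 2) = 4 * y / (1 + y) ^ 2 := by
    rw [cay]; push_cast; field_simp; ring
  rw [h3, mul_pow, mul_pow]
  field_simp

lemma flow_eq_cay (hα : 0 < α) (hy0 : 0 ≤ y) :
    flow α y z = (z + α * cay y) / (1 + cay y * (z / α)) := by
  have h1 : (α : ℂ) ≠ 0 := by exact_mod_cast hα.ne'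
  have h2 : (1 + y : ℂ) ≠ 0 := by
    have : (1 + y : ℝ) ≠ 0 := by positivity
    exact_mod_cast this
  rw [flow, flow_den_eq hα hy0]
  have h3 : (α + z - y * (α - z) : ℂ) = (1 + y) * (z + α * cay y) := by
    rw [cay]; push_cast; field_simp; ring
  rw [h3, show (α * ((1 + y) * (z + α * cay y)) : ℂ) = (α * (1 + y)) * (z + α * cay y) by ring,
    mul_div_mul_left _ _ (mul_ne_zero h1 h2)]

lemma re_div_nonneg (hα : 0 < α) (hz : 0 ≤ z.re) : 0 ≤ (z / α).re := by
  rw [Complex.div_ofReal_re]; positivity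

lemma norm_div_ofReal (hα : 0 < α) : ‖z / α‖ = ‖z‖ / α := by
  rw [norm_div, Complex.norm_real, Real.norm_of_nonneg hα.le]

/-- The change of `(1 - a²)(1 + a p)⁻²` splits into that of `1 - a²`, accounted for by the term `a²`
of `varD`, and that of `(1 + a p)⁻²`, accounted for by `-4 / (1 + a q)`. The bound is an increment,
so it telescopes along any monotone sequence of parameters. -/
lemma norm_flowD_sub_le (hα : 0 < α) (hz : 0 ≤ z.re) {y' : ℝ} (hy0 : 0 ≤ y) (hyy : y ≤ y')
    (hy' : y' ≤ 1) :
    ‖flowD α y z - flowD α y' z‖ ≤ varD (‖z‖ / α) y - varD (‖z‖ / α) y' := by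
  have hp := re_div_nonneg hα hz
  rw [flowD_eq_cay hα hy0, flowD_eq_cay hα (hy0.trans hyy), varD, varD, ← norm_div_ofReal hα]
  set p : ℂ := z / α
  have ha0 := cay_nonneg (hy0.trans hyy) hy'
  have hab := cay_anti hy0 hyy
  have hb1 := cay_le_one hy0
  set a := cay y'
  set b := cay y
  clear_value p a b
  have hb0 := ha0.trans hab
  have na := one_le_norm_one_add_mul ha0 hp
  have nb := one_le_norm_one_add_mul hb0 hp
  have za : (1 + a * p : ℂ) ≠ 0 := norm_pos_iff.1 (by linarith)
  have zb : (1 + b * p : ℂ) ≠ 0 := norm_pos_iff.1 (by linarith)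
  set wa : ℂ := (1 + a * p)⁻¹ with hwa
  set wb : ℂ := (1 + b * p)⁻¹ with hwb
  have ia : wa * (1 + a * p) = 1 := inv_mul_cancel₀ za
  have ib : wb * (1 + b * p) = 1 := inv_mul_cancel₀ zb
  have nwa : ‖wa‖ ≤ 1 := by rw [hwa, norm_inv]; exact inv_le_one_of_one_le₀ na
  have nwb : ‖wb‖ ≤ 1 := by rw [hwb, norm_inv]; exact inv_le_one_of_one_le₀ nb
  have hd : ‖wb - wa‖ ≤ 2 * (1 / (1 + a * ‖p‖) - 1 / (1 + b * ‖p‖)) := by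
    have e : wb - wa = -((b - a : ℝ) * p) * (1 / ((1 + a * p) * (1 + b * p))) := by
      rw [one_div, mul_inv, ← hwa, ← hwb]; push_cast
      linear_combination (-wb) * ia + wa * ib
    rw [e, norm_mul, norm_neg, norm_mul, Complex.norm_real, Real.norm_of_nonneg (sub_nonneg.2 hab),
      norm_div, norm_mul, norm_one]
    calc (b - a) * ‖p‖ * (1 / (‖1 + a * p‖ * ‖1 + b * p‖))
        ≤ (b - a) * ‖p‖ * (2 / ((1 + a * ‖p‖) * (1 + b * ‖p‖))) :=
          mul_le_mul_of_nonneg_left (inv_mul_norm_le ha0 hb0 hp)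
            (mul_nonneg (sub_nonneg.2 hab) (norm_nonneg _))
      _ = _ := by field_simp; ring
  have e : (1 - (b : ℂ) ^ 2) / (1 + b * p) ^ 2 - (1 - (a : ℂ) ^ 2) / (1 + a * p) ^ 2
      = ((1 - b ^ 2 : ℝ) : ℂ) * ((wb + wa) * (wb - wa)) - ((b ^ 2 - a ^ 2 : ℝ) : ℂ) * wa ^ 2 := by
    rw [div_eq_mul_inv, div_eq_mul_inv, ← inv_pow, ← inv_pow, ← hwa, ← hwb]; push_cast; ring
  rw [e]
  refine (norm_sub_le _ _).trans ?_
  rw [norm_mul, norm_mul, norm_mul, norm_pow, Complex.norm_real, Complex.norm_real,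
    Real.norm_of_nonneg (by nlinarith), Real.norm_of_nonneg (by nlinarith)]
  have t1 : (1 - b ^ 2) * (‖wb + wa‖ * ‖wb - wa‖)
      ≤ 1 * (2 * (2 * (1 / (1 + a * ‖p‖) - 1 / (1 + b * ‖p‖)))) := by
    gcongr
    · nlinarith [sq_nonneg b]
    · exact (norm_add_le _ _).trans (by linarith)
  have t2 : (b ^ 2 - a ^ 2) * ‖wa‖ ^ 2 ≤ (b ^ 2 - a ^ 2) * 1 := by
    gcongr
    · nlinarith
    · exact pow_le_one₀ (norm_nonneg _) nwa
  have e4 : 4 / (1 + b * ‖p‖) = 4 * (1 / (1 + b * ‖p‖)) := by ring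
  have e5 : 4 / (1 + a * ‖p‖) = 4 * (1 / (1 + a * ‖p‖)) := by ring
  rw [e4, e5]
  linarith

/-- The range has length `5` whatever `q` is, hence uniformly in `z` and `α`. This is the source of
the `5` in the later sums. -/
lemma varD_mem {q : ℝ} (hq : 0 ≤ q) (hy0 : 0 ≤ y) (hy : y ≤ 1) :
    -4 ≤ varD q y ∧ varD q y ≤ 1 := by
  have h0 := cay_nonneg hy0 hy
  have h1 := cay_le_one hy0
  rw [varD]
  have h2 : 4 / (1 + cay y * q) ≤ 4 := div_le_self (by norm_num) (by nlinarith [mul_nonneg h0 hq])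
  have h3 : 0 ≤ 4 / (1 + cay y * q) := by positivity
  constructor <;> nlinarith

lemma varD_anti {q y' : ℝ} (hq : 0 ≤ q) (hy0 : 0 ≤ y) (hyy : y ≤ y') (hy' : y' ≤ 1) :
    varD q y' ≤ varD q y := by
  have h0 := cay_nonneg (hy0.trans hyy) hy'
  have h1 := cay_anti hy0 hyy
  rw [varD, varD]
  gcongr

lemma varF_mem {q : ℝ} (hq : 0 ≤ q) (hy0 : 0 ≤ y) (hy : y ≤ 1) :
    0 ≤ varF q y ∧ varF q y ≤ 1 := by
  have h0 := cay_nonneg hy0 hy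
  have h1 := cay_le_one hy0
  refine ⟨by rw [varF]; positivity, ?_⟩
  rw [varF, div_le_one (by positivity)]
  nlinarith

lemma varF_sub {q y' : ℝ} (hq : 0 ≤ q) (hy0 : 0 ≤ y) (hy : y ≤ 1) (hy0' : 0 ≤ y') (hy' : y' ≤ 1) :
    varF q y - varF q y' = (1 + q) * (cay y - cay y') / ((1 + cay y * q) * (1 + cay y' * q)) := by
  have h0 := cay_nonneg hy0 hy
  have h0' := cay_nonneg hy0' hy'
  rw [varF, varF]
  field_simp
  ring

lemma varF_anti {q y' : ℝ} (hq : 0 ≤ q) (hy0 : 0 ≤ y) (hyy : y ≤ y') (hy' : y' ≤ 1) :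
    varF q y' ≤ varF q y := by
  have h0 := cay_nonneg (hy0.trans hyy) hy'
  have h0' := cay_nonneg hy0 (hyy.trans hy')
  have h1 := cay_anti hy0 hyy
  have := varF_sub hq hy0 (hyy.trans hy') (hy0.trans hyy) hy'
  have h2 : 0 ≤ (1 + q) * (cay y - cay y') / ((1 + cay y * q) * (1 + cay y' * q)) :=
    div_nonneg (mul_nonneg (by linarith) (by linarith)) (by positivity)
  linarith

/-- The flow line from `z` (at `y = 1`) to `α` (at `y = 0`) has length at most `2 |α - z|`, since
`varF` grows from `0` to `1` along it. -/
lemma norm_flow_sub_le (hα : 0 < α) (hz : 0 ≤ z.re) {y' : ℝ} (hy0 : 0 ≤ y) (hyy : y ≤ y')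
    (hy' : y' ≤ 1) :
    ‖flow α y z - flow α y' z‖
      ≤ 2 * ‖α - z‖ * (varF (‖z‖ / α) y - varF (‖z‖ / α) y') := by
  have hp := re_div_nonneg hα hz
  have h1 : (α : ℂ) ≠ 0 := by exact_mod_cast hα.ne'
  rw [varF_sub (by positivity) hy0 (hyy.trans hy') (hy0.trans hyy) hy',
    flow_eq_cay hα hy0, flow_eq_cay hα (hy0.trans hyy), ← norm_div_ofReal hα]
  have hz' : z = α * (z / α) := by field_simp
  set p : ℂ := z / α
  have ha0 := cay_nonneg (hy0.trans hyy) hy'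
  have hab := cay_anti hy0 hyy
  set a := cay y'
  set b := cay y
  clear_value p a b
  have hb0 := ha0.trans hab
  have na := one_le_norm_one_add_mul ha0 hp
  have nb := one_le_norm_one_add_mul hb0 hp
  have za : (1 + a * p : ℂ) ≠ 0 := norm_pos_iff.1 (by linarith)
  have zb : (1 + b * p : ℂ) ≠ 0 := norm_pos_iff.1 (by linarith)
  have e : (z + α * b) / (1 + b * p) - (z + α * a) / (1 + a * p)
      = (α - z) * (1 + p) * (b - a : ℝ) * (1 / ((1 + b * p) * (1 + a * p))) := by
    have ia := inv_mul_cancel₀ za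
    have ib := inv_mul_cancel₀ zb
    rw [one_div, mul_inv, div_eq_mul_inv, div_eq_mul_inv, hz']; push_cast
    linear_combination (-α * (p + b) * (1 + b * p)⁻¹) * ia + (α * (p + a) * (1 + a * p)⁻¹) * ib
  rw [e, norm_mul, norm_mul, norm_mul, Complex.norm_real, Real.norm_of_nonneg (sub_nonneg.2 hab),
    norm_div, norm_mul, norm_one]
  calc ‖α - z‖ * ‖1 + p‖ * (b - a) * (1 / (‖1 + b * p‖ * ‖1 + a * p‖))
      ≤ ‖α - z‖ * (1 + ‖p‖) * (b - a) * (2 / ((1 + b * ‖p‖) * (1 + a * ‖p‖))) := by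
        have := inv_mul_norm_le hb0 ha0 hp
        have h3 : ‖1 + p‖ ≤ 1 + ‖p‖ := (norm_add_le _ _).trans (by simp)
        have h4 := sub_nonneg.2 hab
        gcongr
    _ = _ := by ring

end Flow

/-! ### Sums of sequences of bounded variation -/

lemma summable_sub_of_monotone {U : ℕ → ℝ} {C : ℝ} (hU : ∀ n, U n ≤ U (n + 1))
    (hC : ∀ n, U n ≤ U 0 + C) :
    Summable (fun n => U (n + 1) - U n) ∧ ∑' n, (U (n + 1) - U n) ≤ C := by
  have h1 : ∀ N, ∑ n ∈ Finset.range N, (U (n + 1) - U n) ≤ C := fun N => by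
    rw [Finset.sum_range_sub]; linarith [hC N]
  have h0 : ∀ n, 0 ≤ U (n + 1) - U n := fun n => sub_nonneg.2 (hU n)
  exact ⟨summable_of_sum_range_le h0 h1, Real.tsum_le_of_sum_range_le h0 h1⟩

lemma summable_pow_mul_of_bounded {τ : ℝ} (hτ : |τ| < 1) {a : ℕ → ℂ} {B : ℝ}
    (ha : ∀ n, ‖a n‖ ≤ B) : Summable fun n => (τ : ℂ) ^ n * a n := by
  refine Summable.of_norm_bounded (g := fun n => |τ| ^ n * B)
    ((summable_geometric_of_lt_one (abs_nonneg _) hτ).mul_right B) fun n => ?_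
  rw [norm_mul, norm_pow, Complex.norm_real, Real.norm_eq_abs]
  gcongr
  exact ha n

/-- Summation by parts: the left side is `a₀ + ∑ τ^(n+1) (a_{n+1} - a_n)`. For `τ ≥ 0` the geometric
series alone would give a bound; bounded variation is what keeps it uniform as `τ → -1`, that is, `k
→ 0`. -/
lemma norm_one_sub_mul_tsum_le {τ : ℝ} (hτ : |τ| < 1) {a : ℕ → ℂ} {B : ℝ} (ha : ∀ n, ‖a n‖ ≤ B)
    {U : ℕ → ℝ} {C : ℝ} (hU : ∀ n, ‖a (n + 1) - a n‖ ≤ U (n + 1) - U n)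
    (hC : ∀ n, U n ≤ U 0 + C) :
    ‖(1 - τ : ℂ) * ∑' n, (τ : ℂ) ^ n * a n‖ ≤ B + C := by
  have hs := summable_pow_mul_of_bounded hτ ha
  have hs1 := summable_pow_mul_of_bounded hτ (fun n => ha (n + 1))
  have hm := summable_sub_of_monotone (fun n => by linarith [hU n, norm_nonneg (a (n + 1) - a n)]) hC
  have e : (1 - τ : ℂ) * ∑' n, (τ : ℂ) ^ n * a n
      = a 0 + ∑' n, τ * ((τ : ℂ) ^ n * (a (n + 1) - a n)) := by
    have e1 : ∑' n, τ * ((τ : ℂ) ^ n * (a (n + 1) - a n))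
        = (∑' n, (τ : ℂ) ^ (n + 1) * a (n + 1)) - τ * ∑' n, (τ : ℂ) ^ n * a n := by
      rw [← tsum_mul_left, ← Summable.tsum_sub]
      · congr 1; ext n; ring
      · exact (hs1.mul_left (τ : ℂ)).congr fun n => by ring
      · exact hs.mul_left _
    rw [e1, sub_mul, one_mul]
    nth_rewrite 1 [hs.tsum_eq_zero_add]
    simp
    ring
  rw [e]
  refine (norm_add_le _ _).trans (add_le_add (ha 0) ?_)
  refine le_trans (tsum_of_norm_bounded hm.1.hasSum fun n => ?_) hm.2
  rw [norm_mul, norm_mul, norm_pow, Complex.norm_real, Real.norm_eq_abs]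
  calc |τ| * (|τ| ^ n * ‖a (n + 1) - a n‖) ≤ 1 * (1 * ‖a (n + 1) - a n‖) := by
        gcongr
        exact pow_le_one₀ (abs_nonneg _) hτ.le
    _ ≤ _ := by simpa using hU n

/-! ### Two circles of a common Apollonian family -/

/-- The circles of centres `ci < ce` and radii `ri`, `re` are level lines of the bipolar coordinate
with poles `±α`. -/
structure TwoCircles (re ri α ci ce : ℝ) : Prop where
  ri_pos : 0 < ri
  re_pos : 0 < re
  alpha_pos : 0 < α
  ci_pos : 0 < ci
  ci_lt : ci < ce
  sq_i : α ^ 2 = ci ^ 2 - ri ^ 2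
  sq_e : α ^ 2 = ce ^ 2 - re ^ 2

/-- The multiplier of the composition of the reflections in the two circles. -/
def kap (α ci ce : ℝ) : ℝ := ((ce + α) * (ci - α)) / ((ce - α) * (ci + α))

lemma norm_add_sq' (α : ℝ) (z : ℂ) : ‖(α : ℂ) + z‖ ^ 2 = ‖z‖ ^ 2 + α ^ 2 + 2 * α * z.re := by
  simp only [← Complex.normSq_eq_norm_sq, Complex.normSq_apply]
  simp
  ring

lemma norm_sub_sq' (α : ℝ) (z : ℂ) : ‖(α : ℂ) - z‖ ^ 2 = ‖z‖ ^ 2 + α ^ 2 - 2 * α * z.re := by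
  simp only [← Complex.normSq_eq_norm_sq, Complex.normSq_apply]
  simp
  ring

section Apollonius

variable {c r α : ℝ} {z : ℂ}

/-- The power of `z` with respect to the circle is a linear combination of the squared distances to
`±α`. Hence the circle is a level line of `|α + z| / |α - z|`, and membership in the disk is an
inequality for this ratio. -/
lemma apollonius_aux (hc : α ^ 2 = c ^ 2 - r ^ 2) :
    ((c - α) * ‖(α : ℂ) + z‖ ^ 2 - (c + α) * ‖(α : ℂ) - z‖ ^ 2)
      = 2 * α * (r ^ 2 - ‖z - c‖ ^ 2) := by
  rw [norm_add_sq', norm_sub_sq', norm_sub_rev z, norm_sub_sq']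
  linear_combination (-2) * α * hc

lemma mem_closedBall_iff_apollonius (hα : 0 < α) (hr : 0 < r) (hc : α ^ 2 = c ^ 2 - r ^ 2) :
    z ∈ closedBall (c : ℂ) r ↔ (c + α) * ‖(α : ℂ) - z‖ ^ 2 ≤ (c - α) * ‖(α : ℂ) + z‖ ^ 2 := by
  rw [← sub_nonneg (b := (c + α) * ‖(α : ℂ) - z‖ ^ 2), apollonius_aux hc, mem_closedBall_iff_norm,
    mul_nonneg_iff_of_pos_left (by positivity), sub_nonneg,
    sq_le_sq₀ (norm_nonneg _) hr.le]

lemma mem_ball_iff_apollonius (hα : 0 < α) (hr : 0 < r) (hc : α ^ 2 = c ^ 2 - r ^ 2) :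
    z ∈ ball (c : ℂ) r ↔ (c + α) * ‖(α : ℂ) - z‖ ^ 2 < (c - α) * ‖(α : ℂ) + z‖ ^ 2 := by
  rw [← sub_pos (b := (c + α) * ‖(α : ℂ) - z‖ ^ 2), apollonius_aux hc, mem_ball_iff_norm,
    mul_pos_iff_of_pos_left (by positivity), sub_pos,
    sq_lt_sq₀ (norm_nonneg _) hr.le]

lemma re_pos_of_mem_closedBall (hα : 0 < α) (hr : 0 < r) (hc0 : 0 < c) (hc : α ^ 2 = c ^ 2 - r ^ 2)
    (hz : z ∈ closedBall (c : ℂ) r) : 0 < z.re := by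
  have h1 : r < c := by nlinarith
  rw [mem_closedBall_iff_norm] at hz
  have h2 := Complex.abs_re_le_norm (z - c)
  have h3 := (abs_le.1 (h2.trans hz)).1
  simp at h3
  linarith

lemma lt_of_sq_eq (hα : 0 < α) (hr : 0 < r) (hc0 : 0 < c) (hc : α ^ 2 = c ^ 2 - r ^ 2) : α < c := by
  nlinarith

/-- The flow multiplies `|α - z| / |α + z|` by `y ≤ 1`, which only moves the point deeper into a
disk of the Apollonian family. -/
lemma flow_mem_closedBall (hα : 0 < α) (hr : 0 < r) (hc0 : 0 < c) (hc : α ^ 2 = c ^ 2 - r ^ 2)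
    {y : ℝ} (hy0 : 0 ≤ y) (hy : y ≤ 1) (hz : z ∈ closedBall (c : ℂ) r) :
    flow α y z ∈ closedBall (c : ℂ) r := by
  have hre := re_pos_of_mem_closedBall hα hr hc0 hc hz
  have hne := flow_den_ne_zero hα hre.le hy0 hy
  have hαc := lt_of_sq_eq hα hr hc0 hc
  rw [mem_closedBall_iff_apollonius hα hr hc] at hz ⊢
  rw [add_flow hne, sub_flow hne]
  simp only [norm_div, norm_mul, Complex.norm_ofNat, Complex.norm_real, Real.norm_of_nonneg hα.le,
    Real.norm_of_nonneg hy0, div_pow, mul_pow, mul_div_assoc']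
  gcongr ?_ / _
  have : (c + α) * ‖(α : ℂ) - z‖ ^ 2 * y ^ 2 ≤ (c - α) * ‖(α : ℂ) + z‖ ^ 2 := by
    refine le_trans (mul_le_of_le_one_right (by positivity) (pow_le_one₀ hy0 hy)) hz
  nlinarith [pow_pos hα 2]

lemma flow_mem_ball (hα : 0 < α) (hr : 0 < r) (hc0 : 0 < c) (hc : α ^ 2 = c ^ 2 - r ^ 2)
    {y : ℝ} (hy0 : 0 ≤ y) (hy : y ≤ 1) (hz : z ∈ ball (c : ℂ) r) :
    flow α y z ∈ ball (c : ℂ) r := by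
  have hre := re_pos_of_mem_closedBall hα hr hc0 hc (ball_subset_closedBall hz)
  have hne := flow_den_ne_zero hα hre.le hy0 hy
  have hαc := lt_of_sq_eq hα hr hc0 hc
  rw [mem_ball_iff_apollonius hα hr hc] at hz ⊢
  rw [add_flow hne, sub_flow hne]
  simp only [norm_div, norm_mul, Complex.norm_ofNat, Complex.norm_real, Real.norm_of_nonneg hα.le,
    Real.norm_of_nonneg hy0, div_pow, mul_pow, mul_div_assoc']
  have := norm_pos_iff.2 hne
  gcongr ?_ / _
  have : (c + α) * ‖(α : ℂ) - z‖ ^ 2 * y ^ 2 < (c - α) * ‖(α : ℂ) + z‖ ^ 2 := by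
    refine lt_of_le_of_lt (mul_le_of_le_one_right (by positivity) (pow_le_one₀ hy0 hy)) hz
  nlinarith [pow_pos hα 2]

end Apollonius

/-- The reflection in the circle of centre `ci` whose poles are `±α`. -/
def refl (α ci : ℝ) (z : ℂ) : ℂ := (starRingEnd ℂ) ((α ^ 2 - ci * z) / (ci - z))

/-- The flow parameter which takes `z` to its reflection. -/
def reflPar (α ci : ℝ) (z : ℂ) : ℝ :=
  (ci - α) * ‖(α : ℂ) + z‖ ^ 2 / ((ci + α) * ‖(α : ℂ) - z‖ ^ 2)

namespace TwoCircles

variable {re ri α ci ce : ℝ} (h : TwoCircles re ri α ci ce) {z : ℂ}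

include h

lemma ce_pos : 0 < ce := h.ci_pos.trans h.ci_lt

lemma alpha_lt_ci : α < ci := lt_of_sq_eq h.alpha_pos h.ri_pos h.ci_pos h.sq_i

lemma alpha_lt_ce : α < ce := h.alpha_lt_ci.trans h.ci_lt

lemma kap_pos : 0 < kap α ci ce := by
  have := h.alpha_pos; have := h.ci_pos; have := h.ce_pos
  have := sub_pos.2 h.alpha_lt_ci; have := sub_pos.2 h.alpha_lt_ce
  rw [kap]; positivity

lemma one_sub_kap : 1 - kap α ci ce = 2 * α * (ce - ci) / ((ce - α) * (ci + α)) := by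
  have := h.alpha_pos; have := h.ci_pos
  have h1 := (sub_pos.2 h.alpha_lt_ce).ne'
  have h2 : ci + α ≠ 0 := by positivity
  rw [kap]; field_simp; ring

lemma kap_lt_one : kap α ci ce < 1 := by
  have := h.alpha_pos; have := h.ci_pos
  have := sub_pos.2 h.alpha_lt_ce; have := sub_pos.2 h.ci_lt
  have h1 : 0 < 1 - kap α ci ce := by rw [h.one_sub_kap]; positivity
  linarith

lemma kap_pow_mem (n : ℕ) : 0 ≤ kap α ci ce ^ n ∧ kap α ci ce ^ n ≤ 1 :=
  ⟨pow_nonneg h.kap_pos.le n, pow_le_one₀ h.kap_pos.le h.kap_lt_one.le⟩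

lemma re_pos_of_mem (hz : z ∈ closedBall (ce : ℂ) re) : 0 < z.re :=
  re_pos_of_mem_closedBall h.alpha_pos h.re_pos h.ce_pos h.sq_e hz

lemma flow_mem {y : ℝ} (hy0 : 0 ≤ y) (hy : y ≤ 1) (hz : z ∈ closedBall (ce : ℂ) re) :
    flow α y z ∈ closedBall (ce : ℂ) re :=
  flow_mem_closedBall h.alpha_pos h.re_pos h.ce_pos h.sq_e hy0 hy hz

lemma flow_mem' {y : ℝ} (hy0 : 0 ≤ y) (hy : y ≤ 1) (hz : z ∈ ball (ce : ℂ) re) :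
    flow α y z ∈ ball (ce : ℂ) re :=
  flow_mem_ball h.alpha_pos h.re_pos h.ce_pos h.sq_e hy0 hy hz

lemma alpha_mem_incl : (α : ℂ) ∈ ball (ci : ℂ) ri := by
  have h1 := h.alpha_pos; have h2 := h.alpha_lt_ci
  rw [mem_ball_iff_apollonius h1 h.ri_pos h.sq_i, sub_self]
  have h3 : ‖(α : ℂ) + α‖ ≠ 0 := by
    rw [norm_ne_zero_iff]; exact_mod_cast (by positivity : α + α ≠ 0)
  have := sub_pos.2 h2
  simp only [norm_zero, ne_eq, OfNat.ofNat_ne_zero, not_false_eq_true, zero_pow, mul_zero]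
  positivity

lemma sub_ne_zero_of_notMem (hz : z ∉ ball (ci : ℂ) ri) : (α - z : ℂ) ≠ 0 := by
  intro h0
  rw [← sub_eq_zero.1 h0] at hz
  exact hz h.alpha_mem_incl

lemma ci_sub_ne_zero (hz : z ∉ ball (ci : ℂ) ri) : (ci - z : ℂ) ≠ 0 := by
  intro h0
  rw [← sub_eq_zero.1 h0] at hz
  exact hz (mem_ball_self h.ri_pos)

/-- In bipolar coordinates the reflection is `(ξ, θ) ↦ (2 ξᵢ - ξ, θ)`: it keeps the flow line, and
the modulus of `(α + z) / (α - z)` determines the parameter. -/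
lemma refl_eq_flow (hz : z ∉ ball (ci : ℂ) ri) (hz0 : 0 < z.re) :
    refl α ci z = flow α (reflPar α ci z) z := by
  have h1 := h.sub_ne_zero_of_notMem hz
  have h2 := h.ci_sub_ne_zero hz
  have hα := h.alpha_pos
  have hci := h.ci_pos
  have hαP : (α + z : ℂ) ≠ 0 := by
    intro h0
    have := congrArg Complex.re h0
    simp at this; linarith
  have e : (reflPar α ci z : ℂ) = (ci - α) * ((α + z) * (α + (starRingEnd ℂ) z))
      / ((ci + α) * ((α - z) * (α - (starRingEnd ℂ) z))) := by
    rw [reflPar]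
    push_cast
    simp only [← Complex.mul_conj', map_add, map_sub, Complex.conj_ofReal]
  have h1' : (α - (starRingEnd ℂ) z : ℂ) ≠ 0 := by
    have := (map_ne_zero (starRingEnd ℂ)).2 h1
    simpa using this
  have h2' : (ci - (starRingEnd ℂ) z : ℂ) ≠ 0 := by
    have := (map_ne_zero (starRingEnd ℂ)).2 h2
    simpa using this
  have h3 : (ci + α : ℂ) ≠ 0 := by exact_mod_cast (by positivity : ci + α ≠ 0)
  have hα' : (α : ℂ) ≠ 0 := by exact_mod_cast hα.ne'
  have k1 : (reflPar α ci z : ℂ) * (α - z)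
      = (α + z) * ((ci - α) * (α + (starRingEnd ℂ) z) / ((ci + α) * (α - (starRingEnd ℂ) z))) := by
    rw [e]; field_simp
  rw [flow, k1]
  set w := (starRingEnd ℂ) z with hw
  have n1 : (α + z - (α + z) * ((ci - α) * (α + w) / ((ci + α) * (α - w))) : ℂ)
      = (α + z) * (2 * (α ^ 2 - ci * w)) / ((ci + α) * (α - w)) := by
    field_simp; ring
  have n2 : (α + z + (α + z) * ((ci - α) * (α + w) / ((ci + α) * (α - w))) : ℂ)
      = (α + z) * (2 * α * (ci - w)) / ((ci + α) * (α - w)) := by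
    field_simp; ring
  rw [n1, n2, refl]
  simp only [map_div₀, map_sub, map_mul, map_pow, Complex.conj_ofReal, ← hw]
  field_simp

lemma reflPar_le_one (hz : z ∉ ball (ci : ℂ) ri) : reflPar α ci z ≤ 1 := by
  have h1 := norm_pos_iff.2 (h.sub_ne_zero_of_notMem hz)
  have := h.alpha_pos; have := h.ci_pos
  rw [mem_ball_iff_apollonius h.alpha_pos h.ri_pos h.sq_i, not_lt] at hz
  rw [reflPar, div_le_one (by positivity)]
  exact hz

lemma kap_le_reflPar (hz : z ∉ ball (ci : ℂ) ri) (hz' : z ∈ closedBall (ce : ℂ) re) :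
    kap α ci ce ≤ reflPar α ci z := by
  have h1 := norm_pos_iff.2 (h.sub_ne_zero_of_notMem hz)
  have := h.alpha_pos; have := h.ci_pos
  have h2 := sub_pos.2 h.alpha_lt_ci
  have h3 := sub_pos.2 h.alpha_lt_ce
  rw [mem_closedBall_iff_apollonius h.alpha_pos h.re_pos h.sq_e] at hz'
  rw [reflPar, kap, div_le_div_iff₀ (by positivity) (by positivity)]
  calc (ce + α) * (ci - α) * ((ci + α) * ‖(α : ℂ) - z‖ ^ 2)
      = (ci - α) * (ci + α) * ((ce + α) * ‖(α : ℂ) - z‖ ^ 2) := by ring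
    _ ≤ (ci - α) * (ci + α) * ((ce - α) * ‖(α : ℂ) + z‖ ^ 2) := by gcongr
    _ = _ := by ring

lemma reflPar_pos (hz : z ∉ ball (ci : ℂ) ri) (hz' : z ∈ closedBall (ce : ℂ) re) :
    0 < reflPar α ci z := h.kap_pos.trans_le (h.kap_le_reflPar hz hz')

/-- On the outer circle the reflection thus agrees with a single holomorphic map of the semigroup;
this makes the boundary values of the image series telescope. -/
lemma reflPar_eq_kap (hz : z ∈ sphere (ce : ℂ) re) (hzD : z ∉ ball (ci : ℂ) ri) :
    reflPar α ci z = kap α ci ce := by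
  refine le_antisymm ?_ (h.kap_le_reflPar hzD (sphere_subset_closedBall hz))
  have h1 := norm_pos_iff.2 (h.sub_ne_zero_of_notMem hzD)
  have := h.alpha_pos; have := h.ci_pos
  have h2 := sub_pos.2 h.alpha_lt_ci
  have h3 := sub_pos.2 h.alpha_lt_ce
  have hz' : z ∉ ball (ce : ℂ) re := fun h1 => by
    rw [mem_ball, mem_sphere.1 hz] at h1
    exact lt_irrefl _ h1
  rw [mem_ball_iff_apollonius h.alpha_pos h.re_pos h.sq_e, not_lt] at hz'
  rw [reflPar, kap, div_le_div_iff₀ (by positivity) (by positivity)]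
  calc (ci - α) * ‖(α : ℂ) + z‖ ^ 2 * ((ce - α) * (ci + α))
      = (ci - α) * (ci + α) * ((ce - α) * ‖(α : ℂ) + z‖ ^ 2) := by ring
    _ ≤ (ci - α) * (ci + α) * ((ce + α) * ‖(α : ℂ) - z‖ ^ 2) := by gcongr
    _ = _ := by ring

lemma refl_mem (hz : z ∉ ball (ci : ℂ) ri) (hz' : z ∈ ball (ce : ℂ) re) :
    refl α ci z ∈ ball (ce : ℂ) re := by
  have hz'' := ball_subset_closedBall hz'
  rw [h.refl_eq_flow hz (h.re_pos_of_mem hz'')]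
  exact h.flow_mem' (h.reflPar_pos hz hz'').le (h.reflPar_le_one hz) hz'

/-- `refl` fixes the inner circle. -/
lemma refl_eq_self (hz : z ∈ sphere (ci : ℂ) ri) : refl α ci z = z := by
  have hne : z ∉ ball (ci : ℂ) ri := fun h1 => by
    rw [mem_ball, mem_sphere.1 hz] at h1
    exact lt_irrefl _ h1
  have h2 := (map_ne_zero (starRingEnd ℂ)).2 (h.ci_sub_ne_zero hne)
  have h3 : (z - ci) * (starRingEnd ℂ) (z - ci) = (ri : ℂ) ^ 2 := by
    rw [Complex.mul_conj', mem_sphere_iff_norm.1 hz]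
  have h4 : (α : ℂ) ^ 2 = ci ^ 2 - ri ^ 2 := by exact_mod_cast h.sq_i
  simp only [map_sub, Complex.conj_ofReal] at h2 h3
  rw [refl]
  simp only [map_div₀, map_sub, map_mul, map_pow, Complex.conj_ofReal]
  rw [div_eq_iff h2]
  linear_combination h4 + h3

end TwoCircles

/-! ### The solution by the method of images -/

/-- The holomorphic potential in the inclusion. -/
def innerPot (α κ τ x₀ : ℝ) (F : ℂ → ℂ) (z : ℂ) : ℂ :=
  (1 - τ) * ∑' n : ℕ, (τ : ℂ) ^ n * F (flow α (κ ^ n) z - x₀)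

/-- The derivative of `innerPot`, where `f` is the derivative of `F`. -/
def innerPotD (α κ τ x₀ : ℝ) (f : ℂ → ℂ) (z : ℂ) : ℂ :=
  (1 - τ) * ∑' n : ℕ, (τ : ℂ) ^ n * (f (flow α (κ ^ n) z - x₀) * flowD α (κ ^ n) z)

/-- The holomorphic potential outside the inclusion. -/
def outerPot (α κ τ x₀ ci : ℝ) (F : ℂ → ℂ) (z : ℂ) : ℂ :=
  (innerPot α κ τ x₀ F z - τ * (starRingEnd ℂ) (innerPot α κ τ x₀ F (refl α ci z))) / (1 - τ)

/-- The derivative of `outerPot`. -/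
def outerPotD (α κ τ x₀ ci ri : ℝ) (f : ℂ → ℂ) (z : ℂ) : ℂ :=
  (innerPotD α κ τ x₀ f z - τ * ((starRingEnd ℂ) (innerPotD α κ τ x₀ f (refl α ci z)) *
    (-(ri ^ 2) / (ci - z) ^ 2))) / (1 - τ)

/-- The solution of the transmission problem. -/
def imageSol (α κ τ x₀ ci ri : ℝ) (F : ℂ → ℂ) (z : ℂ) : ℝ :=
  open Classical in
  if z ∈ closedBall (ci : ℂ) ri then (innerPot α κ τ x₀ F z).re
  else (outerPot α κ τ x₀ ci F z).re

lemma hasGradientAt_re {W : ℂ → ℂ} {W' z : ℂ} (h : HasDerivAt W W' z) :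
    HasGradientAt (fun z => (W z).re) ((starRingEnd ℂ) W') z := by
  rw [hasGradientAt_iff_hasFDerivAt]
  have h1 := Complex.reCLM.hasFDerivAt.comp z (h.hasFDerivAt.restrictScalars ℝ)
  refine h1.congr_fderiv ?_
  ext v
  simp [Complex.inner]

namespace TwoCircles

variable {re ri α ci ce : ℝ} (h : TwoCircles re ri α ci ce) {g : ℂ → ℝ} {F f : ℂ → ℂ} {M : ℝ}
  (hF : IsHolomorphicExtension re g F f M) {τ : ℝ} (hτ : |τ| < 1) {z : ℂ}

lemma sub_mem {re ce : ℝ} {z : ℂ} (hz : z ∈ closedBall (ce : ℂ) re) :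
    z - (ce - re : ℝ) ∈ closedBall (re : ℂ) re := by
  rw [mem_closedBall_iff_norm] at hz ⊢
  convert hz using 2
  push_cast; ring

lemma sub_mem' {re ce : ℝ} {z : ℂ} (hz : z ∈ ball (ce : ℂ) re) :
    z - (ce - re : ℝ) ∈ ball (re : ℂ) re := by
  rw [mem_ball_iff_norm] at hz ⊢
  convert hz using 2
  push_cast; ring

include hF in
lemma _root_.ImageCharge.IsHolomorphicExtension.M_nonneg (hre : 0 < re) : 0 ≤ M :=
  (norm_nonneg _).trans (hF.norm_le re (mem_closedBall_self hre.le))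

include h hF hτ

lemma continuousOn_innerPot :
    ContinuousOn (innerPot α (kap α ci ce) τ (ce - re) F) (closedBall (ce : ℂ) re) := by
  obtain ⟨B, hB⟩ := (isCompact_closedBall (re : ℂ) re).exists_bound_of_continuousOn hF.continuousOn
  refine ContinuousOn.mul continuousOn_const (continuousOn_tsum (u := fun n => |τ| ^ n * B)
    (fun n => continuousOn_const.mul ?_)
    ((summable_geometric_of_lt_one (abs_nonneg _) hτ).mul_right B) fun n z hz => ?_)
  · have hk := h.kap_pow_mem n
    refine hF.continuousOn.comp (f := fun z => flow α (kap α ci ce ^ n) z - (ce - re : ℝ))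
      (ContinuousOn.sub (fun z hz => ?_) continuousOn_const)
      (fun z hz => sub_mem (h.flow_mem hk.1 hk.2 hz))
    exact (hasDerivAt_flow h.alpha_pos (h.re_pos_of_mem hz).le hk.1
      hk.2).continuousAt.continuousWithinAt
  · have hk := h.kap_pow_mem n
    rw [norm_mul, norm_pow, Complex.norm_real, Real.norm_eq_abs]
    gcongr
    exact hB _ (sub_mem (h.flow_mem hk.1 hk.2 hz))

lemma hasDerivAt_innerPot (hz : z ∈ ball (ce : ℂ) re) :
    HasDerivAt (innerPot α (kap α ci ce) τ (ce - re) F)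
      (innerPotD α (kap α ci ce) τ (ce - re) f z) z := by
  obtain ⟨B, hB⟩ := (isCompact_closedBall (re : ℂ) re).exists_bound_of_continuousOn hF.continuousOn
  have hbd := ball_subset_closedBall (x := (ce : ℂ)) (ε := re)
  refine HasDerivAt.const_mul _ (hasDerivAt_tsum_of_isPreconnected (t := ball (ce : ℂ) re)
    (g := fun (n : ℕ) z => (τ : ℂ) ^ n * F (flow α (kap α ci ce ^ n) z - (ce - re : ℝ)))
    (g' := fun (n : ℕ) z => (τ : ℂ) ^ n *
      (f (flow α (kap α ci ce ^ n) z - (ce - re : ℝ)) * flowD α (kap α ci ce ^ n) z))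
    (u := fun n => |τ| ^ n * M)
    ((summable_geometric_of_lt_one (abs_nonneg _) hτ).mul_right M) isOpen_ball
    (convex_ball _ _).isPreconnected (fun n y hy => ?_) (fun n y hy => ?_) hz ?_ hz)
  · have hk := h.kap_pow_mem n
    refine HasDerivAt.const_mul _ ?_
    have h1 := hF.hasDerivAt _ (sub_mem' (h.flow_mem' hk.1 hk.2 hy))
    exact h1.comp y ((hasDerivAt_flow h.alpha_pos (h.re_pos_of_mem (hbd hy)).le hk.1
      hk.2).sub_const _)
  · have hk := h.kap_pow_mem n
    rw [norm_mul, norm_pow, Complex.norm_real, Real.norm_eq_abs, norm_mul]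
    have h1 := hF.norm_le _ (sub_mem (h.flow_mem hk.1 hk.2 (hbd hy)))
    have h2 := norm_flowD_le_one h.alpha_pos (h.re_pos_of_mem (hbd hy)).le hk.1 hk.2
    have hM := hF.M_nonneg h.re_pos
    calc _ ≤ |τ| ^ n * (M * 1) := by gcongr
      _ = _ := by ring
  · refine summable_pow_mul_of_bounded hτ (B := B) fun n => ?_
    have hk := h.kap_pow_mem n
    exact hB _ (sub_mem (h.flow_mem hk.1 hk.2 (hbd hz)))

/-- By the semigroup law, composing the series with `flow κ` shifts its index by one, so only the
term `n = 0` survives. On the outer circle this is the Dirichlet condition. -/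
lemma innerPot_sub (hz : z ∈ closedBall (ce : ℂ) re) :
    innerPot α (kap α ci ce) τ (ce - re) F z
      - τ * innerPot α (kap α ci ce) τ (ce - re) F (flow α (kap α ci ce) z)
      = (1 - τ) * F (z - (ce - re : ℝ)) := by
  obtain ⟨B, hB⟩ := (isCompact_closedBall (re : ℂ) re).exists_bound_of_continuousOn hF.continuousOn
  have hs : Summable fun n => (τ : ℂ) ^ n * F (flow α (kap α ci ce ^ n) z - (ce - re : ℝ)) := by
    refine summable_pow_mul_of_bounded hτ (B := B) fun n => ?_
    have hk := h.kap_pow_mem n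
    exact hB _ (sub_mem (h.flow_mem hk.1 hk.2 hz))
  have hne := flow_den_ne_zero h.alpha_pos (h.re_pos_of_mem hz).le h.kap_pos.le h.kap_lt_one.le
  rw [innerPot, innerPot, hs.tsum_eq_zero_add]
  simp only [flow_flow hne h.alpha_pos, ← pow_succ]
  rw [pow_zero, pow_zero, flow_one h.alpha_pos, one_mul, mul_left_comm, ← tsum_mul_left,
    ← mul_sub]
  congr 1
  rw [add_sub_assoc, ← tsum_congr (fun n => by rw [pow_succ', mul_assoc]), sub_self, add_zero]

omit hτ in
lemma norm_image_le (hz : z ∈ closedBall (ce : ℂ) re) (n : ℕ) :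
    ‖f (flow α (kap α ci ce ^ n) z - (ce - re : ℝ)) * flowD α (kap α ci ce ^ n) z‖ ≤ M := by
  have hk := h.kap_pow_mem n
  rw [norm_mul]
  have h1 := hF.norm_le _ (sub_mem (h.flow_mem hk.1 hk.2 hz))
  have h2 := norm_flowD_le_one h.alpha_pos (h.re_pos_of_mem hz).le hk.1 hk.2
  have hM := hF.M_nonneg h.re_pos
  calc _ ≤ M * 1 := by gcongr
    _ = _ := mul_one M

omit hτ hF in
lemma norm_alpha_sub_le (hz : z ∈ closedBall (ce : ℂ) re) : ‖(α : ℂ) - z‖ ≤ 2 * re := by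
  have h1 : ‖(α : ℂ) - ce‖ ≤ re := by
    rw [← Complex.ofReal_sub, Complex.norm_real, Real.norm_eq_abs, abs_sub_comm,
      abs_of_pos (sub_pos.2 h.alpha_lt_ce)]
    nlinarith [h.sq_e, h.alpha_pos, h.alpha_lt_ce, h.re_pos]
  rw [mem_closedBall_iff_norm'] at hz
  have : (α : ℂ) - z = (α - ce) + (ce - z) := by ring
  rw [this]
  exact (norm_add_le _ _).trans (by linarith)

/-- The gradient of the inner potential is bounded uniformly. -/
lemma norm_innerPotD_le (hz : z ∈ closedBall (ce : ℂ) re) :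
    ‖innerPotD α (kap α ci ce) τ (ce - re) f z‖ ≤ M * (6 + 4 * re) := by
  have hM := hF.M_nonneg h.re_pos
  have hα := h.alpha_pos
  have hzr := (h.re_pos_of_mem hz).le
  have hq : 0 ≤ ‖z‖ / α := by positivity
  set κ := kap α ci ce with hκ
  have hk : ∀ n, 0 ≤ κ ^ n ∧ κ ^ n ≤ 1 := h.kap_pow_mem
  have hka : ∀ n, κ ^ (n + 1) ≤ κ ^ n := fun n =>
    pow_le_pow_of_le_one h.kap_pos.le h.kap_lt_one.le (Nat.le_succ n)
  have hmem : ∀ n, flow α (κ ^ n) z - (ce - re : ℝ) ∈ closedBall (re : ℂ) re := fun n =>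
    sub_mem (h.flow_mem (hk n).1 (hk n).2 hz)
  have hdz := h.norm_alpha_sub_le hz
  have hre := h.re_pos
  -- The first term pays for the variation of `flowD`, with `|f| ≤ M`; the second for that of `f`
  -- along the flow line, with Lipschitz constant `M` and length factor `2 |α - z| ≤ 4 re`. Adding
  -- `M` for the first image gives `M (1 + 5 + 4 re)`.
  set U : ℕ → ℝ := fun n => M * varD (‖z‖ / α) (κ ^ n) + M * (4 * re) * varF (‖z‖ / α) (κ ^ n)
    with hU
  have := norm_one_sub_mul_tsum_le hτ (a := fun n => f (flow α (κ ^ n) z - (ce - re : ℝ)) *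
    flowD α (κ ^ n) z) (B := M) (h.norm_image_le hF hz) (U := U) (C := M * (5 + 4 * re)) ?_ ?_
  · rw [innerPotD]
    refine this.trans (le_of_eq (by ring))
  · intro n
    have d1 := norm_flowD_sub_le hα hzr (hk (n + 1)).1 (hka n) (hk n).2
    have d2 := norm_flow_sub_le hα hzr (hk (n + 1)).1 (hka n) (hk n).2
    have d3 := hF.lipschitz _ (hmem (n + 1)) _ (hmem n)
    have d4 := hF.norm_le _ (hmem (n + 1))
    have d5 := norm_flowD_le_one hα hzr (hk n).1 (hk n).2
    have d6 := varF_anti hq (hk (n + 1)).1 (hka n) (hk n).2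
    rw [sub_sub_sub_cancel_right] at d3
    have e : ∀ a b c d : ℂ, a * b - c * d = a * (b - d) + (a - c) * d := by intros; ring
    rw [e]
    refine (norm_add_le _ _).trans ?_
    rw [norm_mul, norm_mul]
    calc _ ≤ M * (varD (‖z‖ / α) (κ ^ (n + 1)) - varD (‖z‖ / α) (κ ^ n))
          + (M * (2 * (2 * re) * (varF (‖z‖ / α) (κ ^ (n + 1)) - varF (‖z‖ / α) (κ ^ n)))) * 1 := by
          have := sub_nonneg.2 d6
          gcongr
          exact d3.trans (by gcongr; exact d2.trans (by gcongr))
      _ = _ := by simp only [hU]; ring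
  · intro n
    have a1 := varD_mem hq (hk n).1 (hk n).2
    have a2 := varD_mem hq (hk 0).1 (hk 0).2
    have a3 := varF_mem hq (hk n).1 (hk n).2
    have a4 := varF_mem hq (hk 0).1 (hk 0).2
    have b1 : M * (varD (‖z‖ / α) (κ ^ n) - varD (‖z‖ / α) (κ ^ 0)) ≤ M * 5 := by
      gcongr; linarith
    have b2 : M * (4 * re) * (varF (‖z‖ / α) (κ ^ n) - varF (‖z‖ / α) (κ ^ 0))
        ≤ M * (4 * re) * 1 := by
      gcongr; linarith
    simp only [hU]
    linarith

/-- The factor `1 - τ` is kept because the outer potential divides by it. The price is `1/(1 - κ)`,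
from the geometric decay `|flowD| ≤ 4 κⁿ`. -/
lemma norm_innerPotD_le' (hz : z ∈ closedBall (ce : ℂ) re) :
    ‖innerPotD α (kap α ci ce) τ (ce - re) f z‖ ≤ (1 - τ) * (4 * M / (1 - kap α ci ce)) := by
  have hM := hF.M_nonneg h.re_pos
  have hτ' := abs_lt.1 hτ
  rw [innerPotD, norm_mul, ← Complex.ofReal_one, ← Complex.ofReal_sub, Complex.norm_real,
    Real.norm_of_nonneg (by linarith)]
  gcongr
  · linarith
  have hs := (hasSum_geometric_of_lt_one h.kap_pos.le h.kap_lt_one).mul_left (4 * M)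
  rw [div_eq_mul_inv]
  refine tsum_of_norm_bounded hs fun n => ?_
  have hk := h.kap_pow_mem n
  rw [norm_mul, norm_mul, norm_pow, Complex.norm_real, Real.norm_eq_abs]
  have h1 := hF.norm_le _ (sub_mem (h.flow_mem hk.1 hk.2 hz))
  have h2 := norm_flowD_le_mul h.alpha_pos (h.re_pos_of_mem hz).le hk.1 hk.2
  calc _ ≤ 1 * (M * (4 * kap α ci ce ^ n)) := by
        gcongr
        exact pow_le_one₀ (abs_nonneg _) hτ.le
    _ = _ := by ring

lemma hasDerivAt_outerPot (hz : z ∈ ball (ce : ℂ) re) (hzr : refl α ci z ∈ ball (ce : ℂ) re)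
    (hne : (ci - z : ℂ) ≠ 0) :
    HasDerivAt (outerPot α (kap α ci ce) τ (ce - re) ci F)
      (outerPotD α (kap α ci ce) τ (ce - re) ci ri f z) z := by
  have h1 := h.hasDerivAt_innerPot hF hτ hz
  -- Conjugation inside and outside the potential restores holomorphy; what remains is composed with
  -- the Möbius map `(α² - cᵢ z) / (cᵢ - z)`.
  have h2 := (h.hasDerivAt_innerPot hF hτ hzr).conj_conj
  have h3 : HasDerivAt (fun z : ℂ => (α ^ 2 - ci * z) / (ci - z)) (-(ri ^ 2) / (ci - z) ^ 2) z := by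
    have n1 : HasDerivAt (fun z : ℂ => (α ^ 2 - ci * z : ℂ)) (-(ci * 1)) z :=
      ((hasDerivAt_id z).const_mul (ci : ℂ)).const_sub _
    have n2 : HasDerivAt (fun z : ℂ => (ci - z : ℂ)) (-1) z := (hasDerivAt_id z).const_sub _
    refine (n1.div n2 hne).congr_deriv ?_
    congr 1
    have : (α : ℂ) ^ 2 = ci ^ 2 - ri ^ 2 := by exact_mod_cast h.sq_i
    linear_combination this
  have h4 : (starRingEnd ℂ) (refl α ci z) = (α ^ 2 - ci * z) / (ci - z) := by
    rw [refl, Complex.conj_conj]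
  rw [h4] at h2
  have h5 := h2.comp z h3
  have h6 := (h1.sub (h5.const_mul (τ : ℂ))).div_const (1 - τ : ℂ)
  exact h6

omit hF in
/-- The gradient of the outer potential, in terms of a bound of that of the inner one. -/
lemma norm_outerPotD_le {B : ℝ} (hB : ∀ w ∈ ball (ce : ℂ) re,
      ‖innerPotD α (kap α ci ce) τ (ce - re) f w‖ ≤ B)
    (hz : z ∈ ball (ce : ℂ) re) (hzD : z ∉ ball (ci : ℂ) ri) :
    ‖outerPotD α (kap α ci ce) τ (ce - re) ci ri f z‖ ≤ 2 * B / (1 - τ) := by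
  have h1 := hB z hz
  have h2 := hB _ (h.refl_mem hzD hz)
  have hB0 := (norm_nonneg _).trans h1
  have hτ' := abs_lt.1 hτ
  rw [outerPotD, norm_div]
  have e : ‖(1 - τ : ℂ)‖ = 1 - τ := by
    rw [← Complex.ofReal_one, ← Complex.ofReal_sub, Complex.norm_real,
      Real.norm_of_nonneg (by linarith)]
  rw [e]
  have : 0 < 1 - τ := by linarith
  gcongr
  refine (norm_sub_le _ _).trans ?_
  rw [norm_mul, norm_mul, RCLike.norm_conj, Complex.norm_real, Real.norm_eq_abs]
  -- Outside `D` the reflection does not increase lengths, as `|cᵢ - z| ≥ rᵢ`.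
  have h3 : ‖(-(ri ^ 2) / (ci - z) ^ 2 : ℂ)‖ ≤ 1 := by
    rw [norm_div, norm_neg, norm_pow, norm_pow, Complex.norm_real, Real.norm_eq_abs,
      abs_of_pos h.ri_pos]
    rw [mem_ball_iff_norm', not_lt] at hzD
    have := h.ri_pos
    rw [div_le_one (by have := this.trans_le hzD; positivity)]
    gcongr
  calc _ ≤ B + 1 * (B * 1) := by gcongr
    _ = _ := by ring

end TwoCircles

lemma closure_incl {re ri ε : ℝ} (hri : 0 < ri) :
    closure (Incl re ri ε) = closedBall (cI re ri ε : ℂ) ri := closure_ball _ hri.ne'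

lemma closure_omega {re ri ε : ℝ} (hre : 0 < re) :
    closure (Omega re ri ε) = closedBall (cE re ri ε : ℂ) re := closure_ball _ hre.ne'

lemma gradient_re_of_eventuallyEq {v : ℂ → ℝ} {W : ℂ → ℂ} {W' z : ℂ} (hW : HasDerivAt W W' z)
    (hv : v =ᶠ[𝓝 z] fun z => (W z).re) : HasGradientAt v ((starRingEnd ℂ) W') z :=
  (hasGradientAt_re hW).congr_of_eventuallyEq hv

lemma abs_tau_lt_one {k : ℝ} (hk : 0 < k) : |tau k| < 1 := by
  rw [tau, abs_lt]
  constructor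
  · rw [lt_div_iff₀ (by linarith)]; linarith
  · rw [div_lt_one (by linarith)]; linarith

lemma one_sub_tau {k : ℝ} (hk : 0 < k) : 1 - tau k = 2 / (k + 1) := by
  rw [tau]; field_simp; ring

namespace TwoCircles

variable {re ri α ci ce : ℝ} (h : TwoCircles re ri α ci ce) {g : ℂ → ℝ} {F f : ℂ → ℂ} {M : ℝ}
  (hF : IsHolomorphicExtension re g F f M) {τ : ℝ} (hτ : |τ| < 1) {z : ℂ}

include h

/-- Equating the two expressions of `α²` gives `(ce - ci)(ce + ci) = (re - ri)(re + ri)`, and `ce +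
ci` exceeds `re + ri`. -/
lemma sub_lt : ce - ci < re - ri := by
  have h1 : ri < ci := by nlinarith [h.sq_i, h.alpha_pos, h.ri_pos, h.ci_pos]
  have h2 : re < ce := by nlinarith [h.sq_e, h.alpha_pos, h.re_pos, h.ce_pos]
  have h3 : (ce - ci) * (ce + ci) = (re - ri) * (re + ri) := by
    linear_combination h.sq_i - h.sq_e
  have h4 := sub_pos.2 h.ci_lt
  by_contra hc
  push Not at hc
  have h5 := h.ri_pos; have h6 := h.re_pos
  nlinarith [mul_le_mul_of_nonneg_right hc (by linarith : 0 ≤ re + ri),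
    mul_pos h4 (by linarith : 0 < ce + ci - (re + ri))]

lemma closedBall_subset : closedBall (ci : ℂ) ri ⊆ ball (ce : ℂ) re := by
  refine closedBall_subset_ball' ?_
  rw [Complex.dist_of_im_eq (by simp), Complex.ofReal_re, Complex.ofReal_re, Real.dist_eq,
    abs_sub_comm, abs_of_pos (sub_pos.2 h.ci_lt)]
  linarith [h.sub_lt]

lemma notMem_of_sphere (hz : z ∈ sphere (ce : ℂ) re) : z ∉ closedBall (ci : ℂ) ri := fun h1 => by
  have := h.closedBall_subset h1
  rw [mem_ball, mem_sphere.1 hz] at this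
  exact lt_irrefl _ this

lemma refl_mem_closedBall (hz : z ∉ ball (ci : ℂ) ri) (hz' : z ∈ closedBall (ce : ℂ) re) :
    refl α ci z ∈ closedBall (ce : ℂ) re := by
  rw [h.refl_eq_flow hz (h.re_pos_of_mem hz')]
  exact h.flow_mem (h.reflPar_pos hz hz').le (h.reflPar_le_one hz) hz'

omit h in
lemma continuousAt_refl (hz : (ci - z : ℂ) ≠ 0) : ContinuousAt (refl α ci) z := by
  have : ContinuousAt (fun z : ℂ => (α ^ 2 - ci * z) / (ci - z)) z :=
    ContinuousAt.div (by fun_prop) (by fun_prop) hz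
  exact Complex.continuous_conj.continuousAt.comp this

omit h in
lemma notMem_ball_of_sphere {c x : ℂ} {r : ℝ} (hx : x ∈ sphere c r) : x ∉ ball c r := fun h1 => by
  rw [mem_ball, mem_sphere.1 hx] at h1
  exact lt_irrefl _ h1

omit h in
lemma eq_add_smul {c x ν : ℂ} {r : ℝ} (hr : 0 < r) (hν : ν = r⁻¹ • (x - c)) : x = c + r * ν := by
  have : (r : ℂ) ≠ 0 := by exact_mod_cast hr.ne'
  rw [hν, Complex.real_smul]; push_cast
  field_simp; ring

omit h in
lemma norm_normal {c x ν : ℂ} {r : ℝ} (hr : 0 < r) (hx : x ∈ sphere c r)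
    (hν : ν = r⁻¹ • (x - c)) : ‖ν‖ = 1 := by
  rw [hν, norm_smul, mem_sphere_iff_norm.1 hx, norm_inv, Real.norm_of_nonneg hr.le,
    inv_mul_cancel₀ hr.ne']

omit h in
lemma tendsto_add_smul (x ν : ℂ) : Tendsto (fun t : ℝ => x + t • ν) (𝓝[>] 0) (𝓝 x) := by
  have h1 := (by fun_prop : Continuous fun t : ℝ => x + t • ν).tendsto 0
  simp only [zero_smul, add_zero] at h1
  exact h1.mono_left nhdsWithin_le_nhds

omit h in
lemma tendsto_sub_smul (x ν : ℂ) : Tendsto (fun t : ℝ => x - t • ν) (𝓝[>] 0) (𝓝 x) := by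
  simpa [sub_eq_add_neg] using tendsto_add_smul x (-ν)

lemma eventually_outer {x ν : ℂ} (hx : x ∈ sphere (ci : ℂ) ri) (hν : ν = ri⁻¹ • (x - (ci : ℂ))) :
    ∀ᶠ t : ℝ in 𝓝[>] 0, x + t • ν ∈ ball (ce : ℂ) re ∧ x + t • ν ∉ closedBall (ci : ℂ) ri := by
  have hxe := h.closedBall_subset (sphere_subset_closedBall hx)
  have hri := h.ri_pos
  filter_upwards [(tendsto_add_smul x ν).eventually (isOpen_ball.mem_nhds hxe),
    self_mem_nhdsWithin] with t ht ht0
  have ht0' : (0 : ℝ) < t := ht0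
  refine ⟨ht, ?_⟩
  rw [mem_closedBall_iff_norm, eq_add_smul hri hν, Complex.real_smul,
    show (ci + ri * ν + t * ν - ci : ℂ) = ((ri + t : ℝ) : ℂ) * ν by push_cast; ring,
    norm_mul, norm_normal hri hx hν, mul_one, Complex.norm_real, Real.norm_of_nonneg (by positivity)]
  linarith

lemma eventually_inner {x ν : ℂ} (hx : x ∈ sphere (ci : ℂ) ri) (hν : ν = ri⁻¹ • (x - (ci : ℂ))) :
    ∀ᶠ t : ℝ in 𝓝[>] 0, x - t • ν ∈ ball (ci : ℂ) ri := by
  have hri := h.ri_pos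
  filter_upwards [Ioo_mem_nhdsGT hri] with t ht
  rw [mem_ball_iff_norm, eq_add_smul hri hν, Complex.real_smul,
    show (ci + ri * ν - t * ν - ci : ℂ) = ((ri - t : ℝ) : ℂ) * ν by push_cast; ring,
    norm_mul, norm_normal hri hx hν, mul_one, Complex.norm_real,
    Real.norm_of_nonneg (by linarith [ht.2])]
  linarith [ht.1]

include hF hτ

lemma analyticAt_innerPot (hz : z ∈ ball (ce : ℂ) re) :
    AnalyticAt ℂ (innerPot α (kap α ci ce) τ (ce - re) F) z :=
  Complex.analyticAt_iff_eventually_differentiableAt.2 <| by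
    filter_upwards [isOpen_ball.mem_nhds hz] with w hw
    exact (h.hasDerivAt_innerPot hF hτ hw).differentiableAt

lemma eventually_hasDerivAt_outerPot (hz : z ∈ ball (ce : ℂ) re) (hzD : z ∉ ball (ci : ℂ) ri) :
    ∀ᶠ w in 𝓝 z, HasDerivAt (outerPot α (kap α ci ce) τ (ce - re) ci F)
      (outerPotD α (kap α ci ce) τ (ce - re) ci ri f w) w := by
  have hne := h.ci_sub_ne_zero hzD
  filter_upwards [isOpen_ball.mem_nhds hz, (continuousAt_refl (α := α) hne).preimage_mem_nhds
    (isOpen_ball.mem_nhds (h.refl_mem hzD hz)),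
    (by fun_prop : ContinuousAt (fun z : ℂ => (ci - z : ℂ)) z).eventually_ne hne] with w h1 h2 h3
  exact h.hasDerivAt_outerPot hF hτ h1 h2 h3

lemma analyticAt_outerPot (hz : z ∈ ball (ce : ℂ) re) (hzD : z ∉ ball (ci : ℂ) ri) :
    AnalyticAt ℂ (outerPot α (kap α ci ce) τ (ce - re) ci F) z :=
  Complex.analyticAt_iff_eventually_differentiableAt.2
    ((h.eventually_hasDerivAt_outerPot hF hτ hz hzD).mono fun _ h1 => h1.differentiableAt)

lemma continuousAt_innerPotD (hz : z ∈ ball (ce : ℂ) re) :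
    ContinuousAt (innerPotD α (kap α ci ce) τ (ce - re) f) z := by
  refine (h.analyticAt_innerPot hF hτ hz).deriv.continuousAt.congr ?_
  filter_upwards [isOpen_ball.mem_nhds hz] with w hw
  exact (h.hasDerivAt_innerPot hF hτ hw).deriv

lemma continuousAt_outerPotD (hz : z ∈ ball (ce : ℂ) re) (hzD : z ∉ ball (ci : ℂ) ri) :
    ContinuousAt (outerPotD α (kap α ci ce) τ (ce - re) ci ri f) z :=
  (h.analyticAt_outerPot hF hτ hz hzD).deriv.continuousAt.congr
    ((h.eventually_hasDerivAt_outerPot hF hτ hz hzD).mono fun _ h1 => h1.deriv)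

omit hF in
lemma re_outerPot_eq (hz : z ∈ sphere (ci : ℂ) ri) :
    (outerPot α (kap α ci ce) τ (ce - re) ci F z).re
      = (innerPot α (kap α ci ce) τ (ce - re) F z).re := by
  have hτ' := abs_lt.1 hτ
  have e : (1 - τ : ℂ) = ((1 - τ : ℝ) : ℂ) := by push_cast; rfl
  rw [outerPot, h.refl_eq_self hz, e, Complex.div_ofReal_re]
  have : 1 - τ ≠ 0 := by linarith
  simp only [Complex.sub_re, Complex.re_ofReal_mul, Complex.conj_re]
  field_simp

lemma continuousOn_imageSol :
    ContinuousOn (imageSol α (kap α ci ce) τ (ce - re) ci ri F) (closedBall (ce : ℂ) re) := by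
  have hsub := h.closedBall_subset.trans ball_subset_closedBall
  have e : closedBall (ce : ℂ) re
      = closedBall (ci : ℂ) ri ∪ (closedBall (ce : ℂ) re \ ball (ci : ℂ) ri) := by
    ext z
    simp only [mem_union, Set.mem_sdiff]
    constructor
    · intro hz
      by_cases h1 : z ∈ ball (ci : ℂ) ri
      · exact Or.inl (ball_subset_closedBall h1)
      · exact Or.inr ⟨hz, h1⟩
    · rintro (h1 | h1)
      · exact hsub h1
      · exact h1.1
  have hA := h.continuousOn_innerPot hF hτ
  rw [e]
  refine ContinuousOn.union_of_isClosed ?_ ?_ isClosed_closedBall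
    (isClosed_closedBall.sdiff isOpen_ball)
  · refine (Complex.continuous_re.comp_continuousOn (hA.mono hsub)).congr fun z hz => ?_
    simp [imageSol, hz]
  · have hO : ContinuousOn (outerPot α (kap α ci ce) τ (ce - re) ci F)
        (closedBall (ce : ℂ) re \ ball (ci : ℂ) ri) := by
      refine ContinuousOn.div_const (ContinuousOn.sub (hA.mono sdiff_subset)
        (continuousOn_const.mul (Complex.continuous_conj.comp_continuousOn ?_))) _
      refine hA.comp (fun z hz => ?_) (fun z hz => h.refl_mem_closedBall hz.2 hz.1)
      exact (continuousAt_refl (h.ci_sub_ne_zero hz.2)).continuousWithinAt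
    refine (Complex.continuous_re.comp_continuousOn hO).congr fun z hz => ?_
    by_cases h1 : z ∈ closedBall (ci : ℂ) ri
    · have h2 : z ∈ sphere (ci : ℂ) ri := by
        rw [mem_sphere]; exact le_antisymm h1 (not_lt.1 hz.2)
      simp only [imageSol, if_pos h1, Function.comp]
      exact (h.re_outerPot_eq hτ h2).symm
    · simp only [imageSol, if_neg h1, Function.comp]

omit hF hτ h in
lemma imageSol_eventuallyEq_inner (hz : z ∈ ball (ci : ℂ) ri) {κ x₀ : ℝ} :
    imageSol α κ τ x₀ ci ri F =ᶠ[𝓝 z] fun z => (innerPot α κ τ x₀ F z).re := by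
  filter_upwards [isOpen_ball.mem_nhds hz] with w hw
  simp only [imageSol, if_pos (ball_subset_closedBall hw)]

omit hF hτ h in
lemma imageSol_eventuallyEq_outer (hz : z ∉ closedBall (ci : ℂ) ri) {κ x₀ : ℝ} :
    imageSol α κ τ x₀ ci ri F =ᶠ[𝓝 z] fun z => (outerPot α κ τ x₀ ci F z).re := by
  filter_upwards [isClosed_closedBall.isOpen_compl.mem_nhds hz] with w hw
  simp only [imageSol, if_neg hw]

lemma hasGradientAt_imageSol_inner (hz : z ∈ ball (ci : ℂ) ri) :
    HasGradientAt (imageSol α (kap α ci ce) τ (ce - re) ci ri F)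
      ((starRingEnd ℂ) (innerPotD α (kap α ci ce) τ (ce - re) f z)) z :=
  gradient_re_of_eventuallyEq
    (h.hasDerivAt_innerPot hF hτ (h.closedBall_subset (ball_subset_closedBall hz)))
    (imageSol_eventuallyEq_inner hz)

lemma hasGradientAt_imageSol_outer (hz : z ∈ ball (ce : ℂ) re) (hzD : z ∉ closedBall (ci : ℂ) ri) :
    HasGradientAt (imageSol α (kap α ci ce) τ (ce - re) ci ri F)
      ((starRingEnd ℂ) (outerPotD α (kap α ci ce) τ (ce - re) ci ri f z)) z :=
  gradient_re_of_eventuallyEq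
    (h.eventually_hasDerivAt_outerPot hF hτ hz
      (fun h1 => hzD (ball_subset_closedBall h1))).self_of_nhds
    (imageSol_eventuallyEq_outer hzD)

lemma imageSol_boundary (hz : z ∈ sphere (ce : ℂ) re) :
    imageSol α (kap α ci ce) τ (ce - re) ci ri F z = g (z - (ce - re : ℝ)) := by
  have hzD := h.notMem_of_sphere hz
  have hzD' : z ∉ ball (ci : ℂ) ri := fun h1 => hzD (ball_subset_closedBall h1)
  have hz' := sphere_subset_closedBall hz
  have hτ' := abs_lt.1 hτ
  have h1 := h.innerPot_sub hF hτ hz'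
  have e : (1 - τ : ℂ) = ((1 - τ : ℝ) : ℂ) := by push_cast; rfl
  have hne : 1 - τ ≠ 0 := by linarith
  have hmem : z - (ce - re : ℝ) ∈ sphere (re : ℂ) re := by
    rw [mem_sphere_iff_norm] at hz ⊢
    convert hz using 2
    push_cast; ring
  simp only [imageSol, if_neg hzD]
  rw [outerPot, h.refl_eq_flow hzD' (h.re_pos_of_mem hz'), h.reflPar_eq_kap hz hzD',
    e, Complex.div_ofReal_re, ← hF.re_eq _ hmem]
  have h2 := congrArg Complex.re h1
  rw [e, Complex.re_ofReal_mul] at h2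
  simp only [Complex.sub_re, Complex.re_ofReal_mul, Complex.conj_re] at h2 ⊢
  rw [h2]
  field_simp

omit hF in
/-- The normal derivative of the outer potential on the inner circle. -/
lemma re_outerPotD_mul (hz : z ∈ sphere (ci : ℂ) ri) {ν : ℂ} (hν : ν = ri⁻¹ • (z - (ci : ℂ))) :
    (outerPotD α (kap α ci ce) τ (ce - re) ci ri f z * ν).re
      = (1 + τ) / (1 - τ) * (innerPotD α (kap α ci ce) τ (ce - re) f z * ν).re := by
  have hτ' := abs_lt.1 hτ
  have e : (1 - τ : ℂ) = ((1 - τ : ℝ) : ℂ) := by push_cast; rfl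
  have hne : 1 - τ ≠ 0 := by linarith
  have hri : (ri : ℂ) ≠ 0 := by exact_mod_cast h.ri_pos.ne'
  have hzν : (ci - z : ℂ) = -(ri * ν) := by
    rw [hν, Complex.real_smul]; push_cast; field_simp; ring
  have hn : ν * (starRingEnd ℂ) ν = 1 := by
    rw [Complex.mul_conj', hν, norm_smul, mem_sphere_iff_norm.1 hz, norm_inv,
      Real.norm_of_nonneg h.ri_pos.le, inv_mul_cancel₀ h.ri_pos.ne']
    simp
  have hν0 : ν ≠ 0 := fun h0 => by rw [h0] at hn; simp at hn
  rw [outerPotD, h.refl_eq_self hz, hzν]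
  set A := innerPotD α (kap α ci ce) τ (ce - re) f z
  -- On the circle `cᵢ - z = -rᵢ ν`, so the derivative of the reflection is `-ν⁻²`. The reflected
  -- term becomes `+τ conj (A ν)`, which has the same real part as `τ A ν`: hence the factor `1 +
  -- τ`.
  have e2 : (A - τ * ((starRingEnd ℂ) A * (-(ri ^ 2) / (-(ri * ν)) ^ 2))) / (1 - τ) * ν
      = (A * ν + τ * (starRingEnd ℂ) (A * ν)) / ((1 - τ : ℝ) : ℂ) := by
    have e3 : (starRingEnd ℂ) ν = ν⁻¹ := eq_inv_of_mul_eq_one_right hn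
    rw [map_mul, e3, ← e]
    field_simp
    ring
  rw [e2, Complex.div_ofReal_re]
  simp only [Complex.add_re, Complex.re_ofReal_mul, Complex.conj_re]
  field_simp

end TwoCircles

/-- The method of images solves the transmission problem. -/
theorem isDirichletSolution_imageSol {re ri ε k : ℝ}
    (h : TwoCircles re ri (alpha re ri ε) (cI re ri ε) (cE re ri ε))
    {g : ℂ → ℝ} {F f : ℂ → ℂ} {M : ℝ} (hF : IsHolomorphicExtension re g F f M) (hk : 0 < k) :
    IsDirichletSolution re ri ε k g
      (imageSol (alpha re ri ε) (kap (alpha re ri ε) (cI re ri ε) (cE re ri ε)) (tau k)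
        (cE re ri ε - re) (cI re ri ε) ri F) := by
  have hτ := abs_tau_lt_one hk
  refine ⟨?_, ?_, ?_, ?_⟩
  · rintro z (hz | ⟨hz, hzD⟩)
    · exact (InnerProductSpace.harmonicAt_congr_nhds (TwoCircles.imageSol_eventuallyEq_inner hz)).2
        (h.analyticAt_innerPot hF hτ (h.closedBall_subset (ball_subset_closedBall hz))).harmonicAt_re
    · rw [closure_incl h.ri_pos] at hzD
      exact (InnerProductSpace.harmonicAt_congr_nhds (TwoCircles.imageSol_eventuallyEq_outer hzD)).2
        (h.analyticAt_outerPot hF hτ hz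
          (fun h1 => hzD (ball_subset_closedBall h1))).harmonicAt_re
  · rw [closure_omega h.re_pos]
    exact h.continuousOn_imageSol hF hτ
  · intro x hx ν hν
    set α := alpha re ri ε
    set ci := cI re ri ε
    set ce := cE re ri ε
    have hxD := TwoCircles.notMem_ball_of_sphere hx
    have hxe := h.closedBall_subset (sphere_subset_closedBall hx)
    refine ⟨(outerPotD α (kap α ci ce) (tau k) (ce - re) ci ri f x * ν).re,
      (innerPotD α (kap α ci ce) (tau k) (ce - re) f x * ν).re, ?_, ?_, ?_⟩
    · have h1 := ((h.continuousAt_outerPotD hF hτ hxe hxD).tendsto.comp (TwoCircles.tendsto_add_smul x ν)).mul_const ν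
      refine ((Complex.continuous_re.tendsto _).comp h1).congr' ?_
      filter_upwards [h.eventually_outer hx hν] with t ht
      simp only [Function.comp_apply]
      rw [(h.hasGradientAt_imageSol_outer hF hτ ht.1 ht.2).gradient, Complex.inner, ← map_mul,
        Complex.conj_re, mul_comm]
    · have h1 := ((h.continuousAt_innerPotD hF hτ hxe).tendsto.comp (TwoCircles.tendsto_sub_smul x ν)).mul_const ν
      refine ((Complex.continuous_re.tendsto _).comp h1).congr' ?_
      filter_upwards [h.eventually_inner hx hν] with t hin
      simp only [Function.comp_apply]
      rw [(h.hasGradientAt_imageSol_inner hF hτ hin).gradient, Complex.inner, ← map_mul,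
        Complex.conj_re, mul_comm]
    · rw [h.re_outerPotD_mul hτ hx hν]
      congr 1
      rw [one_sub_tau hk, tau]
      field_simp
      ring
  · intro x hx
    rw [xZero]
    exact h.imageSol_boundary hF hτ hx

/-! ### Maximum principle and uniqueness -/

/-- The weak maximum principle for harmonic functions on a bounded open set. -/
theorem le_of_harmonicOnNhd {U : Set ℂ} (hU : IsOpen U) (hb : Bornology.IsBounded U) {w : ℂ → ℝ}
    (hc : ContinuousOn w (closure U)) (hh : InnerProductSpace.HarmonicOnNhd w U) {M : ℝ}
    (hfr : ∀ z ∈ frontier U, w z ≤ M) {z : ℂ} (hz : z ∈ closure U) : w z ≤ M := by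
  have hK : IsCompact (closure U) := hb.isCompact_closure
  obtain ⟨z₀, hz₀, hmax⟩ := hK.exists_isMaxOn ⟨z, hz⟩ hc
  refine (hmax hz).trans ?_
  by_contra! hlt
  set S : Set ℂ := closure U ∩ w ⁻¹' {w z₀} with hS
  have hSK : IsCompact S := hK.of_isClosed_subset
    (hc.preimage_isClosed_of_isClosed isClosed_closure isClosed_singleton) inter_subset_left
  -- Take the maximum point with the largest real part. If it were interior, `w` would be locally
  -- `Re F`, the modulus of `e^F` would be constant near it, and a point further right would also be
  -- a maximum.
  obtain ⟨z₁, hz₁, hre⟩ := hSK.exists_isMaxOn ⟨z₀, hz₀, rfl⟩ Complex.continuous_re.continuousOn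
  have hz₁' : w z₁ = w z₀ := hz₁.2
  have hz₁U : z₁ ∈ U := by
    by_contra hn
    have : z₁ ∈ frontier U := by rw [hU.frontier_eq]; exact ⟨hz₁.1, hn⟩
    linarith [hfr z₁ this]
  obtain ⟨R, hR, hball⟩ := Metric.isOpen_iff.1 hU z₁ hz₁U
  obtain ⟨F, hFa, hFe⟩ := (hh.mono hball).exists_analyticOnNhd_ball_re_eq
  have hd : DifferentiableOn ℂ (fun z => Complex.exp (F z)) (ball z₁ R) := fun y hy =>
    ((hFa y hy).differentiableAt.cexp).differentiableWithinAt
  have hmaxF : IsMaxOn (norm ∘ fun z => Complex.exp (F z)) (ball z₁ R) z₁ := fun y hy => by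
    simp only [Function.comp, Complex.norm_exp, mem_ofPred_eq, Real.exp_le_exp]
    have e1 := hFe hy
    have e2 := hFe (mem_ball_self hR)
    simp only at e1 e2
    rw [e1, e2, hz₁']
    exact hmax (subset_closure (hball hy))
  set z₂ : ℂ := z₁ + ((R / 2 : ℝ) : ℂ)
  have hz₂ : z₂ ∈ ball z₁ R := by
    rw [mem_ball_iff_norm, add_sub_cancel_left, Complex.norm_real, Real.norm_of_nonneg (by positivity)]
    linarith
  have hn := Complex.norm_eqOn_of_isPreconnected_of_isMaxOn (convex_ball z₁ R).isPreconnected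
    isOpen_ball hd (mem_ball_self hR) hmaxF hz₂
  simp only [Function.comp, Function.const, Complex.norm_exp, Real.exp_eq_exp] at hn
  have e1 := hFe hz₂
  have e2 := hFe (mem_ball_self hR)
  simp only at e1 e2
  rw [e1, e2, hz₁'] at hn
  have h3 := hre (show z₂ ∈ S from ⟨subset_closure (hball hz₂), hn⟩)
  simp only [mem_ofPred_eq, z₂, Complex.add_re, Complex.ofReal_re] at h3
  linarith

/-- At a one-sided maximum the limit of the derivative is nonpositive. -/
lemma deriv_limit_nonpos {φ φ' : ℝ → ℝ} {L : ℝ} (hc : ContinuousWithinAt φ (Ici 0) 0)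
    (hd : ∀ᶠ t in 𝓝[>] (0 : ℝ), HasDerivAt φ (φ' t) t) (hL : Tendsto φ' (𝓝[>] 0) (𝓝 L))
    (hmax : ∀ᶠ t in 𝓝[>] (0 : ℝ), φ t ≤ φ 0) : L ≤ 0 := by
  obtain ⟨a, ha, hsub⟩ := (mem_nhdsGT_iff_exists_Ioo_subset).1 hd
  have h1 : HasDerivWithinAt φ L (Ici 0) 0 := by
    refine hasDerivWithinAt_Ici_of_tendsto_deriv (s := Ioo 0 a)
      (fun t ht => (hsub ht).differentiableAt.differentiableWithinAt)
      (hc.mono fun t ht => ht.1.le) (Ioo_mem_nhdsGT ha) ?_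
    exact hL.congr' (hd.mono fun t ht => ht.deriv.symm)
  have h2 := (hasDerivWithinAt_iff_tendsto_slope' (by simp)).1 (h1.mono Ioi_subset_Ici_self)
  refine le_of_tendsto h2 ?_
  filter_upwards [hmax, self_mem_nhdsWithin] with t ht ht0
  have ht0' : (0 : ℝ) < t := ht0
  rw [slope_def_field, sub_zero]
  exact div_nonpos_of_nonpos_of_nonneg (by linarith) ht0'.le

lemma hasFDerivAt_log_norm {u : ℂ → ℂ} {u' z : ℂ} (hu : HasDerivAt u u' z) (hne : u z ≠ 0) :
    HasFDerivAt (fun w => Real.log ‖u w‖)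
      ((Complex.reCLM.comp ((ContinuousLinearMap.toSpanSingleton ℂ (u' / u z)).restrictScalars ℝ)))
      z := by
  have e2 : (fun w => Real.log ‖u w‖) = fun w => (1 / 2) * Real.log (‖u w‖ ^ 2) := by
    ext w; rw [Real.log_pow]; push_cast; ring
  rw [e2]
  have hn : ‖u z‖ ^ 2 ≠ 0 := by positivity
  have h1 := ((hu.hasFDerivAt.restrictScalars ℝ).norm_sq.log hn).const_mul (1 / 2 : ℝ)
  refine h1.congr_fderiv ?_
  ext v
  have hns : Complex.normSq (u z) ≠ 0 := by simpa using hne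
  simp [Complex.inner, Complex.div_re, Complex.div_im, ← Complex.normSq_eq_norm_sq]
  field_simp
  ring

lemma hasGradientAt_xiCoord {α : ℝ} {z : ℂ} (hP : (α + z : ℂ) ≠ 0) (hQ : (α - z : ℂ) ≠ 0) :
    HasGradientAt (xiCoord α) ((starRingEnd ℂ) (2 * α / (α ^ 2 - z ^ 2))) z := by
  have e : xiCoord α =ᶠ[𝓝 z] fun w => (Real.log ‖(α + w : ℂ)‖ - Real.log ‖(α - w : ℂ)‖) := by
    filter_upwards [(by fun_prop : ContinuousAt (fun w : ℂ => (α + w : ℂ)) z).eventually_ne hP,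
      (by fun_prop : ContinuousAt (fun w : ℂ => (α - w : ℂ)) z).eventually_ne hQ] with w h1 h2
    rw [xiCoord, norm_div, Real.log_div (norm_ne_zero_iff.2 h1) (norm_ne_zero_iff.2 h2)]
  rw [hasGradientAt_iff_hasFDerivAt]
  have h1 := (hasFDerivAt_log_norm ((hasDerivAt_id z).const_add (α : ℂ)) hP).sub
    (hasFDerivAt_log_norm ((hasDerivAt_id z).const_sub (α : ℂ)) hQ)
  refine (h1.congr_of_eventuallyEq e).congr_fderiv ?_
  ext v
  have e3 : (2 * α / (α ^ 2 - z ^ 2) : ℂ) = 1 / (α + z) - (-1) / (α - z) := by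
    have : (α ^ 2 - z ^ 2 : ℂ) ≠ 0 := by
      rw [show (α ^ 2 - z ^ 2 : ℂ) = (α + z) * (α - z) by ring]; exact mul_ne_zero hP hQ
    field_simp
    ring
  rw [e3]
  simp [Complex.inner]

lemma IsDirichletSolution.differentiableAt {re ri ε k : ℝ} {g v : ℂ → ℝ}
    (hv : IsDirichletSolution re ri ε k g v) {z : ℂ}
    (hz : z ∈ Incl re ri ε ∪ (Omega re ri ε \ closure (Incl re ri ε))) :
    DifferentiableAt ℝ v z :=
  (hv.harmonic z hz).1.differentiableAt (by norm_num)

/-- The difference of two solutions solves the homogeneous problem. -/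
lemma IsDirichletSolution.sub {re ri ε k : ℝ}
    (h : TwoCircles re ri (alpha re ri ε) (cI re ri ε) (cE re ri ε)) {g v₁ v₂ : ℂ → ℝ}
    (h₁ : IsDirichletSolution re ri ε k g v₁) (h₂ : IsDirichletSolution re ri ε k g v₂) :
    IsDirichletSolution re ri ε k 0 (v₁ - v₂) := by
  have hgrad : ∀ z ∈ Incl re ri ε ∪ (Omega re ri ε \ closure (Incl re ri ε)),
      gradient (v₁ - v₂) z = gradient v₁ z - gradient v₂ z := fun z hz => by
    rw [gradient, fderiv_sub (h₁.differentiableAt hz) (h₂.differentiableAt hz), map_sub]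
    rfl
  refine ⟨h₁.harmonic.sub h₂.harmonic, h₁.continuousOn.sub h₂.continuousOn, ?_, ?_⟩
  · intro x hx ν hν
    obtain ⟨p₁, m₁, hp₁, hm₁, e₁⟩ := h₁.transmission x hx ν hν
    obtain ⟨p₂, m₂, hp₂, hm₂, e₂⟩ := h₂.transmission x hx ν hν
    refine ⟨p₁ - p₂, m₁ - m₂, (hp₁.sub hp₂).congr' ?_, (hm₁.sub hm₂).congr' ?_, ?_⟩
    · filter_upwards [h.eventually_outer hx hν] with t ht
      rw [hgrad _ (Or.inr ⟨ht.1, by rw [closure_incl h.ri_pos]; exact ht.2⟩), inner_sub_right]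
    · filter_upwards [h.eventually_inner hx hν] with t ht
      rw [hgrad _ (Or.inl ht), inner_sub_right]
    · rw [e₁, e₂]; ring
  · intro x hx
    simp [h₁.boundary x hx, h₂.boundary x hx]

lemma hasDerivAt_line {v : ℂ → ℝ} {G x ν : ℂ} {t : ℝ} (hv : HasGradientAt v G (x + t • ν)) :
    HasDerivAt (fun t : ℝ => v (x + t • ν)) (inner ℝ ν G) t := by
  have h1 : HasDerivAt (fun t : ℝ => x + t • ν) ν t := by
    simpa using ((hasDerivAt_id t).smul_const ν).const_add x
  have h2 := (hasGradientAt_iff_hasFDerivAt.1 hv).comp_hasDerivAt t h1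
  rw [InnerProductSpace.toDual_apply_apply, real_inner_comm] at h2
  exact h2

lemma xiCoord_sphere {α c r : ℝ} (hα : 0 < α) (hr : 0 < r) (hc0 : 0 < c)
    (hc : α ^ 2 = c ^ 2 - r ^ 2) {z : ℂ} (hz : z ∈ sphere (c : ℂ) r) :
    xiCoord α z = 1 / 2 * Real.log ((c + α) / (c - α)) := by
  have hαc := lt_of_sq_eq hα hr hc0 hc
  have h0 := re_pos_of_mem_closedBall hα hr hc0 hc (sphere_subset_closedBall hz)
  have hP : 0 < ‖(α + z : ℂ)‖ := by
    rw [norm_pos_iff]; intro h1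
    have := congrArg Complex.re h1
    simp at this; linarith
  have h1 := apollonius_aux (z := z) hc
  rw [mem_sphere_iff_norm.1 hz, sub_self, mul_zero] at h1
  have hca := sub_pos.2 hαc
  have hQ : 0 < ‖(α - z : ℂ)‖ := by
    by_contra h2
    have h3 : ‖(α - z : ℂ)‖ = 0 := le_antisymm (not_lt.1 h2) (norm_nonneg _)
    rw [h3] at h1
    have : 0 < (c - α) * ‖(α + z : ℂ)‖ ^ 2 := by positivity
    simp at h1
    rcases h1 with h1 | h1
    · linarith
    · rw [h1] at hP; simp at hP
  have e : (c + α) / (c - α) = (‖(α + z : ℂ)‖ / ‖(α - z : ℂ)‖) ^ 2 := by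
    rw [div_pow, div_eq_div_iff hca.ne' (by positivity)]
    linarith
  rw [xiCoord, e, Real.log_pow, norm_div]
  push_cast; ring

lemma frontier_annulus_subset {c₁ c₂ : ℂ} {r₁ r₂ : ℝ} (h₁ : r₁ ≠ 0) (h₂ : r₂ ≠ 0) :
    frontier (ball c₂ r₂ \ closedBall c₁ r₁) ⊆ sphere c₂ r₂ ∪ sphere c₁ r₁ := by
  rw [sdiff_eq]
  refine (frontier_inter_subset _ _).trans (union_subset_union ?_ ?_)
  · rw [frontier_ball _ h₂]; exact inter_subset_left
  · rw [frontier_compl, frontier_closedBall _ h₁]; exact inter_subset_right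

/-- Let `M` be the maximum of `w` on `∂D`, attained at `x`; then `w ≤ M` in `D`. If `M ≤ 0`, the
maximum principle in the annulus concludes. If `M > 0`, the normal derivative at `x` from inside is
nonnegative. From outside `w` lies below `M (ξ - ξₑ) / (ξᵢ - ξₑ)`, which touches it at `x` and
strictly decreases along `ν`, so the outer normal derivative is negative. This contradicts `p = k
m`. The explicit barrier plays the role of the Hopf lemma. -/
lemma IsDirichletSolution.nonpos {re ri ε k : ℝ} (hk : 0 < k)
    (h : TwoCircles re ri (alpha re ri ε) (cI re ri ε) (cE re ri ε)) {w : ℂ → ℝ}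
    (hw : IsDirichletSolution re ri ε k 0 w) {z : ℂ} (hz : z ∈ closure (Omega re ri ε)) :
    w z ≤ 0 := by
  have hharm := hw.harmonic
  have hcont := hw.continuousOn
  have hbdry := hw.boundary
  have htr := hw.transmission
  have hdiff := fun z hz => hw.differentiableAt (z := z) hz
  rw [closure_omega h.re_pos] at hcont hz
  simp only [Incl, Omega, closure_ball _ h.ri_pos.ne'] at hharm hdiff
  clear hw
  set α := alpha re ri ε
  set ci := cI re ri ε
  set ce := cE re ri ε
  have hri := h.ri_pos
  have hα := h.alpha_pos
  have hsub := h.closedBall_subset.trans ball_subset_closedBall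
  obtain ⟨x, hx, hmax⟩ := (isCompact_sphere (ci : ℂ) ri).exists_isMaxOn
    (NormedSpace.sphere_nonempty.2 hri.le) (hcont.mono (sphere_subset_closedBall.trans hsub))
  set M := w x with hM
  have hD : ∀ z ∈ closedBall (ci : ℂ) ri, w z ≤ M := fun z hz => by
    refine le_of_harmonicOnNhd isOpen_ball isBounded_ball
      (by rw [closure_ball _ hri.ne']; exact hcont.mono hsub)
      (hharm.mono subset_union_left) (fun y hy => ?_) (z := z) (by rwa [closure_ball _ hri.ne'])
    rw [frontier_ball _ hri.ne'] at hy
    exact hmax hy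
  have hUo : IsOpen (ball (ce : ℂ) re \ closedBall (ci : ℂ) ri) :=
    isOpen_ball.sdiff isClosed_closedBall
  have hUb : Bornology.IsBounded (ball (ce : ℂ) re \ closedBall (ci : ℂ) ri) :=
    isBounded_ball.subset sdiff_subset
  have hUc : closure (ball (ce : ℂ) re \ closedBall (ci : ℂ) ri)
      ⊆ closedBall (ce : ℂ) re \ ball (ci : ℂ) ri :=
    closure_minimal (fun y hy => ⟨ball_subset_closedBall hy.1,
      fun h1 => hy.2 (ball_subset_closedBall h1)⟩) (isClosed_closedBall.sdiff isOpen_ball)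
  have hfr := frontier_annulus_subset (c₁ := (ci : ℂ)) (c₂ := (ce : ℂ)) hri.ne' h.re_pos.ne'
  have hzU : ∀ y ∈ closedBall (ce : ℂ) re, y ∉ closedBall (ci : ℂ) ri →
      y ∈ closure (ball (ce : ℂ) re \ closedBall (ci : ℂ) ri) := fun y hy hyD => by
    rw [← closure_ball _ h.re_pos.ne'] at hy
    rw [mem_closure_iff_nhds] at hy ⊢
    intro t ht
    obtain ⟨u, hu⟩ := hy _ (inter_mem ht (isClosed_closedBall.isOpen_compl.mem_nhds hyD))
    exact ⟨u, hu.1.1, hu.2, hu.1.2⟩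
  rcases le_or_gt M 0 with hM0 | hM0
  · by_cases hzD : z ∈ closedBall (ci : ℂ) ri
    · exact (hD z hzD).trans hM0
    · refine le_of_harmonicOnNhd hUo hUb (hcont.mono (hUc.trans sdiff_subset))
        (hharm.mono subset_union_right) (fun y hy => ?_) (hzU z hz hzD)
      rcases hfr hy with h1 | h1
      · rw [hbdry y h1]; rfl
      · exact (hmax h1).trans hM0
  · exfalso
    obtain ⟨ν, hν⟩ : ∃ ν : ℂ, ν = ri⁻¹ • (x - (ci : ℂ)) := ⟨_, rfl⟩
    obtain ⟨p, m, hp, hm, hpm⟩ := htr x hx ν hν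
    have hxν := TwoCircles.eq_add_smul hri hν
    have hnν := TwoCircles.norm_normal hri hx hν
    have hxe := h.closedBall_subset (sphere_subset_closedBall hx)
    have hcx : ContinuousAt w x :=
      (hcont x (ball_subset_closedBall hxe)).continuousAt (closedBall_mem_nhds_of_mem hxe)
    have hm0 : 0 ≤ m := by
      have hnm : Tendsto (fun t : ℝ => -inner ℝ ν (gradient w (x - t • ν))) (𝓝[>] 0) (𝓝 (-m)) :=
        hm.neg
      have := deriv_limit_nonpos (φ := fun t : ℝ => w (x + t • (-ν))) ?_ ?_ hnm ?_
      · linarith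
      · refine ContinuousAt.continuousWithinAt (ContinuousAt.comp ?_ (by fun_prop))
        simpa using hcx
      · filter_upwards [h.eventually_inner hx hν] with t ht
        rw [sub_eq_add_neg, ← smul_neg] at ht ⊢
        have := hasDerivAt_line (hdiff _ (Or.inl ht)).hasGradientAt
        rwa [inner_neg_left] at this
      · filter_upwards [h.eventually_inner hx hν] with t ht
        rw [sub_eq_add_neg, ← smul_neg] at ht
        simpa using hD _ (ball_subset_closedBall ht)
    set Xi := 1 / 2 * Real.log ((ci + α) / (ci - α)) with hXi
    set Xe := 1 / 2 * Real.log ((ce + α) / (ce - α)) with hXe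
    have hX : 0 < Xi - Xe := by
      have h1 := sub_pos.2 h.alpha_lt_ci
      have h2 := sub_pos.2 h.alpha_lt_ce
      have h3 := h.ci_pos; have h4 := h.ce_pos
      have : Real.log ((ce + α) / (ce - α)) < Real.log ((ci + α) / (ci - α)) := by
        refine Real.log_lt_log (by positivity) ?_
        rw [div_lt_div_iff₀ h2 h1]
        nlinarith [h.ci_lt]
      simp only [hXi, hXe]; linarith
    have hPQ : ∀ y ∈ closedBall (ce : ℂ) re, y ∉ ball (ci : ℂ) ri →
        (α + y : ℂ) ≠ 0 ∧ (α - y : ℂ) ≠ 0 := fun y hy hyD => by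
      refine ⟨fun h1 => ?_, h.sub_ne_zero_of_notMem hyD⟩
      have := congrArg Complex.re h1
      have h2 := h.re_pos_of_mem hy
      simp at this; linarith
    set c := M / (Xi - Xe) with hc
    have hc0 : 0 < c := by positivity
    have hb : ∀ y ∈ closure (ball (ce : ℂ) re \ closedBall (ci : ℂ) ri),
        w y - c * (xiCoord α y - Xe) ≤ 0 := fun y hy => by
      refine le_of_harmonicOnNhd (w := fun y => w y - c * (xiCoord α y - Xe)) hUo hUb ?_ ?_ ?_ hy
      · refine (hcont.mono (hUc.trans sdiff_subset)).sub (continuousOn_const.mul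
          (ContinuousOn.sub (fun y hy => ?_) continuousOn_const))
        obtain ⟨h1, h2⟩ := hPQ y (hUc hy).1 (hUc hy).2
        exact (hasGradientAt_xiCoord h1 h2).continuousAt.continuousWithinAt
      · intro y hy
        obtain ⟨h1, h2⟩ := hPQ y (ball_subset_closedBall hy.1)
          (fun h1 => hy.2 (ball_subset_closedBall h1))
        have han : AnalyticAt ℂ (fun z : ℂ => ((α : ℂ) + z) / ((α : ℂ) - z)) y :=
          (analyticAt_const.add analyticAt_id).div (analyticAt_const.sub analyticAt_id) h2
        have h3 : InnerProductSpace.HarmonicAt (xiCoord α) y :=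
          han.harmonicAt_log_norm (div_ne_zero h1 h2)
        exact (hharm y (Or.inr hy)).sub
          ((h3.sub (InnerProductSpace.harmonicAt_const Xe)).const_smul (c := c))
      · intro y hy
        rcases hfr hy with h1 | h1
        · rw [hbdry y h1, xiCoord_sphere hα h.re_pos h.ce_pos h.sq_e h1]
          simp [hXe]
        · rw [xiCoord_sphere hα hri h.ci_pos h.sq_i h1, ← hXi, hc, div_mul_cancel₀ _ hX.ne']
          have : w y ≤ M := hmax h1
          linarith
    have hxP := hPQ x (ball_subset_closedBall hxe) (TwoCircles.notMem_ball_of_sphere hx)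
    have hx0 := h.re_pos_of_mem (ball_subset_closedBall hxe)
    -- On `∂D` the relation `α² = cᵢ² - rᵢ²` gives `α² - x² = -2 rᵢ (Re x) ν`; so `∇ξ` is normal and
    -- points into `D`.
    have hgx : (2 * α / (α ^ 2 - x ^ 2) * ν : ℂ) = ((-(α / (ri * x.re)) : ℝ) : ℂ) := by
      have hn : ν * (starRingEnd ℂ) ν = 1 := by rw [Complex.mul_conj', hnν]; simp
      have hν0 : ν ≠ 0 := fun h0 => by rw [h0] at hn; simp at hn
      have hxre : (x.re : ℂ) = ci + ri * ((ν + (starRingEnd ℂ) ν) / 2) := by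
        rw [← Complex.re_eq_add_conj, hxν]; simp
      have hsq : (α : ℂ) ^ 2 = ci ^ 2 - ri ^ 2 := by exact_mod_cast h.sq_i
      have e : (α ^ 2 - x ^ 2 : ℂ) = -(2 * ri * x.re * ν) := by
        rw [hxre, hxν]
        linear_combination hsq + ri ^ 2 * hn
      have h1 : (ri : ℂ) ≠ 0 := by exact_mod_cast hri.ne'
      have h2 : (x.re : ℂ) ≠ 0 := by exact_mod_cast hx0.ne'
      rw [e]; push_cast
      field_simp
    have hlim2 : Tendsto (fun t : ℝ => inner ℝ ν
        ((starRingEnd ℂ) (2 * α / (α ^ 2 - (x + t • ν) ^ 2) : ℂ))) (𝓝[>] 0)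
        (𝓝 (-(α / (ri * x.re)))) := by
      have h1 : ContinuousAt (fun y : ℂ => inner ℝ ν
          ((starRingEnd ℂ) (2 * α / (α ^ 2 - y ^ 2) : ℂ))) x := by
        refine ContinuousAt.inner continuousAt_const
          (Complex.continuous_conj.continuousAt.comp
            (ContinuousAt.div (by fun_prop) (by fun_prop) ?_))
        rw [show (α ^ 2 - x ^ 2 : ℂ) = (α + x) * (α - x) by ring]
        exact mul_ne_zero hxP.1 hxP.2
      have h2 := h1.tendsto.comp (TwoCircles.tendsto_add_smul x ν)
      have e : inner ℝ ν ((starRingEnd ℂ) (2 * α / (α ^ 2 - x ^ 2) : ℂ)) = -(α / (ri * x.re)) := by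
        rw [Complex.inner, ← map_mul, Complex.conj_re, hgx, Complex.ofReal_re]
      rw [e] at h2
      exact h2
    have hp0 : p - c * -(α / (ri * x.re)) ≤ 0 := by
      refine deriv_limit_nonpos
        (φ := fun t : ℝ => w (x + t • ν) - c * (xiCoord α (x + t • ν) - Xe)) ?_ ?_
        (hp.sub (hlim2.const_mul c)) ?_
      · have h1 : ContinuousAt (fun y => w y - c * (xiCoord α y - Xe)) x :=
          hcx.sub (continuousAt_const.mul
            ((hasGradientAt_xiCoord hxP.1 hxP.2).continuousAt.sub continuousAt_const))
        refine ContinuousAt.continuousWithinAt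
          (ContinuousAt.comp (g := fun y => w y - c * (xiCoord α y - Xe)) ?_ (by fun_prop))
        simpa using h1
      · filter_upwards [h.eventually_outer hx hν] with t ht
        have h1 := hPQ _ (ball_subset_closedBall ht.1) (fun h1 => ht.2 (ball_subset_closedBall h1))
        have d1 := hasDerivAt_line (hdiff _ (Or.inr ht)).hasGradientAt
        have d2 := hasDerivAt_line (hasGradientAt_xiCoord h1.1 h1.2)
        exact d1.sub ((d2.sub_const Xe).const_mul c)
      · filter_upwards [h.eventually_outer hx hν] with t ht
        refine (hb _ (subset_closure ht)).trans (le_of_eq ?_)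
        rw [zero_smul, add_zero, xiCoord_sphere hα hri h.ci_pos h.sq_i hx, ← hXi, hc,
          div_mul_cancel₀ _ hX.ne', ← hM, sub_self]
    have h1 : 0 < c * (α / (ri * x.re)) := by positivity
    have h2 : 0 ≤ p := by rw [hpm]; positivity
    linarith

/-- The solution of the transmission problem is unique. -/
theorem IsDirichletSolution.eqOn {re ri ε k : ℝ} (hk : 0 < k)
    (h : TwoCircles re ri (alpha re ri ε) (cI re ri ε) (cE re ri ε)) {g v₁ v₂ : ℂ → ℝ}
    (h₁ : IsDirichletSolution re ri ε k g v₁) (h₂ : IsDirichletSolution re ri ε k g v₂) :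
    EqOn v₁ v₂ (closure (Omega re ri ε)) := fun z hz => by
  have h3 := (h₁.sub h h₂).nonpos hk h hz
  have h4 := (h₂.sub h h₁).nonpos hk h hz
  simp only [Pi.sub_apply] at h3 h4
  linarith

/-! ### The geometry of the two disks and the gradient bounds -/

section Geometry

variable {re ri ε : ℝ}

lemma cE_sub_cI : cE re ri ε - cI re ri ε = re - ri - ε := by rw [cE]; ring

lemma alpha_sq (hri : 0 < ri) (hε : 0 < ε) (hε' : ε < re - ri) :
    alpha re ri ε ^ 2 = ε * (2 * ri + ε) * (2 * re - ε) * (2 * re - 2 * ri - ε)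
      / (4 * (re - ri - ε) ^ 2) := by
  have h1 : 0 < 2 * re - ε := by linarith
  have h2 : 0 < 2 * re - 2 * ri - ε := by linarith
  rw [alpha, div_pow, Real.sq_sqrt (by positivity)]
  ring

lemma twoCircles (hri : 0 < ri) (hre : ri < re) (hε : 0 < ε) (hε' : ε < re - ri) :
    TwoCircles re ri (alpha re ri ε) (cI re ri ε) (cE re ri ε) := by
  have h1 : 0 < 2 * re - ε := by linarith
  have h2 : 0 < 2 * re - 2 * ri - ε := by linarith
  have h3 : 0 < re - ri - ε := by linarith
  have hi : alpha re ri ε ^ 2 = cI re ri ε ^ 2 - ri ^ 2 := by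
    rw [alpha_sq hri hε hε', cI]
    field_simp
    ring
  refine ⟨hri, hri.trans hre, ?_, ?_, ?_, hi, ?_⟩
  · rw [alpha]; positivity
  · rw [cI]; apply div_pos _ (by positivity); nlinarith
  · linarith [cE_sub_cI (re := re) (ri := ri) (ε := ε)]
  · rw [hi, cE, cI]
    field_simp
    ring

lemma TwoCircles.one_div_one_sub_kap_le {α ci ce : ℝ} (h : TwoCircles re ri α ci ce) :
    1 / (1 - kap α ci ce) ≤ re ^ 2 / (2 * α * (ce - ci)) := by
  have hα := h.alpha_pos
  have hd := sub_pos.2 h.ci_lt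
  have h1 := sub_pos.2 h.alpha_lt_ce
  have h2 := h.ci_pos
  rw [h.one_sub_kap, one_div_div]
  gcongr
  have e : re ^ 2 = (ce - α) * (ce + α) := by linear_combination h.sq_e
  rw [e]
  gcongr
  exact h.ci_lt.le

/-- The product is half the square root in the definition of `alpha`. It stays away from `0` even as
`ε → re - ri`, where `ce - ci` vanishes and `alpha` blows up. -/
lemma le_alpha_mul (hri : 0 < ri) {ε₀ : ℝ} (hε₀ : 0 < ε₀) (hε : ε₀ ≤ ε)
    (hε' : ε < re - ri) :
    √(ε₀ * (2 * ri) * re * (re - ri)) / 2 ≤ alpha re ri ε * (cE re ri ε - cI re ri ε) := by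
  have h3 : 0 < re - ri - ε := by linarith
  have e : alpha re ri ε * (cE re ri ε - cI re ri ε)
      = √(ε * (2 * ri + ε) * (2 * re - ε) * (2 * re - 2 * ri - ε)) / 2 := by
    rw [cE_sub_cI, alpha]; field_simp
  rw [e]
  have : 0 < re - ri := by linarith
  have : 0 < re := by linarith
  have : 0 < 2 * re - ε := by linarith
  have : 0 < ε := by linarith
  obtain ⟨A, hA⟩ : ∃ A, A = re - ri := ⟨_, rfl⟩
  rw [← hA]
  have : 0 < A := by linarith
  gcongr <;> linarith

lemma one_div_one_sub_kap_bound (hri : 0 < ri) (hre : ri < re) {ε₀ : ℝ} (hε₀ : 0 < ε₀)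
    (hε : ε₀ ≤ ε) (hε' : ε < re - ri) :
    1 / (1 - kap (alpha re ri ε) (cI re ri ε) (cE re ri ε))
      ≤ re ^ 2 / √(ε₀ * (2 * ri) * re * (re - ri)) := by
  have h := twoCircles hri hre (hε₀.trans_le hε) hε'
  refine h.one_div_one_sub_kap_le.trans ?_
  have h1 := le_alpha_mul hri hε₀ hε hε'
  have : 0 < re - ri := by linarith
  have : 0 < re := by linarith
  have h2 : 0 < √(ε₀ * (2 * ri) * re * (re - ri)) := by positivity
  gcongr
  linarith

end Geometry

/-! ### Gradient bounds for an arbitrary solution -/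

section Gradient

variable {re ri ε k : ℝ} {g v : ℂ → ℝ} {F f : ℂ → ℂ} {M : ℝ}

/-- By uniqueness an arbitrary solution inherits the derivative of the image series. -/
lemma hasGradientAt_inner (h : TwoCircles re ri (alpha re ri ε) (cI re ri ε) (cE re ri ε))
    (hF : IsHolomorphicExtension re g F f M) (hk : 0 < k)
    (hv : IsDirichletSolution re ri ε k g v) {z : ℂ} (hz : z ∈ Incl re ri ε) :
    HasGradientAt v ((starRingEnd ℂ) (innerPotD (alpha re ri ε)
      (kap (alpha re ri ε) (cI re ri ε) (cE re ri ε)) (tau k) (cE re ri ε - re) f z)) z := by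
  refine (h.hasGradientAt_imageSol_inner hF (abs_tau_lt_one hk) hz).congr_of_eventuallyEq ?_
  filter_upwards [isOpen_ball.mem_nhds hz] with w hw
  refine hv.eqOn hk h (isDirichletSolution_imageSol h hF hk) ?_
  rw [closure_omega h.re_pos]
  exact ball_subset_closedBall (h.closedBall_subset (ball_subset_closedBall hw))

lemma hasGradientAt_outer (h : TwoCircles re ri (alpha re ri ε) (cI re ri ε) (cE re ri ε))
    (hF : IsHolomorphicExtension re g F f M) (hk : 0 < k)
    (hv : IsDirichletSolution re ri ε k g v) {z : ℂ}
    (hz : z ∈ Omega re ri ε \ closure (Incl re ri ε)) :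
    HasGradientAt v ((starRingEnd ℂ) (outerPotD (alpha re ri ε)
      (kap (alpha re ri ε) (cI re ri ε) (cE re ri ε)) (tau k) (cE re ri ε - re)
      (cI re ri ε) ri f z)) z := by
  have hz' := hz
  rw [closure_incl h.ri_pos] at hz'
  refine (h.hasGradientAt_imageSol_outer hF (abs_tau_lt_one hk) hz'.1
    hz'.2).congr_of_eventuallyEq ?_
  filter_upwards [isOpen_ball.mem_nhds hz.1] with w hw
  exact hv.eqOn hk h (isDirichletSolution_imageSol h hF hk) (subset_closure hw)

lemma norm_gradient_inner_le (h : TwoCircles re ri (alpha re ri ε) (cI re ri ε) (cE re ri ε))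
    (hF : IsHolomorphicExtension re g F f M) (hk : 0 < k)
    (hv : IsDirichletSolution re ri ε k g v) {z : ℂ} (hz : z ∈ Incl re ri ε) :
    ‖gradient v z‖ ≤ M * (6 + 4 * re) := by
  rw [(hasGradientAt_inner h hF hk hv hz).gradient, RCLike.norm_conj]
  exact h.norm_innerPotD_le hF (abs_tau_lt_one hk)
    (ball_subset_closedBall (h.closedBall_subset (ball_subset_closedBall hz)))

lemma norm_gradient_outer_le (h : TwoCircles re ri (alpha re ri ε) (cI re ri ε) (cE re ri ε))
    (hF : IsHolomorphicExtension re g F f M) (hk : 0 < k)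
    (hv : IsDirichletSolution re ri ε k g v) {z : ℂ}
    (hz : z ∈ Omega re ri ε \ closure (Incl re ri ε)) :
    ‖gradient v z‖ ≤ M * (6 + 4 * re) * (k + 1) ∧
    ‖gradient v z‖ ≤ 8 * M * (1 / (1 - kap (alpha re ri ε) (cI re ri ε) (cE re ri ε))) := by
  have hτ := abs_tau_lt_one hk
  have hz' := hz
  rw [closure_incl h.ri_pos] at hz'
  have hzD : z ∉ ball (cI re ri ε : ℂ) ri := fun h1 => hz'.2 (ball_subset_closedBall h1)
  rw [(hasGradientAt_outer h hF hk hv hz).gradient, RCLike.norm_conj]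
  constructor
  · refine (h.norm_outerPotD_le hτ
      (fun w hw => h.norm_innerPotD_le hF hτ (ball_subset_closedBall hw)) hz'.1 hzD).trans
      (le_of_eq ?_)
    rw [one_sub_tau hk]
    field_simp
  · refine (h.norm_outerPotD_le hτ
      (fun w hw => h.norm_innerPotD_le' hF hτ (ball_subset_closedBall hw)) hz'.1 hzD).trans
      (le_of_eq ?_)
    have : 1 - tau k ≠ 0 := by have := (abs_lt.1 hτ).2; linarith
    field_simp
    ring

end Gradient

/-- The gradient of `Hd` at the boundary point `0`. -/
lemma tendsto_fderiv_Hd {re : ℝ} (hre : 0 < re) {g : ℂ → ℝ} {F f : ℂ → ℂ} {M : ℝ}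
    (hF : IsHolomorphicExtension re g F f M) (e : ℂ) :
    Tendsto (fun x : ℂ => fderiv ℝ (Hd re g) x e) (𝓝[ball (re : ℂ) re] 0) (𝓝 (f 0 * e).re) := by
  have h0 : (0 : ℂ) ∈ closedBall (re : ℂ) re := by
    simp [abs_of_pos hre]
  have hc : ContinuousWithinAt f (ball (re : ℂ) re) 0 := by
    have : LipschitzOnWith M.toNNReal f (closedBall (re : ℂ) re) := by
      refine LipschitzOnWith.of_dist_le_mul fun z hz w hw => ?_
      rw [dist_eq_norm, dist_eq_norm, Real.coe_toNNReal _ (hF.M_nonneg hre)]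
      exact hF.lipschitz z hz w hw
    exact (this.continuousOn 0 h0).mono ball_subset_closedBall
  have h1 : Tendsto (fun x => (f x * e).re) (𝓝[ball (re : ℂ) re] 0) (𝓝 (f 0 * e).re) :=
    (Complex.continuous_re.tendsto _).comp (hc.tendsto.mul_const e)
  refine h1.congr' ?_
  filter_upwards [self_mem_nhdsWithin] with x hx
  have h2 : HasGradientAt (Hd re g) ((starRingEnd ℂ) (f x)) x :=
    gradient_re_of_eventuallyEq (hF.hasDerivAt x hx) (by
      filter_upwards [isOpen_ball.mem_nhds hx] with w hw
      exact hF.Hd_eq w hw)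
  rw [(hasGradientAt_iff_hasFDerivAt.1 h2).fderiv, InnerProductSpace.toDual_apply_apply,
    Complex.inner, Complex.conj_conj, mul_comm]

/-! ### Sums over images and integrals over the flow -/

/-- The kernel of the integral of `flowD` along the flow: `flowD α (s * y) z = y * flowK α s z y`. -/
def flowK (α s : ℝ) (z : ℂ) (y : ℝ) : ℂ := 4 * s * α ^ 2 / ((α + z) + (s * y : ℝ) * (α - z)) ^ 2

/-- The continuous superposition of image charges. -/
def flowInt (α s b : ℝ) (z : ℂ) : ℂ := ∫ y in (0 : ℝ)..1, ((y ^ b : ℝ) : ℂ) * flowK α s z y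

/-- The discrete superposition of image charges. -/
def flowSum (α κ τ s : ℝ) (z : ℂ) : ℂ := ∑' n : ℕ, (τ : ℂ) ^ n * flowD α (κ ^ n * s) z

section

variable {α κ τ s : ℝ} {z : ℂ} (hα : 0 < α) (hz : 0 ≤ z.re)

lemma flowD_mul (y : ℝ) : flowD α (s * y) z = y * flowK α s z y := by
  rw [flowD, flowK]; push_cast; ring

include hα hz

lemma continuousOn_flowK (hs0 : 0 ≤ s) (hs : s ≤ 1) : ContinuousOn (flowK α s z) (Icc 0 1) := by
  refine ContinuousOn.div continuousOn_const (by fun_prop) fun y hy => pow_ne_zero 2 ?_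
  exact flow_den_ne_zero hα hz (mul_nonneg hs0 hy.1) (mul_le_one₀ hs hy.1 hy.2)

lemma norm_flowK_le (hs0 : 0 ≤ s) (hs : s ≤ 1) {y : ℝ} (hy : y ∈ Icc (0 : ℝ) 1) :
    ‖flowK α s z y‖ ≤ 4 := by
  have h0 := mul_nonneg hs0 hy.1
  have h1 := le_norm_flow_den (α := α) hz (mul_le_one₀ hs hy.1 hy.2)
  have e : ‖(4 * s * α ^ 2 : ℂ)‖ = 4 * s * α ^ 2 := by
    simp [abs_of_nonneg hs0]
  rw [flowK, norm_div, norm_pow, e]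
  have h2 : α ≤ ‖((α + z) + (s * y : ℝ) * (α - z) : ℂ)‖ := le_trans (by nlinarith) h1
  rw [div_le_iff₀ (by have := hα.trans_le h2; positivity)]
  calc 4 * s * α ^ 2 ≤ 4 * 1 * α ^ 2 := by gcongr
    _ ≤ _ := by rw [mul_one]; gcongr

lemma continuousOn_flowInt_integrand (hs0 : 0 ≤ s) (hs : s ≤ 1) {b : ℝ} (hb : 0 < b) :
    ContinuousOn (fun y : ℝ => ((y ^ b : ℝ) : ℂ) * flowK α s z y) (Icc 0 1) :=
  ContinuousOn.mul (Complex.continuous_ofReal.comp_continuousOn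
    (Real.continuous_rpow_const hb.le).continuousOn) (continuousOn_flowK hα hz hs0 hs)

lemma intervalIntegrable_flowInt (hs0 : 0 ≤ s) (hs : s ≤ 1) {b : ℝ} (hb : 0 < b) {p q : ℝ}
    (hp : p ∈ Icc (0 : ℝ) 1) (hq : q ∈ Icc (0 : ℝ) 1) :
    IntervalIntegrable (fun y : ℝ => ((y ^ b : ℝ) : ℂ) * flowK α s z y) MeasureTheory.volume p q :=
  ((continuousOn_flowInt_integrand hα hz hs0 hs hb).mono
    (ordConnected_Icc.uIcc_subset hp hq)).intervalIntegrable

/-- The decay in `b` matters: it absorbs prefactors of the order of `b`, which are unbounded as `ε →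
0`. -/
lemma norm_flowInt_le (hs0 : 0 ≤ s) (hs : s ≤ 1) {b : ℝ} (hb : 0 < b) :
    ‖flowInt α s b z‖ ≤ 4 / (b + 1) := by
  have h1 : ‖flowInt α s b z‖ ≤ ∫ y in (0 : ℝ)..1, 4 * y ^ b := by
    refine intervalIntegral.norm_integral_le_of_norm_le zero_le_one
      (Eventually.of_forall fun y hy => ?_) ?_
    · rw [norm_mul, Complex.norm_real, Real.norm_of_nonneg (Real.rpow_nonneg hy.1.le _), mul_comm]
      have := norm_flowK_le hα hz hs0 hs (Ioc_subset_Icc_self hy)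
      have := Real.rpow_nonneg hy.1.le b
      gcongr
    · exact ((Real.continuous_rpow_const hb.le).const_mul 4).intervalIntegrable _ _
  rw [intervalIntegral.integral_const_mul, integral_rpow (Or.inl (by linarith)), Real.one_rpow,
    Real.zero_rpow (by linarith), sub_zero] at h1
  exact h1.trans (le_of_eq (by ring))

lemma norm_flowInt_sub_le (hs0 : 0 ≤ s) (hs : s ≤ 1) {b b' : ℝ} (hb : 0 < b) (hb' : 0 < b') :
    ‖flowInt α s b z - flowInt α s b' z‖ ≤ 4 * (|b - b'| / ((b + 1) * (b' + 1))) := by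
  wlog hbb : b ≤ b' generalizing b b'
  · rw [norm_sub_rev, abs_sub_comm, mul_comm (b + 1)]
    exact this hb' hb (le_of_not_ge hbb)
  have hI := intervalIntegrable_flowInt hα hz hs0 hs hb (p := 0) (q := 1) (by simp) (by simp)
  have hI' := intervalIntegrable_flowInt hα hz hs0 hs hb' (p := 0) (q := 1) (by simp) (by simp)
  have hr : ∀ b : ℝ, 0 < b → IntervalIntegrable (fun y : ℝ => y ^ b) MeasureTheory.volume 0 1 :=
    fun b hb => (Real.continuous_rpow_const hb.le).intervalIntegrable _ _
  have h1 : ‖flowInt α s b z - flowInt α s b' z‖ ≤ ∫ y in (0 : ℝ)..1, 4 * (y ^ b - y ^ b') := by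
    rw [flowInt, flowInt, ← intervalIntegral.integral_sub hI hI']
    refine intervalIntegral.norm_integral_le_of_norm_le zero_le_one
      (Eventually.of_forall fun y hy => ?_) (((hr b hb).sub (hr b' hb')).const_mul 4)
    have h2 : y ^ b' ≤ y ^ b := Real.rpow_le_rpow_of_exponent_ge hy.1 hy.2 hbb
    rw [← sub_mul, ← Complex.ofReal_sub, norm_mul, Complex.norm_real,
      Real.norm_of_nonneg (sub_nonneg.2 h2), mul_comm]
    have := norm_flowK_le hα hz hs0 hs (Ioc_subset_Icc_self hy)
    have := sub_nonneg.2 h2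
    gcongr
  rw [intervalIntegral.integral_const_mul, intervalIntegral.integral_sub (hr b hb) (hr b' hb'),
    integral_rpow (Or.inl (by linarith)), integral_rpow (Or.inl (by linarith)), Real.one_rpow,
    Real.one_rpow, Real.zero_rpow (by linarith), Real.zero_rpow (by linarith)] at h1
  refine h1.trans (le_of_eq ?_)
  rw [abs_sub_comm, abs_of_nonneg (sub_nonneg.2 hbb)]
  field_simp
  ring

variable (hκ0 : 0 < κ) (hκ : κ < 1) (hτ0 : 0 < τ) (hτ : τ < 1)

include hκ0 hκ

omit hα hz in
lemma pow_mul_mem (hs0 : 0 ≤ s) (hs : s ≤ 1) (n : ℕ) : 0 ≤ κ ^ n * s ∧ κ ^ n * s ≤ 1 :=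
  ⟨by positivity, mul_le_one₀ (pow_le_one₀ hκ0.le hκ.le) hs0 hs⟩

omit hα hz in
lemma pow_succ_mul_le (hs0 : 0 ≤ s) (n : ℕ) : κ ^ (n + 1) * s ≤ κ ^ n * s :=
  mul_le_mul_of_nonneg_right (pow_le_pow_of_le_one hκ0.le hκ.le (Nat.le_succ n)) hs0

omit hα hz in
lemma sum_varD_sub_le {q : ℝ} (hq : 0 ≤ q) (hs0 : 0 ≤ s) (hs : s ≤ 1) (N : ℕ) :
    ∑ n ∈ Finset.range N, (varD q (κ ^ (n + 1) * s) - varD q (κ ^ n * s)) ≤ 5 := by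
  rw [Finset.sum_range_sub (fun n => varD q (κ ^ n * s))]
  have h1 := varD_mem hq (pow_mul_mem hκ0 hκ hs0 hs N).1 (pow_mul_mem hκ0 hκ hs0 hs N).2
  have h2 := varD_mem hq (pow_mul_mem hκ0 hκ hs0 hs 0).1 (pow_mul_mem hκ0 hκ hs0 hs 0).2
  linarith

omit hα hz in
lemma sum_varD_shift_le {q : ℝ} (hq : 0 ≤ q) (m N : ℕ) :
    ∑ n ∈ Finset.range N, (varD q (κ ^ (n + m)) - varD q (κ ^ n)) ≤ 5 * m := by
  induction m with
  | zero => simp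
  | succ m ih =>
    have h1 := sum_varD_sub_le hκ0 hκ hq (s := κ ^ m) (by positivity) (pow_le_one₀ hκ0.le hκ.le) N
    calc ∑ n ∈ Finset.range N, (varD q (κ ^ (n + (m + 1))) - varD q (κ ^ n))
        = ∑ n ∈ Finset.range N, (varD q (κ ^ (n + 1) * κ ^ m) - varD q (κ ^ n * κ ^ m))
          + ∑ n ∈ Finset.range N, (varD q (κ ^ (n + m)) - varD q (κ ^ n)) := by
          rw [← Finset.sum_add_distrib]
          refine Finset.sum_congr rfl fun n _ => ?_
          rw [← pow_add, ← pow_add, show n + 1 + m = n + (m + 1) by ring]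
          ring
      _ ≤ 5 + 5 * m := add_le_add h1 ih
      _ = _ := by push_cast; ring

include hτ0 hτ

lemma summable_flowSum (hs0 : 0 ≤ s) (hs : s ≤ 1) :
    Summable fun n : ℕ => (τ : ℂ) ^ n * flowD α (κ ^ n * s) z :=
  summable_pow_mul_of_bounded (by rwa [abs_of_pos hτ0]) (B := 1) fun n =>
    norm_flowD_le_one hα hz (pow_mul_mem hκ0 hκ hs0 hs n).1 (pow_mul_mem hκ0 hκ hs0 hs n).2

lemma norm_one_sub_mul_flowSum_le (hs0 : 0 ≤ s) (hs : s ≤ 1) :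
    ‖(1 - τ : ℂ) * flowSum α κ τ s z‖ ≤ 1 := by
  have h1 : ‖flowSum α κ τ s z‖ ≤ (1 - τ)⁻¹ := by
    refine tsum_of_norm_bounded (hasSum_geometric_of_lt_one hτ0.le hτ) fun n => ?_
    rw [norm_mul, norm_pow, Complex.norm_real, Real.norm_of_nonneg hτ0.le]
    exact mul_le_of_le_one_right (by positivity) (norm_flowD_le_one hα hz
      (pow_mul_mem hκ0 hκ hs0 hs n).1 (pow_mul_mem hκ0 hκ hs0 hs n).2)
  have h2 : 0 < 1 - τ := by linarith
  rw [norm_mul, ← Complex.ofReal_one, ← Complex.ofReal_sub, Complex.norm_real,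
    Real.norm_of_nonneg h2.le]
  calc (1 - τ) * ‖flowSum α κ τ s z‖ ≤ (1 - τ) * (1 - τ)⁻¹ := by gcongr
    _ = 1 := mul_inv_cancel₀ h2.ne'

/-- The `n`-th parameters of both series lie in `[κ^(n+m), κ^n]`. Each of these intervals consists
of `m` consecutive steps, so the total variation is met `m` times. The starting parameter can
therefore be changed at a bounded cost as long as `m` is bounded. -/
lemma norm_flowSum_sub_le {s' : ℝ} {m : ℕ} (hs0 : κ ^ m ≤ s) (hs : s ≤ 1) (hs0' : κ ^ m ≤ s')
    (hs' : s' ≤ 1) : ‖flowSum α κ τ s z - flowSum α κ τ s' z‖ ≤ 5 * m := by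
  wlog hss : s ≤ s' generalizing s s'
  · rw [norm_sub_rev]
    exact this hs0' hs' hs0 hs (le_of_not_ge hss)
  have hκm : 0 < κ ^ m := by positivity
  have hsn : 0 ≤ s := hκm.le.trans hs0
  have hsn' : 0 ≤ s' := hsn.trans hss
  have hq : 0 ≤ ‖z‖ / α := by positivity
  set U : ℕ → ℝ := fun n => varD (‖z‖ / α) (κ ^ n)
  have hmono : ∀ n, U n ≤ U (n + m) := fun n =>
    varD_anti hq (by positivity) (pow_le_pow_of_le_one hκ0.le hκ.le (Nat.le_add_right n m))
      (pow_le_one₀ hκ0.le hκ.le)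
  have h0 : ∀ n, 0 ≤ U (n + m) - U n := fun n => sub_nonneg.2 (hmono n)
  have hsum := summable_of_sum_range_le h0 (sum_varD_shift_le hκ0 hκ hq m)
  have hle := Real.tsum_le_of_sum_range_le h0 (sum_varD_shift_le hκ0 hκ hq m)
  rw [flowSum, flowSum, ← Summable.tsum_sub
    (summable_flowSum hα hz hκ0 hκ hτ0 hτ hsn hs) (summable_flowSum hα hz hκ0 hκ hτ0 hτ hsn' hs')]
  refine (tsum_of_norm_bounded hsum.hasSum fun n => ?_).trans hle
  have hk : 0 < κ ^ n := by positivity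
  have hk1 : κ ^ n ≤ 1 := pow_le_one₀ hκ0.le hκ.le
  rw [← mul_sub, norm_mul, norm_pow, Complex.norm_real, Real.norm_of_nonneg hτ0.le]
  have h1 := norm_flowD_sub_le hα hz (y := κ ^ n * s) (y' := κ ^ n * s') (by positivity)
    (by gcongr) (pow_mul_mem hκ0 hκ hsn' hs' n).2
  have h2 : varD (‖z‖ / α) (κ ^ n * s) ≤ U (n + m) :=
    varD_anti hq (by positivity) (by rw [pow_add]; gcongr) (pow_mul_mem hκ0 hκ hsn hs n).2
  have h3 : U n ≤ varD (‖z‖ / α) (κ ^ n * s') :=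
    varD_anti hq (by positivity) (mul_le_of_le_one_right hk.le hs') hk1
  calc _ ≤ 1 * ‖flowD α (κ ^ n * s) z - flowD α (κ ^ n * s') z‖ := by
        gcongr; exact pow_le_one₀ hτ0.le hτ.le
    _ ≤ _ := by linarith

/-- Comparison of the discrete and the continuous superposition. -/
lemma norm_flowInt_sub_flowSum_le (hs0 : 0 ≤ s) (hs : s ≤ 1) {b : ℝ} (hb : 0 < b)
    (hbτ : κ ^ b = τ) :
    ‖(b / (1 - τ) : ℂ) * flowInt α s b z - flowSum α κ τ s z‖ ≤ 5 := by
  have hq : 0 ≤ ‖z‖ / α := by positivity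
  have h1τ : 0 < 1 - τ := by linarith
  set G : ℝ → ℂ := fun y => ((y ^ b : ℝ) : ℂ) * flowK α s z y with hG
  have hmem : ∀ n : ℕ, κ ^ n ∈ Icc (0 : ℝ) 1 := fun n =>
    ⟨by positivity, pow_le_one₀ hκ0.le hκ.le⟩
  have hint : ∀ m n : ℕ, IntervalIntegrable G MeasureTheory.volume (κ ^ m) (κ ^ n) := fun m n =>
    intervalIntegrable_flowInt hα hz hs0 hs hb (hmem m) (hmem n)
  have hτpow : ∀ n : ℕ, (κ ^ n) ^ b = τ ^ n := fun n => by
    rw [← Real.rpow_natCast, ← Real.rpow_mul hκ0.le, mul_comm, Real.rpow_mul hκ0.le, hbτ,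
      Real.rpow_natCast]
  -- This is why `b` is defined by `κ^b = τ`: the weight `y^(b-1)` spreads the mass `τⁿ`, up to the
  -- common factor `(1 - τ)/b`, over the interval between the `n`-th and the next parameter.
  have hrp : ∀ n : ℕ, ∫ y in (κ ^ (n + 1))..(κ ^ n), y ^ (b - 1) = τ ^ n * ((1 - τ) / b) := fun n => by
    rw [integral_rpow (Or.inl (by linarith)), sub_add_cancel, hτpow, hτpow, pow_succ]; ring
  have hstep : ∀ n : ℕ, ‖(∫ y in (κ ^ (n + 1))..(κ ^ n), G y)
      - ((1 - τ) / b : ℝ) * ((τ : ℂ) ^ n * flowD α (κ ^ n * s) z)‖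
      ≤ ((1 - τ) / b) * (varD (‖z‖ / α) (κ ^ (n + 1) * s) - varD (‖z‖ / α) (κ ^ n * s)) := by
    intro n
    have hk0 : 0 < κ ^ (n + 1) := by positivity
    have hkk : κ ^ (n + 1) ≤ κ ^ n := pow_le_pow_of_le_one hκ0.le hκ.le (Nat.le_succ n)
    have h0mem : (0 : ℝ) ∉ uIcc (κ ^ (n + 1)) (κ ^ n) := by
      rw [uIcc_of_le hkk]; exact fun h => absurd h.1 (not_le.2 hk0)
    have hri : IntervalIntegrable (fun y : ℝ => y ^ (b - 1)) MeasureTheory.volume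
        (κ ^ (n + 1)) (κ ^ n) := intervalIntegral.intervalIntegrable_rpow (Or.inr h0mem)
    have e1 : ((1 - τ) / b : ℝ) * ((τ : ℂ) ^ n * flowD α (κ ^ n * s) z)
        = ∫ y in (κ ^ (n + 1))..(κ ^ n), ((y ^ (b - 1) : ℝ) : ℂ) * flowD α (κ ^ n * s) z := by
      rw [intervalIntegral.integral_mul_const, intervalIntegral.integral_ofReal, hrp]
      push_cast; ring
    have hri' : IntervalIntegrable (fun y : ℝ => ((y ^ (b - 1) : ℝ) : ℂ) * flowD α (κ ^ n * s) z)
        MeasureTheory.volume (κ ^ (n + 1)) (κ ^ n) := 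
      ((Complex.continuous_ofReal.comp_continuousOn (ContinuousOn.rpow_const continuousOn_id
        fun y hy => Or.inl (ne_of_mem_of_not_mem hy h0mem))).mul
          continuousOn_const).intervalIntegrable
    rw [e1, ← intervalIntegral.integral_sub (hint _ _) hri']
    set Δ := varD (‖z‖ / α) (κ ^ (n + 1) * s) - varD (‖z‖ / α) (κ ^ n * s) with hΔ
    have hΔ0 : 0 ≤ Δ := sub_nonneg.2 (varD_anti hq (by positivity)
      (pow_succ_mul_le hκ0 hκ hs0 n) (pow_mul_mem hκ0 hκ hs0 hs n).2)
    have hbd : ‖∫ y in (κ ^ (n + 1))..(κ ^ n), (G y - ((y ^ (b - 1) : ℝ) : ℂ)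
        * flowD α (κ ^ n * s) z)‖ ≤ ∫ y in (κ ^ (n + 1))..(κ ^ n), y ^ (b - 1) * Δ := by
      refine intervalIntegral.norm_integral_le_of_norm_le hkk
        (Eventually.of_forall fun y hy => ?_) (hri.mul_const _)
      have hy0 : 0 < y := hk0.trans hy.1
      have hy1 : y ≤ 1 := hy.2.trans (hmem n).2
      have e2 : G y = ((y ^ (b - 1) : ℝ) : ℂ) * flowD α (s * y) z := by
        simp only [hG]
        rw [flowD_mul, Real.rpow_sub_one hy0.ne']
        push_cast
        have : (y : ℂ) ≠ 0 := by exact_mod_cast hy0.ne'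
        field_simp
      rw [e2, ← mul_sub, norm_mul, Complex.norm_real, Real.norm_of_nonneg (Real.rpow_nonneg hy0.le _)]
      refine mul_le_mul_of_nonneg_left ?_ (Real.rpow_nonneg hy0.le _)
      have hsy : s * y ≤ κ ^ n * s := by rw [mul_comm]; gcongr; exact hy.2
      have d1 := norm_flowD_sub_le hα hz (y := s * y) (y' := κ ^ n * s) (by positivity)
        hsy (pow_mul_mem hκ0 hκ hs0 hs n).2
      have d2 : varD (‖z‖ / α) (s * y) ≤ varD (‖z‖ / α) (κ ^ (n + 1) * s) :=
        varD_anti hq (by positivity) (by rw [mul_comm]; gcongr; exact hy.1.le)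
          (mul_le_one₀ hs hy0.le hy1)
      linarith
    rw [intervalIntegral.integral_mul_const, hrp] at hbd
    refine hbd.trans ?_
    have : 0 < (1 - τ) / b := by positivity
    calc τ ^ n * ((1 - τ) / b) * Δ ≤ 1 * ((1 - τ) / b) * Δ := by
          gcongr; exact pow_le_one₀ hτ0.le hτ.le
      _ = _ := by ring
  have hpart : ∀ N : ℕ, ‖(∫ y in (κ ^ N)..1, G y) - ((1 - τ) / b : ℝ) *
      ∑ n ∈ Finset.range N, (τ : ℂ) ^ n * flowD α (κ ^ n * s) z‖ ≤ (1 - τ) / b * 5 := by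
    intro N
    have e3 : ∫ y in (κ ^ N)..1, G y = ∑ n ∈ Finset.range N, ∫ y in (κ ^ (n + 1))..(κ ^ n), G y := by
      have := intervalIntegral.sum_integral_adjacent_intervals (f := G)
        (μ := MeasureTheory.volume) (a := fun n => κ ^ n) (n := N) (fun k _ => hint k (k + 1))
      rw [intervalIntegral.integral_symm, ← pow_zero κ, ← this, ← Finset.sum_neg_distrib]
      refine Finset.sum_congr rfl fun n _ => ?_
      rw [intervalIntegral.integral_symm, neg_neg]
    rw [e3, Finset.mul_sum, ← Finset.sum_sub_distrib]
    refine (norm_sum_le _ _).trans ((Finset.sum_le_sum fun n _ => hstep n).trans ?_)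
    rw [← Finset.mul_sum]
    have : 0 < (1 - τ) / b := by positivity
    gcongr
    exact sum_varD_sub_le hκ0 hκ hq hs0 hs N
  have hlimI : Tendsto (fun N : ℕ => ∫ y in (κ ^ N)..1, G y) atTop (𝓝 (flowInt α s b z)) := by
    have hint01 := intervalIntegrable_flowInt hα hz hs0 hs hb (p := 1) (q := 0) (by simp) (by simp)
    have hc := intervalIntegral.continuousOn_primitive_interval' (a := 1) hint01 (by simp)
    have h0 : (0 : ℝ) ∈ uIcc (1 : ℝ) 0 := by simp
    have ht : Tendsto (fun N : ℕ => κ ^ N) atTop (𝓝[uIcc (1 : ℝ) 0] 0) := by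
      refine tendsto_nhdsWithin_iff.2 ⟨tendsto_pow_atTop_nhds_zero_of_lt_one hκ0.le hκ,
        Eventually.of_forall fun N => ?_⟩
      rw [uIcc_of_ge zero_le_one]; exact hmem N
    have h1 := ((hc 0 h0).tendsto.comp ht).neg
    rw [← intervalIntegral.integral_symm] at h1
    refine h1.congr fun N => ?_
    rw [Function.comp, ← intervalIntegral.integral_symm]
  have hlimS := (summable_flowSum hα hz hκ0 hκ hτ0 hτ hs0 hs).hasSum.tendsto_sum_nat
  have hfin := le_of_tendsto (hlimI.sub (hlimS.const_mul (((1 - τ) / b : ℝ) : ℂ))).norm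
    (Eventually.of_forall hpart)
  have e4 : (b / (1 - τ) : ℂ) * flowInt α s b z - flowSum α κ τ s z
      = ((b / (1 - τ) : ℝ) : ℂ) * (flowInt α s b z - ((1 - τ) / b : ℝ) * flowSum α κ τ s z) := by
    have hb' : (b : ℂ) ≠ 0 := by exact_mod_cast hb.ne'
    have h1τ' : (1 - τ : ℂ) ≠ 0 := by exact_mod_cast h1τ.ne'
    push_cast
    field_simp
  rw [e4, norm_mul, Complex.norm_real, Real.norm_of_nonneg (by positivity)]
  calc b / (1 - τ) * ‖flowInt α s b z - ((1 - τ) / b : ℝ) * flowSum α κ τ s z‖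
      ≤ b / (1 - τ) * ((1 - τ) / b * 5) := by gcongr; exact hfin
    _ = 5 := by field_simp

end

/-! ### From the two image series to one integral with exponent `β` -/

section

variable {α κ τ s σ : ℝ} {z : ℂ}

/-- Replacements and their costs: `S1` by `τ S1`, `1`; both starting parameters by `s`, `5m` each;
the series by the integral, `10`; `b'/(1-τ)` by `1/ℓ` with `ℓ = -log κ`, `8`; `1/ℓ` by `r2/(4α)`, `8
C₁`; the exponent `T/ℓ` by `T Y` with `T = -log τ`, the last term. -/
lemma norm_flowSum_add_sub_flowInt_le (hα : 0 < α) (hz : 0 ≤ z.re) (hκ0 : 0 < κ) (hκ : κ < 1)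
    (hτ0 : 0 < τ) (hτ : τ < 1) {m : ℕ} (hs0 : κ ^ m ≤ s) (hs : s ≤ 1) (hσ0 : κ ^ m ≤ σ)
    (hσ : σ ≤ 1) {r2 Y C₁ C₂ C₃ : ℝ} (hr2 : 0 ≤ r2) (hY : 0 < Y)
    (h1 : |1 / (-Real.log κ) - r2 / (4 * α)| ≤ C₁) (h2 : |1 / (-Real.log κ) - Y| ≤ C₂)
    (h3 : -Real.log κ ≤ C₃ * α) :
    ‖flowSum α κ τ 1 z + τ * flowSum α κ τ σ z
      - (r2 * τ / (2 * α) : ℝ) * flowInt α s (-Real.log τ * Y) z‖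
      ≤ 19 + 10 * m + 8 * C₁ + 2 * r2 * C₂ * C₃ := by
  set ℓ := -Real.log κ with hℓ
  set T := -Real.log τ with hT
  have hℓ0 : 0 < ℓ := neg_pos.2 (Real.log_neg hκ0 hκ)
  have hT0 : 0 < T := neg_pos.2 (Real.log_neg hτ0 hτ)
  have h1τ : 0 < 1 - τ := by linarith
  have hT1 : 1 - τ ≤ T := by have := Real.log_le_sub_one_of_pos hτ0; linarith
  have hT2 : τ * T ≤ 1 - τ := by
    have := Real.one_sub_inv_le_log_of_pos hτ0
    have h4 : T ≤ τ⁻¹ - 1 := by linarith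
    calc τ * T ≤ τ * (τ⁻¹ - 1) := by gcongr
      _ = 1 - τ := by field_simp
  set b' := T / ℓ with hb'
  set b := T * Y with hb
  have hb0 : 0 < b := by positivity
  have hb0' : 0 < b' := by positivity
  have hbτ : κ ^ b' = τ := by
    rw [Real.rpow_def_of_pos hκ0, show Real.log κ * b' = Real.log τ by
      rw [hb', show Real.log κ = -ℓ by simp [hℓ], show Real.log τ = -T by simp [hT]]; field_simp,
      Real.exp_log hτ0]
  have hsn : 0 ≤ s := le_trans (by positivity) hs0
  have hm1 : κ ^ m ≤ 1 := pow_le_one₀ hκ0.le hκ.le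
  set S1 := flowSum α κ τ 1 z
  set Sσ := flowSum α κ τ σ z
  set S := flowSum α κ τ s z
  set I := flowInt α s b z
  set I' := flowInt α s b' z
  have e1 : ‖(1 - τ : ℂ) * S1‖ ≤ 1 :=
    norm_one_sub_mul_flowSum_le hα hz hκ0 hκ hτ0 hτ zero_le_one le_rfl
  have nτ : ‖(τ : ℂ)‖ ≤ 1 := by rw [Complex.norm_real, Real.norm_of_nonneg hτ0.le]; exact hτ.le
  have e2 : ‖(τ : ℂ) * (S1 - S)‖ ≤ 5 * m := by
    rw [norm_mul]
    exact (mul_le_of_le_one_left (norm_nonneg _) nτ).trans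
      (norm_flowSum_sub_le hα hz hκ0 hκ hτ0 hτ hm1 le_rfl hs0 hs)
  have e3 : ‖(τ : ℂ) * (Sσ - S)‖ ≤ 5 * m := by
    rw [norm_mul]
    exact (mul_le_of_le_one_left (norm_nonneg _) nτ).trans
      (norm_flowSum_sub_le hα hz hκ0 hκ hτ0 hτ hσ0 hσ hs0 hs)
  have e4 : ‖(2 * τ : ℂ) * ((b' / (1 - τ) : ℂ) * I' - S)‖ ≤ 10 := by
    have := norm_flowInt_sub_flowSum_le hα hz hκ0 hκ hτ0 hτ hsn hs hb0' hbτ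
    rw [norm_mul, norm_mul]
    calc _ ≤ ‖(2 : ℂ)‖ * 1 * 5 := by gcongr
      _ = 10 := by norm_num
  have hI' : ‖I'‖ ≤ 4 / (b' + 1) := norm_flowInt_le hα hz hsn hs hb0'
  have hI'4 : ‖I'‖ ≤ 4 := hI'.trans (div_le_self (by norm_num) (by linarith))
  -- The prefactor `1/ℓ` is unbounded as `κ → 1`, but `|I'| ≤ 4/b' = 4ℓ/T` cancels it. What is left
  -- is bounded because `τ T ≤ 1 - τ`.
  have e5 : ‖((2 * τ * (1 / ℓ - b' / (1 - τ)) : ℝ) : ℂ) * I'‖ ≤ 8 := by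
    rw [norm_mul, Complex.norm_real, Real.norm_eq_abs]
    have a1 : 1 / ℓ - b' / (1 - τ) = -(1 / ℓ * ((T - (1 - τ)) / (1 - τ))) := by
      rw [hb']; field_simp; ring
    have a2 : 0 ≤ T - (1 - τ) := by linarith
    rw [a1, abs_mul, abs_neg, abs_of_nonneg (by positivity : (0:ℝ) ≤ 2 * τ),
      abs_of_nonneg (by positivity)]
    calc 2 * τ * (1 / ℓ * ((T - (1 - τ)) / (1 - τ))) * ‖I'‖
        ≤ 2 * τ * (1 / ℓ * ((T - (1 - τ)) / (1 - τ))) * (4 / b') := by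
          gcongr
          exact hI'.trans (by gcongr; linarith)
      _ = 8 * (τ * T - τ * (1 - τ)) / (T * (1 - τ)) := by rw [hb']; field_simp; ring
      _ ≤ 8 := by
          rw [div_le_iff₀ (by positivity)]
          nlinarith
  have e6 : ‖((2 * τ * (r2 / (4 * α) - 1 / ℓ) : ℝ) : ℂ) * I'‖ ≤ 8 * C₁ := by
    rw [norm_mul, Complex.norm_real, Real.norm_eq_abs, abs_mul, abs_of_nonneg (by positivity),
      abs_sub_comm]
    calc _ ≤ 2 * 1 * C₁ * 4 := by have := (abs_nonneg _).trans h1; gcongr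
      _ = 8 * C₁ := by ring
  -- Here `|b' - b| ≤ T C₂`, and dividing by `b' = T/ℓ` leaves `C₂ ℓ`. The bound `ℓ ≤ C₃ α` then
  -- cancels the `1/α` of the prefactor.
  have e7 : ‖((r2 * τ / (2 * α) : ℝ) : ℂ) * (I' - I)‖ ≤ 2 * r2 * C₂ * C₃ := by
    have hII : ‖I' - I‖ ≤ 4 * (|b' - b| / ((b' + 1) * (b + 1))) :=
      norm_flowInt_sub_le hα hz hsn hs hb0' hb0
    have a1 : |b' - b| ≤ T * C₂ := by
      rw [hb', hb, show T / ℓ - T * Y = T * (1 / ℓ - Y) by ring, abs_mul, abs_of_pos hT0]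
      gcongr
    have hC2 : 0 ≤ C₂ := (abs_nonneg _).trans h2
    rw [norm_mul, Complex.norm_real, Real.norm_of_nonneg (by positivity)]
    calc r2 * τ / (2 * α) * ‖I' - I‖
        ≤ r2 * 1 / (2 * α) * (4 * (T * C₂ / (b' * 1))) := by
          gcongr
          refine hII.trans ?_
          gcongr
          · linarith
          · linarith
      _ = 2 * r2 * C₂ * ℓ / α := by rw [hb']; field_simp; ring
      _ ≤ 2 * r2 * C₂ * (C₃ * α) / α := by gcongr
      _ = _ := by field_simp
  have key : S1 + τ * Sσ - (r2 * τ / (2 * α) : ℝ) * I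
      = (1 - τ : ℂ) * S1 + (τ : ℂ) * (S1 - S) + (τ : ℂ) * (Sσ - S)
        - (2 * τ : ℂ) * ((b' / (1 - τ) : ℂ) * I' - S)
        - ((2 * τ * (1 / ℓ - b' / (1 - τ)) : ℝ) : ℂ) * I'
        - ((2 * τ * (r2 / (4 * α) - 1 / ℓ) : ℝ) : ℂ) * I'
        + ((r2 * τ / (2 * α) : ℝ) : ℂ) * (I' - I) := by
    push_cast
    have : (α : ℂ) ≠ 0 := by exact_mod_cast hα.ne'
    field_simp
    ring
  rw [key]
  refine (norm_add_le_of_le (norm_sub_le_of_le (norm_sub_le_of_le (norm_sub_le_of_le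
    (norm_add_le_of_le (norm_add_le_of_le e1 e2) e3) e4) e5) e6) e7).trans (le_of_eq ?_)
  ring

end

/-! ### Asymptotics of the multiplier for nearly touching circles -/

/-- The number `1/(-log κ)` lies between `κ/(1-κ)` and `1/(1-κ)`, whose difference is exactly `1`.
-/
lemma abs_one_div_neg_log_sub_le {κ : ℝ} (h0 : 0 < κ) (h1 : κ < 1) :
    |1 / (-Real.log κ) - 1 / (1 - κ)| ≤ 1 := by
  have h2 : 0 < 1 - κ := by linarith
  have h3 := Real.log_le_sub_one_of_pos h0
  have h4 := Real.one_sub_inv_le_log_of_pos h0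
  have h5 : 0 < -Real.log κ := by linarith
  rw [abs_sub_comm, abs_of_nonneg]
  · have : κ / (1 - κ) ≤ 1 / (-Real.log κ) := by
      rw [div_le_div_iff₀ h2 h5]
      calc κ * -Real.log κ ≤ κ * (κ⁻¹ - 1) := by gcongr; linarith
        _ = 1 * (1 - κ) := by field_simp
    have e : 1 / (1 - κ) = κ / (1 - κ) + 1 := by field_simp; ring
    linarith
  · rw [sub_nonneg]; gcongr; linarith

namespace TwoCircles

variable {re ri α ci ce : ℝ} (h : TwoCircles re ri α ci ce)

include h

lemma sub_mul_add_le : (ce - α) * (ci + α) ≤ re ^ 2 := by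
  have := h.alpha_pos; have := sub_pos.2 h.alpha_lt_ce; have := h.ci_lt
  calc (ce - α) * (ci + α) ≤ (ce - α) * (ce + α) := by gcongr
    _ = re ^ 2 := by linear_combination -h.sq_e

lemma two_mul_sub_mul_ci_le : 2 * (ce - ci) * ci ≤ re ^ 2 := by
  nlinarith [h.sq_e, h.sq_i, sq_nonneg (ce - ci), sq_nonneg ri]

lemma sq_mul_le_ci_sub : ri ^ 2 * (ce - ci) ≤ re ^ 2 * (ci - α) := by
  have hd := sub_pos.2 h.ci_lt
  have h1 := sub_pos.2 h.alpha_lt_ci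
  have h2 : (ce - ci) * (ci + α) ≤ re ^ 2 := by
    have := h.two_mul_sub_mul_ci_le
    nlinarith [h.alpha_lt_ci]
  have e : ri ^ 2 = (ci - α) * (ci + α) := by linear_combination h.sq_i
  rw [e]
  nlinarith

/-- For `ce - ci = re - ri - ε` the numerator tends to `2 re ri` as `ε → 0`, so the leading term is
`r_*²/(4α)`. -/
lemma one_div_one_sub_kap :
    1 / (1 - kap α ci ce) = (re ^ 2 + ri ^ 2 - (ce - ci) ^ 2) / (4 * α * (ce - ci)) + 1 / 2 := by
  have hd := (sub_pos.2 h.ci_lt).ne'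
  have hα := h.alpha_pos.ne'
  rw [h.one_sub_kap, one_div_div]
  field_simp
  linear_combination -2 * h.sq_e - 2 * h.sq_i

lemma alpha_div_one_sub_kap_le : α / (1 - kap α ci ce) ≤ re ^ 2 / (2 * (ce - ci)) := by
  have hd := sub_pos.2 h.ci_lt
  have hα := h.alpha_pos
  calc α / (1 - kap α ci ce) = α * (1 / (1 - kap α ci ce)) := by ring
    _ ≤ α * (re ^ 2 / (2 * α * (ce - ci))) :=
        mul_le_mul_of_nonneg_left h.one_div_one_sub_kap_le hα.le
    _ = _ := by field_simp

lemma neg_log_kap_le : -Real.log (kap α ci ce) ≤ 2 * re / ri ^ 2 * α := by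
  have hα := h.alpha_pos; have hd := sub_pos.2 h.ci_lt; have h1 := sub_pos.2 h.alpha_lt_ci
  have h2 := sub_pos.2 h.alpha_lt_ce; have h3 := h.ci_pos; have h4 := h.ce_pos
  have h5 := h.re_pos; have h6 := h.ri_pos
  have h7 := Real.one_sub_inv_le_log_of_pos h.kap_pos
  have e : (kap α ci ce)⁻¹ - 1 = 2 * α * (ce - ci) / ((ce + α) * (ci - α)) := by
    rw [kap, inv_div]; field_simp; ring
  have h8 : re ≤ ce + α := by nlinarith [h.sq_e]
  have h9 : ri ^ 2 * (ce - ci) / re ^ 2 ≤ ci - α := by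
    rw [div_le_iff₀ (by positivity)]; linarith [h.sq_mul_le_ci_sub]
  calc -Real.log (kap α ci ce) ≤ 2 * α * (ce - ci) / ((ce + α) * (ci - α)) := by linarith
    _ ≤ 2 * α * (ce - ci) / (re * (ri ^ 2 * (ce - ci) / re ^ 2)) := by gcongr
    _ = _ := by field_simp

/-- Both logarithms are of order `α`: `-log κ ≥ 2α(ce-ci)/re²`, while minus the logarithm of the
right side is at most `2α/(ci-α)`. So `m` does not depend on `α`. -/
lemma kap_pow_le {m : ℕ} (hm : re ^ 4 / (ri ^ 2 * (ce - ci) ^ 2) ≤ m) :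
    kap α ci ce ^ m ≤ (ci - α) / (ci + α) := by
  have hα := h.alpha_pos; have hd := sub_pos.2 h.ci_lt; have h1 := sub_pos.2 h.alpha_lt_ci
  have h2 := sub_pos.2 h.alpha_lt_ce; have h3 := h.ci_pos; have h4 := h.ce_pos
  have h5 := h.re_pos; have h6 := h.ri_pos
  have hκ := h.kap_pos
  rw [← Real.log_le_log_iff (by positivity) (by positivity), Real.log_pow]
  have a1 : Real.log (kap α ci ce) ≤ -(2 * α * (ce - ci) / re ^ 2) := by
    have := Real.log_le_sub_one_of_pos h.kap_pos
    have b1 := h.one_sub_kap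
    have b2 : 2 * α * (ce - ci) / re ^ 2 ≤ 2 * α * (ce - ci) / ((ce - α) * (ci + α)) := by
      gcongr; exact h.sub_mul_add_le
    linarith
  have a2 : -(2 * α / (ci - α)) ≤ Real.log ((ci - α) / (ci + α)) := by
    have := Real.one_sub_inv_le_log_of_pos (x := (ci - α) / (ci + α)) (by positivity)
    have e : 1 - ((ci - α) / (ci + α))⁻¹ = -(2 * α / (ci - α)) := by field_simp; ring
    linarith
  have a3 : 2 * α / (ci - α) ≤ 2 * α / (ri ^ 2 * (ce - ci) / re ^ 2) := by
    gcongr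
    rw [div_le_iff₀ (by positivity)]; linarith [h.sq_mul_le_ci_sub]
  calc (m : ℝ) * Real.log (kap α ci ce) ≤ m * -(2 * α * (ce - ci) / re ^ 2) := by gcongr
    _ = -(m * (2 * α * (ce - ci) / re ^ 2)) := by ring
    _ ≤ -(re ^ 4 / (ri ^ 2 * (ce - ci) ^ 2) * (2 * α * (ce - ci) / re ^ 2)) := by gcongr
    _ = -(2 * α / (ri ^ 2 * (ce - ci) / re ^ 2)) := by field_simp
    _ ≤ _ := by linarith

end TwoCircles

section SmallDistance

variable {re ri ε : ℝ}

lemma rStar_sq (hri : 0 < ri) (hre : ri < re) : rStar re ri ^ 2 = 2 * ri * re / (re - ri) := by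
  have : 0 < re - ri := by linarith
  have : 0 < re := by linarith
  rw [rStar, Real.sq_sqrt (by positivity)]

lemma rStar_pos (hri : 0 < ri) (hre : ri < re) : 0 < rStar re ri := by
  have : 0 < re - ri := by linarith
  have : 0 < re := by linarith
  rw [rStar]; positivity

/-- As `ε → 0`, `alpha` is asymptotic to `r_* √ε`; half of this is a lower bound on the whole range
of `ε`. -/
lemma rStar_mul_sqrt_le_alpha (hri : 0 < ri) (hre : ri < re) (hε : 0 < ε) (hε' : ε < re - ri) :
    rStar re ri * √ε / 2 ≤ alpha re ri ε := by
  have h0 := (twoCircles hri hre hε hε').alpha_pos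
  have hd : 0 < re - ri - ε := by linarith
  have hL : 0 < re - ri := by linarith
  have hr := rStar_pos hri hre
  refine abs_le_of_sq_le_sq' ?_ h0.le |>.2
  rw [alpha_sq hri hε hε', div_pow, mul_pow, rStar_sq hri hre, Real.sq_sqrt hε.le,
    div_mul_eq_mul_div, div_div, div_le_div_iff₀ (by positivity) (by positivity)]
  have e1 : (re - ri - ε) ^ 2 ≤ (re - ri) ^ 2 := pow_le_pow_left₀ hd.le (by linarith) 2
  have e2 : 2 * ri * re * (re - ri) ≤ (2 * ri + ε) * (2 * re - ε) * (2 * re - 2 * ri - ε) := by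
    have h2 : 0 < re := by linarith
    have h3 : 0 < 2 * re - ε := by linarith
    have a1 : 2 * ri * re ≤ (2 * ri + ε) * (2 * re - ε) := by
      nlinarith [mul_pos hri h2, mul_pos hε (by linarith : 0 < 2 * (re - ri) - ε)]
    exact mul_le_mul a1 (by linarith) hL.le (by positivity)
  calc 2 * ri * re * ε * (4 * (re - ri - ε) ^ 2)
      ≤ 2 * ri * re * ε * (4 * (re - ri) ^ 2) := by
        have : 0 < re := by linarith
        gcongr
    _ = (2 * ri * re * (re - ri)) * (ε * ((re - ri) * 2 ^ 2)) := by ring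
    _ ≤ ((2 * ri + ε) * (2 * re - ε) * (2 * re - 2 * ri - ε)) * (ε * ((re - ri) * 2 ^ 2)) := by
        gcongr
    _ = _ := by ring

lemma abs_one_div_log_kap_sub_le (hri : 0 < ri) (hre : ri < re) (hε : 0 < ε)
    (hε' : ε ≤ (re - ri) / 2) :
    |1 / (-Real.log (kap (alpha re ri ε) (cI re ri ε) (cE re ri ε)))
      - rStar re ri ^ 2 / (4 * alpha re ri ε)|
      ≤ 3 / 2 + √(re - ri) / (2 * rStar re ri) * (4 * ri * re / (re - ri) ^ 2 + 3) := by
  have hL : 0 < re - ri := by linarith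
  have hre0 : 0 < re := by linarith
  have hε'' : ε < re - ri := by linarith
  have h := twoCircles hri hre hε hε''
  have hα := h.alpha_pos
  have hd : 0 < re - ri - ε := by linarith
  have hr := rStar_pos hri hre
  have h1 := abs_one_div_neg_log_sub_le h.kap_pos h.kap_lt_one
  have h2 : |1 / (1 - kap (alpha re ri ε) (cI re ri ε) (cE re ri ε))
      - rStar re ri ^ 2 / (4 * alpha re ri ε)|
      ≤ 1 / 2 + √(re - ri) / (2 * rStar re ri) * (4 * ri * re / (re - ri) ^ 2 + 3) := by
    rw [h.one_div_one_sub_kap, cE_sub_cI, rStar_sq hri hre]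
    set α := alpha re ri ε with hαdef
    -- The singular parts cancel exactly; the remaining terms carry `ε/α`, which is `O(√ε)`.
    have e : (re ^ 2 + ri ^ 2 - (re - ri - ε) ^ 2) / (4 * α * (re - ri - ε)) + 1 / 2
        - 2 * ri * re / (re - ri) / (4 * α)
        = 1 / 2 + ε / (4 * α) * (2 * ri * re / ((re - ri - ε) * (re - ri))
          + ((re - ri) / (re - ri - ε) + 1)) := by
      field_simp
      ring
    have h3 : ε / (4 * α) ≤ √(re - ri) / (2 * rStar re ri) := by
      have h4 := rStar_mul_sqrt_le_alpha hri hre hε hε''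
      have hw : 0 < √ε := Real.sqrt_pos.2 hε
      calc ε / (4 * α) ≤ ε / (4 * (rStar re ri * √ε / 2)) := by gcongr
        _ = √ε / (2 * rStar re ri) := by
          nth_rewrite 1 [← Real.sq_sqrt hε.le]; field_simp; ring
        _ ≤ _ := by gcongr
    have h5 : 2 * ri * re / ((re - ri - ε) * (re - ri)) ≤ 4 * ri * re / (re - ri) ^ 2 := by
      calc 2 * ri * re / ((re - ri - ε) * (re - ri))
          ≤ 2 * ri * re / ((re - ri) / 2 * (re - ri)) := by gcongr; linarith
        _ = _ := by field_simp; ring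
    have h6 : (re - ri) / (re - ri - ε) + 1 ≤ 3 := by
      have : (re - ri) / (re - ri - ε) ≤ 2 := by rw [div_le_iff₀ hd]; linarith
      linarith
    rw [e, abs_of_nonneg (by positivity)]
    gcongr
  calc _ ≤ _ := abs_sub_le _ (1 / (1 - kap (alpha re ri ε) (cI re ri ε) (cE re ri ε))) _
    _ ≤ 1 + _ := add_le_add h1 h2
    _ = _ := by ring

lemma abs_rStar_sq_div_alpha_sub_le (hri : 0 < ri) (hre : ri < re) (hε : 0 < ε)
    (hε' : ε ≤ (re - ri) / 2) :
    |rStar re ri ^ 2 / (4 * alpha re ri ε) - rStar re ri / (4 * √ε)|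
      ≤ √(re - ri) * (20 * ri * re / (re - ri) ^ 2 + 4) / (2 * rStar re ri) := by
  have hL : 0 < re - ri := by linarith
  have hre0 : 0 < re := by linarith
  have hε'' : ε < re - ri := by linarith
  have hα := (twoCircles hri hre hε hε'').alpha_pos
  have hd : 0 < re - ri - ε := by linarith
  have hr := rStar_pos hri hre
  have h1 : |alpha re ri ε ^ 2 - rStar re ri ^ 2 * ε|
      ≤ ε ^ 2 * (20 * ri * re / (re - ri) ^ 2 + 4) := by
    have e : alpha re ri ε ^ 2 - rStar re ri ^ 2 * ε
        = ε ^ 2 * ((12 * ri * re - 8 * ri * re * (ε / (re - ri)) + (2 * (re - ri) - ε) ^ 2)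
          / (4 * (re - ri - ε) ^ 2)) := by
      rw [alpha_sq hri hε hε'', rStar_sq hri hre]
      field_simp
      ring
    have t1 : ε / (re - ri) ≤ 1 := by rw [div_le_one hL]; exact hε''.le
    have t0 : 0 ≤ ε / (re - ri) := by positivity
    have hp : 0 < ri * re := by positivity
    have num : |12 * ri * re - 8 * ri * re * (ε / (re - ri)) + (2 * (re - ri) - ε) ^ 2|
        ≤ 20 * ri * re + 4 * (re - ri) ^ 2 := by
      rw [abs_le]
      have t2 : 0 ≤ ri * re * (ε / (re - ri)) := by positivity
      have t3 : ri * re * (ε / (re - ri)) ≤ ri * re := mul_le_of_le_one_right hp.le t1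
      have t4 : (2 * (re - ri) - ε) ^ 2 ≤ (2 * (re - ri)) ^ 2 := by gcongr <;> linarith
      constructor <;> nlinarith [sq_nonneg (2 * (re - ri) - ε)]
    have den : (re - ri) ^ 2 ≤ 4 * (re - ri - ε) ^ 2 := by
      calc (re - ri) ^ 2 = 4 * ((re - ri) / 2) ^ 2 := by ring
        _ ≤ _ := by gcongr; linarith
    rw [e, abs_mul, abs_div, abs_of_nonneg (sq_nonneg ε),
      abs_of_nonneg (by positivity : (0 : ℝ) ≤ 4 * (re - ri - ε) ^ 2)]
    gcongr
    calc _ ≤ (20 * ri * re + 4 * (re - ri) ^ 2) / (re - ri) ^ 2 := by gcongr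
      _ = _ := by field_simp
  have h2 := rStar_mul_sqrt_le_alpha hri hre hε hε''
  set α := alpha re ri ε
  set r := rStar re ri
  set K := 20 * ri * re / (re - ri) ^ 2 + 4
  have hK : 0 < K := by positivity
  have hwL : √ε ≤ √(re - ri) := Real.sqrt_le_sqrt hε''.le
  have hw : 0 < √ε := Real.sqrt_pos.2 hε
  have hw2 : √ε ^ 2 = ε := Real.sq_sqrt hε.le
  set w := √ε
  rw [← hw2] at h1
  -- The difference `α² - r² w²` is `O(w⁴)`, against a denominator of order `w³` with `w = √ε`.
  have e : r ^ 2 / (4 * α) - r / (4 * w)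
      = -(r / (4 * α * w * (α + r * w)) * (α ^ 2 - r ^ 2 * w ^ 2)) := by
    field_simp
    ring
  rw [e, abs_neg, abs_mul, abs_of_nonneg (by positivity)]
  calc r / (4 * α * w * (α + r * w)) * |α ^ 2 - r ^ 2 * w ^ 2|
      ≤ r / (4 * (r * w / 2) * w * (0 + r * w)) * ((w ^ 2) ^ 2 * K) := by gcongr
    _ = w * K / (2 * r) := by field_simp; ring
    _ ≤ _ := by gcongr

end SmallDistance

/-! ### The derivative along the bipolar coordinate -/

/-- The sum of the images, with a factor `f`. -/
def imgSum (α κ τ x₀ : ℝ) (f : ℂ → ℂ) (s : ℝ) (z : ℂ) : ℂ :=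
  ∑' n : ℕ, (τ : ℂ) ^ n * (f (flow α (κ ^ n * s) z - x₀) * flowD α (κ ^ n * s) z)

/-- The distance to `x₀` is at most `2α(1 + q)` with `q = |z|/α`, and `1 + q` is the factor in the
numerator of `varF`. The numerator `1 - a²` of `flowD` is at most `4/(1-κ)` times the increment of
`cay` over one step. The product is thus dominated by an increment of `varF`, and the sum over the
images telescopes. -/
lemma norm_flow_mul_flowD_le {α κ y x₀ : ℝ} {z : ℂ} (hα : 0 < α) (hz : 0 ≤ z.re) (hκ0 : 0 < κ)
    (hκ : κ < 1) (hy0 : 0 < y) (hy : y ≤ 1) (hx0 : 0 ≤ x₀) (hx : x₀ ≤ α) :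
    ‖flow α (κ * y) z - x₀‖ * ‖flowD α (κ * y) z‖
      ≤ 16 * α / (1 - κ) * (varF (‖z‖ / α) (κ * y) - varF (‖z‖ / α) y) := by
  have hκy0 : 0 < κ * y := by positivity
  have hκyy : κ * y ≤ y := mul_le_of_le_one_left hy0.le hκ.le
  have hκy : κ * y ≤ 1 := hκyy.trans hy
  have hp := re_div_nonneg hα hz
  have ha0 := cay_nonneg hκy0.le hκy
  have ha1 := cay_le_one hκy0.le
  have hb0 := cay_nonneg hy0.le hy
  have hab := cay_anti hκy0.le hκyy
  have h1κ : 0 < 1 - κ := by linarith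
  have key : 1 - cay (κ * y) ^ 2 ≤ 4 / (1 - κ) * (cay (κ * y) - cay y) := by
    have e1 : 1 - cay (κ * y) ^ 2 = 4 * (κ * y) / (1 + κ * y) ^ 2 := by
      rw [cay]; field_simp; ring
    have e2 : cay (κ * y) - cay y = 2 * y * (1 - κ) / ((1 + κ * y) * (1 + y)) := by
      rw [cay, cay]; field_simp; ring
    rw [e1, e2]
    calc 4 * (κ * y) / (1 + κ * y) ^ 2 ≤ 4 * y / (1 + κ * y) := by
          rw [div_le_div_iff₀ (by positivity) (by positivity)]
          have : κ * y * (1 + κ * y) ≤ y * (1 + κ * y) ^ 2 := by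
            have : 0 ≤ y * (1 + κ * y) - κ * y := by nlinarith
            nlinarith
          nlinarith
      _ = 8 * y / ((1 + κ * y) * 2) := by field_simp; ring
      _ ≤ 8 * y / ((1 + κ * y) * (1 + y)) := by gcongr; linarith
      _ = _ := by field_simp; ring
  rw [varF_sub (by positivity) hκy0.le hκy hy0.le hy, flow_eq_cay hα hκy0.le,
    flowD_eq_cay hα hκy0.le, ← norm_div_ofReal hα]
  have hα' : (α : ℂ) ≠ 0 := by exact_mod_cast hα.ne'
  have hz' : z = α * (z / α) := by field_simp
  set p : ℂ := z / α
  set a := cay (κ * y)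
  set b := cay y
  clear_value p a b
  rw [hz']
  have n1 := one_le_norm_one_add_mul ha0 hp
  have n2 := norm_one_add_mul ha0 hp
  have hq := norm_nonneg p
  have f1 : ‖(α * p + α * a) / (1 + a * p) - x₀‖ ≤ 2 * α * (1 + ‖p‖) := by
    have : ‖(α * p + α * a) / (1 + a * p)‖ ≤ α * (‖p‖ + 1) := by
      rw [norm_div, ← mul_add, norm_mul, Complex.norm_real, Real.norm_of_nonneg hα.le]
      refine (div_le_self (by positivity) n1).trans ?_
      gcongr
      refine (norm_add_le _ _).trans ?_
      rw [Complex.norm_real, Real.norm_of_nonneg ha0]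
      gcongr
    refine (norm_sub_le _ _).trans ?_
    rw [Complex.norm_real, Real.norm_of_nonneg hx0]
    nlinarith
  have ha2 : 0 ≤ 1 - a ^ 2 := by nlinarith
  have f2 : ‖(1 - a ^ 2) / (1 + a * p) ^ 2‖ ≤ 2 * (1 - a ^ 2) / (1 + a * ‖p‖) ^ 2 := by
    have : ‖(1 - a ^ 2 : ℂ)‖ = 1 - a ^ 2 := by
      rw [← Complex.ofReal_one, ← Complex.ofReal_pow, ← Complex.ofReal_sub, Complex.norm_real,
        Real.norm_of_nonneg ha2]
    rw [norm_div, this, norm_pow, div_le_div_iff₀ (by positivity) (by positivity)]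
    calc (1 - a ^ 2) * (1 + a * ‖p‖) ^ 2 ≤ (1 - a ^ 2) * (2 * ‖1 + a * p‖ ^ 2) := by gcongr
      _ = _ := by ring
  have hab' : 0 ≤ a - b := by linarith
  calc _ ≤ 2 * α * (1 + ‖p‖) * (2 * (1 - a ^ 2) / (1 + a * ‖p‖) ^ 2) := by gcongr
    _ ≤ 2 * α * (1 + ‖p‖) * (2 * (4 / (1 - κ) * (a - b)) / ((1 + a * ‖p‖) * (1 + b * ‖p‖))) := by
        rw [sq (1 + a * ‖p‖)]
        gcongr
    _ = _ := by field_simp; ring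

namespace TwoCircles

variable {re ri α ci ce : ℝ} (h : TwoCircles re ri α ci ce) {g : ℂ → ℝ} {F f : ℂ → ℂ} {M : ℝ}
  (hF : IsHolomorphicExtension re g F f M) {τ s : ℝ} {z : ℂ}

include h

lemma pow_kap_mul_mem (hs0 : 0 ≤ s) (hs : s ≤ 1) (n : ℕ) :
    0 ≤ kap α ci ce ^ n * s ∧ kap α ci ce ^ n * s ≤ 1 :=
  pow_mul_mem h.kap_pos h.kap_lt_one hs0 hs n

include hF

lemma summable_imgSum (hτ : |τ| < 1) (hs0 : 0 ≤ s) (hs : s ≤ 1)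
    (hz : z ∈ closedBall (ce : ℂ) re) :
    Summable fun n : ℕ => (τ : ℂ) ^ n *
      (f (flow α (kap α ci ce ^ n * s) z - (ce - re : ℝ)) * flowD α (kap α ci ce ^ n * s) z) := by
  refine summable_pow_mul_of_bounded hτ (B := M) fun n => ?_
  have hk := h.pow_kap_mul_mem hs0 hs n
  rw [norm_mul]
  have h1 := hF.norm_le _ (sub_mem (h.flow_mem hk.1 hk.2 hz))
  have h2 := norm_flowD_le_one h.alpha_pos (h.re_pos_of_mem hz).le hk.1 hk.2
  have hM := hF.M_nonneg h.re_pos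
  calc _ ≤ M * 1 := by gcongr
    _ = _ := mul_one M

/-- The factor `f` may be frozen at the boundary point `0`. -/
lemma norm_imgSum_sub_le (hτ0 : 0 < τ) (hτ : τ < 1) (hs0 : 0 < s) (hs : s ≤ 1)
    (hz : z ∈ closedBall (ce : ℂ) re) :
    ‖imgSum α (kap α ci ce) τ (ce - re) f s z - f 0 * flowSum α (kap α ci ce) τ s z‖
      ≤ M * (2 * re + 16 * (α / (1 - kap α ci ce))) := by
  have hα := h.alpha_pos
  have hz0 := (h.re_pos_of_mem hz).le
  have hM := hF.M_nonneg h.re_pos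
  have hκ := h.kap_pos
  have hκ1 := h.kap_lt_one
  have hre := h.re_pos
  have hx0 : 0 ≤ ce - re := by nlinarith [h.sq_e, h.ce_pos]
  have hx : ce - re ≤ α := by nlinarith [h.sq_e, h.ce_pos]
  have hmem := fun n => h.pow_kap_mul_mem hs0.le hs n
  have hsum := h.summable_imgSum hF (by rwa [abs_of_pos hτ0]) hs0.le hs hz
  have hsum' := (summable_flowSum hα hz0 hκ hκ1 hτ0 hτ hs0.le hs).mul_left (f 0)
  set κ := kap α ci ce with hκdef
  set b : ℕ → ℝ := fun n => ‖flow α (κ ^ n * s) z - (ce - re : ℝ)‖ * ‖flowD α (κ ^ n * s) z‖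
  have hb0 : ∀ n, 0 ≤ b n := fun n => by positivity
  have hbs : ∀ n, b (n + 1) ≤ 16 * α / (1 - κ) *
      (varF (‖z‖ / α) (κ ^ (n + 1) * s) - varF (‖z‖ / α) (κ ^ n * s)) := fun n => by
    have := norm_flow_mul_flowD_le (x₀ := ce - re) hα hz0 hκ hκ1 (y := κ ^ n * s)
      (by positivity) (hmem n).2 hx0 hx
    rwa [← mul_assoc, ← pow_succ'] at this
  -- Each term after the first is dominated by the increment of `varF` over the preceding step. The
  -- term `n = 0` has no preceding step and is bounded by the diameter of the disk.
  have hbsum : ∀ N, ∑ n ∈ Finset.range N, b n ≤ 2 * re + 16 * (α / (1 - κ)) := fun N => by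
    have h1κ : 0 < 1 - κ := by linarith
    calc ∑ n ∈ Finset.range N, b n ≤ ∑ n ∈ Finset.range (N + 1), b n :=
          Finset.sum_le_sum_of_subset_of_nonneg (Finset.range_mono (Nat.le_succ N))
            fun n _ _ => hb0 n
      _ = (∑ n ∈ Finset.range N, b (n + 1)) + b 0 := Finset.sum_range_succ' _ _
      _ ≤ 16 * α / (1 - κ) * 1 + 2 * re * 1 := by
          gcongr
          · refine (Finset.sum_le_sum fun n _ => hbs n).trans ?_
            rw [← Finset.mul_sum, Finset.sum_range_sub (fun n => varF (‖z‖ / α) (κ ^ n * s))]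
            have h1 := varF_mem (q := ‖z‖ / α) (by positivity) (hmem N).1 (hmem N).2
            have h2 := varF_mem (q := ‖z‖ / α) (by positivity) (hmem 0).1 (hmem 0).2
            gcongr
            linarith
          · have h1 := sub_mem (h.flow_mem (hmem 0).1 (hmem 0).2 hz)
            rw [mem_closedBall_iff_norm] at h1
            have h2 := norm_flowD_le_one hα hz0 (hmem 0).1 (hmem 0).2
            have h3 : ‖flow α (κ ^ 0 * s) z - (ce - re : ℝ)‖ ≤ 2 * re := by
              have := norm_le_norm_add_norm_sub' (flow α (κ ^ 0 * s) z - (ce - re : ℝ)) (re : ℂ)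
              rw [Complex.norm_real, Real.norm_of_nonneg hre.le] at this
              linarith
            exact mul_le_mul h3 h2 (norm_nonneg _) (by positivity)
      _ = _ := by ring
  have hbS := summable_of_sum_range_le hb0 hbsum
  have hbT := Real.tsum_le_of_sum_range_le hb0 hbsum
  rw [imgSum, flowSum, ← tsum_mul_left, ← hsum.tsum_sub hsum']
  refine (tsum_of_norm_bounded (hbS.hasSum.mul_left M) fun n => ?_).trans (by gcongr)
  have h0 : (0 : ℂ) ∈ closedBall (re : ℂ) re := by
    rw [mem_closedBall_iff_norm', sub_zero, Complex.norm_real, Real.norm_of_nonneg hre.le]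
  have hl := hF.lipschitz _ (sub_mem (h.flow_mem (hmem n).1 (hmem n).2 hz)) 0 h0
  rw [sub_zero] at hl
  have e : (τ : ℂ) ^ n * (f (flow α (κ ^ n * s) z - (ce - re : ℝ)) * flowD α (κ ^ n * s) z)
      - f 0 * ((τ : ℂ) ^ n * flowD α (κ ^ n * s) z)
      = (τ : ℂ) ^ n * ((f (flow α (κ ^ n * s) z - (ce - re : ℝ)) - f 0)
        * flowD α (κ ^ n * s) z) := by ring
  rw [e, norm_mul, norm_pow, Complex.norm_real, Real.norm_of_nonneg hτ0.le, norm_mul]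
  calc _ ≤ 1 * (M * ‖flow α (κ ^ n * s) z - (ce - re : ℝ)‖ * ‖flowD α (κ ^ n * s) z‖) := by
        gcongr
        exact pow_le_one₀ hτ0.le hτ.le
    _ = _ := by simp only [b]; ring

end TwoCircles

/-- The direction of the gradient of the bipolar coordinate. -/
def xiDir (α : ℝ) (z : ℂ) : ℂ := (α ^ 2 - z ^ 2) / ‖(α ^ 2 - z ^ 2 : ℂ)‖

lemma norm_xiDir_le (α : ℝ) (z : ℂ) : ‖xiDir α z‖ ≤ 1 := by
  rw [xiDir, norm_div, Complex.norm_real, norm_norm]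
  exact div_self_le_one _

lemma eXi_eq_xiDir {α : ℝ} {z : ℂ} (hα : 0 < α) (hP : (α + z : ℂ) ≠ 0) (hQ : (α - z : ℂ) ≠ 0) :
    eXi α z = xiDir α z := by
  have hPQ : (α ^ 2 - z ^ 2 : ℂ) ≠ 0 := by
    rw [show (α ^ 2 - z ^ 2 : ℂ) = (α + z) * (α - z) by ring]; exact mul_ne_zero hP hQ
  rw [eXi, (hasGradientAt_xiCoord hP hQ).gradient, xiDir, RCLike.norm_conj]
  generalize (α ^ 2 - z ^ 2 : ℂ) = W at hPQ
  have hα' : (α : ℂ) ≠ 0 := by exact_mod_cast hα.ne'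
  have hW : (‖W‖ : ℂ) ≠ 0 := by simpa using hPQ
  have hW' : (starRingEnd ℂ) W ≠ 0 := by simpa using hPQ
  have e : W * (starRingEnd ℂ) W = ‖W‖ ^ 2 := Complex.mul_conj' W
  rw [norm_div, norm_mul, Complex.norm_real, Real.norm_of_nonneg hα.le, Complex.real_smul, map_div₀,
    map_mul, Complex.conj_ofReal, map_ofNat]
  push_cast
  simp only [Complex.norm_ofNat, Complex.ofReal_ofNat]
  field_simp
  linear_combination -e

namespace TwoCircles

variable {re ri α ci ce : ℝ} (h : TwoCircles re ri α ci ce) {f : ℂ → ℂ} {τ : ℝ} {z : ℂ}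

include h in
-- The derivative of the reflection sends the direction `α² - z²` to minus the direction at the
-- reflected point, up to conjugation. This sign cancels that of `-τ`, and the invariance of `α² -
-- z²` under the flow expresses the reflected terms as images of `z` with parameters `κⁿ σ(z)`.
lemma inner_xiDir_outerPotD (hτ : |τ| < 1) (hz : z ∈ ball (ce : ℂ) re)
    (hzD : z ∉ ball (ci : ℂ) ri) :
    inner ℝ (xiDir α z)
        ((starRingEnd ℂ) (outerPotD α (kap α ci ce) τ (ce - re) ci ri f z))
      = (xiDir α z * (imgSum α (kap α ci ce) τ (ce - re) f 1 z
        + τ * imgSum α (kap α ci ce) τ (ce - re) f (reflPar α ci z) z)).re := by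
  have hz' := ball_subset_closedBall hz
  have hα := h.alpha_pos
  have hz0 := (h.re_pos_of_mem hz').le
  have hσ0 := (h.reflPar_pos hzD hz').le
  have hσ := h.reflPar_le_one hzD
  have hw := h.refl_eq_flow hzD (h.re_pos_of_mem hz')
  have hwm := ball_subset_closedBall (h.refl_mem hzD hz)
  have hw0 := (h.re_pos_of_mem hwm).le
  have hden := flow_den_ne_zero hα hz0 hσ0 hσ
  have h1τ : (1 - τ : ℂ) ≠ 0 := by
    have : 1 - τ ≠ 0 := by have := (abs_lt.1 hτ).2; linarith
    exact_mod_cast this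
  have hcz := h.ci_sub_ne_zero hzD
  set κ := kap α ci ce with hκdef
  set w := refl α ci z with hwdef
  set u := xiDir α z with hu
  set ρ : ℂ := -(ri ^ 2) / (ci - z) ^ 2 with hρ
  set A : ℂ := ∑' n : ℕ, (τ : ℂ) ^ n * (f (flow α (κ ^ n) w - (ce - re : ℝ)) * flowD α (κ ^ n) w)
    with hA
  have hcu : (starRingEnd ℂ) (ρ * u) = -((α ^ 2 - w ^ 2) / ‖(α ^ 2 - z ^ 2 : ℂ)‖) := by
    have hcz' : (ci - (starRingEnd ℂ) z : ℂ) ≠ 0 := by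
      have := (map_ne_zero (starRingEnd ℂ)).2 hcz
      simpa using this
    have hri : (ri : ℂ) ^ 2 = ci ^ 2 - α ^ 2 := by
      have : (α : ℂ) ^ 2 = ci ^ 2 - ri ^ 2 := by exact_mod_cast h.sq_i
      linear_combination this
    rw [hρ, hu, xiDir, hwdef, refl, hri]
    simp only [map_mul, map_div₀, map_neg, map_sub, map_pow, Complex.conj_ofReal]
    field_simp
    ring
  have hAσ : A * (starRingEnd ℂ) (ρ * u)
      = -(u * imgSum α κ τ (ce - re) f (reflPar α ci z) z) := by
    rw [hcu, hA, imgSum, ← tsum_mul_right, ← tsum_mul_left, ← tsum_neg]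
    refine tsum_congr fun n => ?_
    have hk := h.kap_pow_mem n
    have e1 : flow α (κ ^ n) w = flow α (κ ^ n * reflPar α ci z) z := by
      rw [hw, flow_flow hden hα]
    have e2 := sq_sub_flow_sq (y := κ ^ n) (z := w) (α := α) (flow_den_ne_zero hα hw0 hk.1 hk.2)
    have hk' := h.pow_kap_mul_mem hσ0 hσ n
    have e3 := sq_sub_flow_sq (flow_den_ne_zero hα hz0 hk'.1 hk'.2)
    rw [e1, e3] at e2
    rw [e1, hu, xiDir]
    linear_combination (-((τ : ℂ) ^ n) * f (flow α (κ ^ n * reflPar α ci z) z - (ce - re : ℝ))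
      * (‖(α ^ 2 - z ^ 2 : ℂ)‖ : ℂ)⁻¹) * (-e2)
  have hout : outerPotD α κ τ (ce - re) ci ri f z
      = imgSum α κ τ (ce - re) f 1 z - τ * ((starRingEnd ℂ) A * ρ) := by
    have e : imgSum α κ τ (ce - re) f 1 z
        = ∑' n : ℕ, (τ : ℂ) ^ n * (f (flow α (κ ^ n) z - (ce - re : ℝ)) * flowD α (κ ^ n) z) := by
      simp only [imgSum, mul_one]
    rw [outerPotD, innerPotD, innerPotD, ← e, ← hA, map_mul, map_sub, map_one,
      Complex.conj_ofReal, div_eq_iff h1τ]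
    ring
  rw [hout, Complex.inner, ← map_mul, Complex.conj_re, mul_comm _ u, mul_sub, mul_add, Complex.sub_re,
    Complex.add_re]
  have e4 : (u * (τ * ((starRingEnd ℂ) A * ρ))).re = τ * (A * (starRingEnd ℂ) (ρ * u)).re := by
    rw [← Complex.conj_re (A * _), map_mul, Complex.conj_conj, ← Complex.re_ofReal_mul]
    congr 1; ring
  have e5 : (u * (τ * imgSum α κ τ (ce - re) f (reflPar α ci z) z)).re
      = τ * (u * imgSum α κ τ (ce - re) f (reflPar α ci z) z).re := by
    rw [← Complex.re_ofReal_mul]; congr 1; ring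
  rw [e4, e5, hAσ, Complex.neg_re]
  ring

end TwoCircles

/-! ### Line charges -/

/-- The coordinate increasing from `0` to `1` on the segment `[α, ci]` of charges. -/
def eta (α ci t : ℝ) : ℝ := (ci + α) / (ci - α) * ((t - α) / (t + α))

/-- The holomorphic potential of the dipoles on the segment `e [α, ci]`. -/
def chargeInt (α ci b e : ℝ) (x : ℂ) : ℂ :=
  ∫ t in α..ci, ((eta α ci t ^ b : ℝ) : ℂ) / (x - (e * t : ℝ))

section

variable {α ci b : ℝ} (hα : 0 < α) (hci : α < ci)

include hα hci

omit hα hci in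
lemma eta_left : eta α ci α = 0 := by simp [eta]

lemma eta_right : eta α ci ci = 1 := by
  have h1 := sub_pos.2 hci
  have h2 : 0 < ci + α := by linarith
  rw [eta]; field_simp

lemma eta_mem {t : ℝ} (ht : t ∈ Icc α ci) : eta α ci t ∈ Icc (0 : ℝ) 1 := by
  have h1 := sub_pos.2 hci
  have h2 : 0 < ci + α := by linarith
  have h3 := sub_nonneg.2 ht.1
  have h4 : 0 < t + α := by linarith [ht.1]
  refine ⟨by rw [eta]; positivity, ?_⟩
  rw [eta, div_mul_div_comm, div_le_one (by positivity)]
  nlinarith [ht.2]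

lemma eta_pos {t : ℝ} (ht : t ∈ Ioc α ci) : 0 < eta α ci t := by
  have h1 := sub_pos.2 hci
  have h2 : 0 < ci + α := by linarith
  have h3 := sub_pos.2 ht.1
  have h4 : 0 < t + α := by linarith
  rw [eta]; positivity

omit hci in
lemma hasDerivAt_eta {t : ℝ} (ht : α ≤ t) :
    HasDerivAt (eta α ci) ((ci + α) / (ci - α) * (2 * α / (t + α) ^ 2)) t := by
  have h4 : t + α ≠ 0 := by linarith
  have := (((hasDerivAt_id t).sub_const α).div ((hasDerivAt_id t).add_const α) h4).const_mul
    ((ci + α) / (ci - α))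
  refine this.congr_deriv ?_
  congr 2
  simp only [id]
  ring

omit hci in
lemma continuousOn_eta : ContinuousOn (eta α ci) (Icc α ci) := fun _ ht =>
  (hasDerivAt_eta hα ht.1).continuousAt.continuousWithinAt

omit hci in
lemma continuousOn_eta_rpow (hb : 0 < b) : ContinuousOn (fun t => eta α ci t ^ b) (Icc α ci) :=
  (continuousOn_eta hα).rpow_const fun _ _ => Or.inr hb.le

variable {e : ℝ} {x : ℂ}

omit hci in
lemma continuousOn_chargeInt_integrand (hb : 0 < b)
    (hx : ∀ t ∈ Icc α ci, (x - (e * t : ℝ) : ℂ) ≠ 0) (n : ℕ) :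
    ContinuousOn (fun t : ℝ => ((eta α ci t ^ b : ℝ) : ℂ) / (x - (e * t : ℝ)) ^ n) (Icc α ci) :=
  (Complex.continuous_ofReal.comp_continuousOn (continuousOn_eta_rpow hα hb)).div
    (by fun_prop) fun t ht => pow_ne_zero n (hx t ht)

lemma hasDerivAt_chargeInt (hb : 0 < b)
    (hx : ∀ t ∈ Icc α ci, (x - (e * t : ℝ) : ℂ) ≠ 0) :
    HasDerivAt (chargeInt α ci b e)
      (-∫ t in α..ci, ((eta α ci t ^ b : ℝ) : ℂ) / (x - (e * t : ℝ)) ^ 2) x := by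
  have hcomp : IsCompact ((fun t : ℝ => ((e * t : ℝ) : ℂ)) '' Icc α ci) :=
    isCompact_Icc.image (by fun_prop)
  have hxS : x ∈ ((fun t : ℝ => ((e * t : ℝ) : ℂ)) '' Icc α ci)ᶜ := by
    rintro ⟨t, ht, h1⟩
    exact hx t ht (sub_eq_zero.2 h1.symm)
  obtain ⟨δ, hδ, hball⟩ := Metric.isOpen_iff.1 hcomp.isClosed.isOpen_compl x hxS
  have hfar : ∀ w ∈ ball x (δ / 2), ∀ t ∈ Icc α ci, δ / 2 ≤ ‖w - (e * t : ℝ)‖ := by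
    intro w hw t ht
    by_contra! hlt
    refine hball (?_ : ((e * t : ℝ) : ℂ) ∈ ball x δ) ⟨t, ht, rfl⟩
    rw [mem_ball_iff_norm'] at hw ⊢
    calc ‖x - (e * t : ℝ)‖ ≤ ‖x - w‖ + ‖w - (e * t : ℝ)‖ := norm_sub_le_norm_sub_add_norm_sub _ _ _
      _ < δ := by linarith
  have hne : ∀ w ∈ ball x (δ / 2), ∀ t ∈ Icc α ci, (w - (e * t : ℝ) : ℂ) ≠ 0 := fun w hw t ht =>
    norm_pos_iff.1 ((half_pos hδ).trans_le (hfar w hw t ht))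
  have hI : uIcc α ci = Icc α ci := uIcc_of_le hci.le
  have hI' : uIoc α ci ⊆ Icc α ci := by rw [uIoc_of_le hci.le]; exact Ioc_subset_Icc_self
  have hmeas : ∀ w ∈ ball x (δ / 2), ∀ n : ℕ, MeasureTheory.AEStronglyMeasurable
      (fun t : ℝ => ((eta α ci t ^ b : ℝ) : ℂ) / (w - (e * t : ℝ)) ^ n)
      (MeasureTheory.volume.restrict (uIoc α ci)) := fun w hw n =>
    ((continuousOn_chargeInt_integrand hα hb (hne w hw) n).mono hI').aestronglyMeasurable
      measurableSet_uIoc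
  have hx0 : x ∈ ball x (δ / 2) := mem_ball_self (half_pos hδ)
  have h := intervalIntegral.hasDerivAt_integral_of_dominated_loc_of_deriv_le
    (μ := MeasureTheory.volume) (a := α) (b := ci) (x₀ := x) (s := ball x (δ / 2))
    (F := fun (w : ℂ) (t : ℝ) => ((eta α ci t ^ b : ℝ) : ℂ) / (w - (e * t : ℝ)))
    (F' := fun (w : ℂ) (t : ℝ) => -(((eta α ci t ^ b : ℝ) : ℂ) / (w - (e * t : ℝ)) ^ 2))
    (bound := fun _ => 1 / (δ / 2) ^ 2) (ball_mem_nhds x (half_pos hδ)) ?_ ?_ ?_ ?_ ?_ ?_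
  · rw [← intervalIntegral.integral_neg]
    exact h.2
  · filter_upwards [ball_mem_nhds x (half_pos hδ)] with w hw
    simpa only [pow_one] using hmeas w hw 1
  · have := continuousOn_chargeInt_integrand hα hb hx 1
    rw [← hI] at this
    simpa only [pow_one] using this.intervalIntegrable
  · exact (hmeas x hx0 2).neg
  · refine Eventually.of_forall fun t ht w hw => ?_
    have h1 := eta_mem hα hci (hI' ht)
    have h2 := hfar w hw t (hI' ht)
    rw [norm_neg, norm_div, norm_pow, Complex.norm_real, Real.norm_of_nonneg
      (Real.rpow_nonneg h1.1 _)]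
    gcongr
    exact Real.rpow_le_one h1.1 h1.2 hb.le
  · exact intervalIntegrable_const
  · refine Eventually.of_forall fun t ht w hw => ?_
    have h1 : HasDerivAt (fun w : ℂ => (w - (e * t : ℝ) : ℂ)) 1 w :=
      (hasDerivAt_id w).sub_const _
    refine ((hasDerivAt_const w ((eta α ci t ^ b : ℝ) : ℂ)).div h1
      (hne w hw t (hI' ht))).congr_deriv ?_
    ring

/-- The substitution `y = eta t`. -/
lemma integral_eta_rpow_div_sq (hb : 0 < b) (hx : ∀ t ∈ Icc α ci, (x + t : ℂ) ≠ 0) :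
    ∫ t in α..ci, ((eta α ci t ^ b : ℝ) : ℂ) / (x + t) ^ 2
      = 1 / (2 * α) * flowInt α ((ci - α) / (ci + α)) b x := by
  have h1 := sub_pos.2 hci
  have h2 : 0 < ci + α := by linarith
  have hI : uIcc α ci = Icc α ci := uIcc_of_le hci.le
  have hα' : (α : ℂ) ≠ 0 := by exact_mod_cast hα.ne'
  -- Under `y = eta t` the denominator of `flowK` becomes `2α(x + t)/(t + α)`; the powers of `t + α`
  -- then cancel against the derivative of `eta`.
  have hden : ∀ t ∈ Icc α ci, ((α + x) + ((ci - α) / (ci + α) * eta α ci t : ℝ) * (α - x) : ℂ)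
      = 2 * α * (x + t) / (t + α) := fun t ht => by
    have h3 : (t + α : ℂ) ≠ 0 := by
      have : t + α ≠ 0 := by linarith [ht.1]
      exact_mod_cast this
    have e1 : (ci - α) / (ci + α) * eta α ci t = (t - α) / (t + α) := by
      rw [eta]; field_simp
    rw [e1]; push_cast
    field_simp
    ring
  have hden0 : ∀ t ∈ Icc α ci,
      ((α + x) + ((ci - α) / (ci + α) * eta α ci t : ℝ) * (α - x) : ℂ) ≠ 0 := fun t ht => by
    rw [hden t ht]
    have h3 : (t + α : ℂ) ≠ 0 := by
      have : t + α ≠ 0 := by linarith [ht.1]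
      exact_mod_cast this
    exact div_ne_zero (mul_ne_zero (mul_ne_zero two_ne_zero hα') (hx t ht)) h3
  have hsub := intervalIntegral.integral_deriv_smul_comp' (a := α) (b := ci) (f := eta α ci)
    (f' := fun t => (ci + α) / (ci - α) * (2 * α / (t + α) ^ 2))
    (g := fun y : ℝ => ((y ^ b : ℝ) : ℂ) * flowK α ((ci - α) / (ci + α)) x y)
    (fun t ht => hasDerivAt_eta hα (hI ▸ ht).1) ?_ ?_
  · rw [eta_left, eta_right hα hci] at hsub
    rw [flowInt, ← hsub, ← intervalIntegral.integral_const_mul]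
    refine intervalIntegral.integral_congr fun t ht => ?_
    rw [hI] at ht
    have h3 : (t + α : ℂ) ≠ 0 := by
      have : t + α ≠ 0 := by linarith [ht.1]
      exact_mod_cast this
    have h1' : (ci - α : ℂ) ≠ 0 := by exact_mod_cast h1.ne'
    have h2' : (ci + α : ℂ) ≠ 0 := by exact_mod_cast h2.ne'
    have hxt := hx t ht
    simp only [Function.comp, flowK]
    rw [hden t ht, Complex.real_smul]
    push_cast
    field_simp
    ring
  · rw [hI]
    refine ContinuousOn.mul continuousOn_const (continuousOn_const.div (by fun_prop) fun t ht => ?_)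
    have : t + α ≠ 0 := by linarith [ht.1]
    positivity
  · rw [hI]
    refine ContinuousOn.mul (Complex.continuous_ofReal.comp
      (Real.continuous_rpow_const hb.le)).continuousOn (ContinuousOn.div (by fun_prop)
        (by fun_prop) ?_)
    rintro _ ⟨t, ht, rfl⟩
    exact pow_ne_zero 2 (hden0 t ht)

/-- Integration by parts for the logarithmic potential. -/
lemma integral_log_mul_deriv (hb : 0 < b) (hx : ∀ t ∈ Icc α ci, (x - (e * t : ℝ) : ℂ) ≠ 0)
    {φ : ℝ → ℝ} (hφ : ∀ t ∈ Ioo α ci, HasDerivAt (fun t => eta α ci t ^ b) (φ t) t)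
    (hφ0 : ∀ t ∈ Ioo α ci, 0 ≤ φ t) :
    ∫ t in α..ci, Real.log ‖x - (e * t : ℝ)‖ * φ t
      = Real.log ‖x - (e * ci : ℝ)‖ + e * (chargeInt α ci b e x).re := by
  have hI : uIcc α ci = Icc α ci := uIcc_of_le hci.le
  have hd : ∀ t ∈ Icc α ci, HasDerivAt (fun t : ℝ => Real.log ‖x - (e * t : ℝ)‖)
      (-e / (x - (e * t : ℝ))).re t := fun t ht => by
    have h1 : HasDerivAt (fun t : ℝ => (x - (e * t : ℝ) : ℂ)) (-e : ℂ) t := by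
      have := ((hasDerivAt_id t).const_mul e).ofReal_comp.const_sub x
      simpa using this
    have h2 := (hasFDerivAt_log_norm (hasDerivAt_id (x - (e * t : ℝ) : ℂ))
      (hx t ht)).comp_hasDerivAt t h1
    refine h2.congr_deriv ?_
    simp [div_eq_mul_inv]
  have hc := continuousOn_eta_rpow (ci := ci) hα hb
  have hcd : ContinuousOn (fun t : ℝ => (-e / (x - (e * t : ℝ)) : ℂ).re) (Icc α ci) :=
    Complex.continuous_re.comp_continuousOn (continuousOn_const.div (by fun_prop) hx)
  have hparts := intervalIntegral.integral_mul_deriv_eq_deriv_mul_of_hasDerivAt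
    (a := α) (b := ci) (u := fun t : ℝ => Real.log ‖x - (e * t : ℝ)‖)
    (v := fun t => eta α ci t ^ b) (u' := fun t => (-e / (x - (e * t : ℝ)) : ℂ).re) (v' := φ)
    (hI ▸ fun t ht => (hd t ht).continuousAt.continuousWithinAt) (hI ▸ hc)
    (by rw [min_eq_left hci.le, max_eq_right hci.le]
        exact fun t ht => hd t (Ioo_subset_Icc_self ht))
    (by rwa [min_eq_left hci.le, max_eq_right hci.le])
    (hI.symm ▸ hcd).intervalIntegrable
    -- For `b < 1` the charge density is unbounded at `α`; its integrability follows from its sign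
    -- and the continuity of the primitive.
    (intervalIntegral.intervalIntegrable_deriv_of_nonneg (hI.symm ▸ hc)
      (by rwa [min_eq_left hci.le, max_eq_right hci.le])
      (by rwa [min_eq_left hci.le, max_eq_right hci.le]))
  rw [hparts, eta_right hα hci, eta_left, Real.one_rpow, Real.zero_rpow hb.ne', mul_one,
    mul_zero, sub_zero, sub_eq_add_neg, ← intervalIntegral.integral_neg, chargeInt]
  congr 1
  have hint : IntervalIntegrable (fun t : ℝ => ((eta α ci t ^ b : ℝ) : ℂ) / (x - (e * t : ℝ)))
      MeasureTheory.volume α ci := by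
    have := continuousOn_chargeInt_integrand hα hb hx 1
    rw [← hI] at this
    simpa only [pow_one] using this.intervalIntegrable
  have hre := Complex.reCLM.intervalIntegral_comp_comm hint
  rw [Complex.reCLM_apply] at hre
  rw [← hre, ← intervalIntegral.integral_const_mul]
  refine intervalIntegral.integral_congr fun t _ => ?_
  simp only [Complex.reCLM_apply]
  rw [← Complex.re_ofReal_mul, ← neg_mul, ← Complex.neg_re, ← Complex.re_mul_ofReal]
  congr 1
  ring

lemma integral_dLog_mul (hb : 0 < b) (hx : ∀ t ∈ Icc α ci, (x - (e * t : ℝ) : ℂ) ≠ 0) :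
    ∫ t in α..ci, dLog (e * t) x * eta α ci t ^ b
      = (Complex.I * chargeInt α ci b e x).re := by
  have hI : uIcc α ci = Icc α ci := uIcc_of_le hci.le
  have hint : IntervalIntegrable
      (fun t : ℝ => Complex.I * (((eta α ci t ^ b : ℝ) : ℂ) / (x - (e * t : ℝ))))
      MeasureTheory.volume α ci := by
    have := continuousOn_chargeInt_integrand hα hb hx 1
    rw [← hI] at this
    simpa only [pow_one] using this.intervalIntegrable.const_mul Complex.I
  have hre := Complex.reCLM.intervalIntegral_comp_comm hint
  rw [Complex.reCLM_apply, intervalIntegral.integral_const_mul] at hre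
  rw [chargeInt, ← hre]
  refine intervalIntegral.integral_congr fun t ht => ?_
  rw [hI] at ht
  have h1 := hasFDerivAt_log_norm ((hasDerivAt_id x).sub_const ((e * t : ℝ) : ℂ)) (hx t ht)
  simp only [dLog, Complex.reCLM_apply]
  simp only [id] at h1
  rw [h1.fderiv]
  simp only [ContinuousLinearMap.comp_apply, ContinuousLinearMap.coe_restrictScalars',
    ContinuousLinearMap.toSpanSingleton_apply, Complex.reCLM_apply, smul_eq_mul]
  rw [← Complex.re_mul_ofReal]
  congr 1
  ring

end

/-- The potential of the charges and dipoles on the segment `e [α, ci]`. -/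
def linePot (α ci b e C₁ C₂ : ℝ) (x : ℂ) : ℝ :=
  C₁ * (Real.log ‖x - (e * ci : ℝ)‖ + e * (chargeInt α ci b e x).re)
    + C₂ * (Complex.I * chargeInt α ci b e x).re

lemma hasGradientAt_const_mul {f : ℂ → ℝ} {G x : ℂ} (hf : HasGradientAt f G x) (c : ℝ) :
    HasGradientAt (fun w => c * f w) (c • G) x := by
  rw [hasGradientAt_iff_hasFDerivAt]
  refine (hf.hasFDerivAt.const_mul c).congr_fderiv ?_
  ext v
  simp [mul_add, mul_left_comm]

lemma hasGradientAt_linePot {α ci b e C₁ C₂ : ℝ} {x : ℂ} (hα : 0 < α) (hci : α < ci) (hb : 0 < b)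
    (hx : ∀ t ∈ Icc α ci, (x - (e * t : ℝ) : ℂ) ≠ 0) :
    HasGradientAt (linePot α ci b e C₁ C₂) ((starRingEnd ℂ) (C₁ / (x - (e * ci : ℝ))
      - (e * C₁ + C₂ * Complex.I) *
        ∫ t in α..ci, ((eta α ci t ^ b : ℝ) : ℂ) / (x - (e * t : ℝ)) ^ 2)) x := by
  have h1 := hasDerivAt_chargeInt hα hci hb hx
  have h2 := hasFDerivAt_log_norm ((hasDerivAt_id x).sub_const ((e * ci : ℝ) : ℂ))
    (hx ci ⟨hci.le, le_rfl⟩)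
  have h3 := (hasGradientAt_re (h1.const_mul (e * C₁ + C₂ * Complex.I : ℂ))).hasFDerivAt
  rw [hasGradientAt_iff_hasFDerivAt]
  refine ((h2.const_mul C₁).add h3).congr_of_eventuallyEq (f₁ := linePot α ci b e C₁ C₂)
    (Eventually.of_forall fun w => ?_) |>.congr_fderiv ?_
  · simp [linePot]
    ring
  · ext v
    simp only [id, add_apply, smul_apply,
      ContinuousLinearMap.comp_apply, ContinuousLinearMap.coe_restrictScalars',
      ContinuousLinearMap.toSpanSingleton_apply, Complex.reCLM_apply, smul_eq_mul,
      InnerProductSpace.toDual_apply_apply, Complex.inner, Complex.conj_conj]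
    rw [← Complex.re_ofReal_mul, ← Complex.add_re]
    congr 1
    ring

/-- The integrands agree for each `y`: the denominator at `x` is `(α + x)/(α - conj x)` times the
conjugate of the one at `-x`. Thus charges on the right segment yield the same kind of integral,
started at `σ(x)`. -/
lemma conj_xiDir_mul_flowInt {α ci b : ℝ} {x : ℂ} (hα : 0 < α) (hci : α < ci)
    (hP : (α + x : ℂ) ≠ 0) (hQ : (α - x : ℂ) ≠ 0) :
    (starRingEnd ℂ) (xiDir α x * flowInt α ((ci - α) / (ci + α)) b (-x))
      = xiDir α x * flowInt α (reflPar α ci x) b x := by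
  rw [map_mul, flowInt, flowInt, ← intervalIntegral.integral_const_mul,
    intervalIntegral.integral_of_le zero_le_one, intervalIntegral.integral_of_le zero_le_one,
    ← integral_conj, ← MeasureTheory.integral_const_mul]
  congr 1
  ext y
  have h1 := sub_pos.2 hci
  have h2 : 0 < ci + α := by linarith
  have h1' : (ci - α : ℂ) ≠ 0 := by exact_mod_cast h1.ne'
  have h2' : (ci + α : ℂ) ≠ 0 := by exact_mod_cast h2.ne'
  have hP' : (α + (starRingEnd ℂ) x : ℂ) ≠ 0 := by
    have := (map_ne_zero (starRingEnd ℂ)).2 hP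
    simpa using this
  have hQ' : (α - (starRingEnd ℂ) x : ℂ) ≠ 0 := by
    have := (map_ne_zero (starRingEnd ℂ)).2 hQ
    simpa using this
  have e : (reflPar α ci x : ℂ) = (ci - α) * ((α + x) * (α + (starRingEnd ℂ) x))
      / ((ci + α) * ((α - x) * (α - (starRingEnd ℂ) x))) := by
    rw [reflPar]
    push_cast
    simp only [← Complex.mul_conj', map_add, map_sub, Complex.conj_ofReal]
  have hu : (starRingEnd ℂ) (xiDir α x) = (α ^ 2 - (starRingEnd ℂ) x ^ 2) / ‖(α ^ 2 - x ^ 2 : ℂ)‖ := by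
    simp [xiDir]
  rw [hu, map_mul, Complex.conj_ofReal, xiDir, flowK, flowK]
  set w := (starRingEnd ℂ) x with hw
  have e2 : (starRingEnd ℂ) (4 * ((ci - α) / (ci + α) : ℝ) * α ^ 2 /
      (α + -x + ((ci - α) / (ci + α) * y : ℝ) * (α - -x)) ^ 2)
      = 4 * ((ci - α) / (ci + α)) * α ^ 2 / ((α - w) + (ci - α) / (ci + α) * y * (α + w)) ^ 2 := by
    simp [← hw, sub_eq_add_neg, map_ofNat]
  have e3 : (α + x + (reflPar α ci x * y : ℝ) * (α - x) : ℂ)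
      = (α + x) / (α - w) * ((α - w) + (ci - α) / (ci + α) * y * (α + w)) := by
    push_cast
    rw [e]
    field_simp
  rw [e2, e3, e]
  set B : ℂ := (α - w) + (ci - α) / (ci + α) * y * (α + w)
  rw [show (α ^ 2 - w ^ 2 : ℂ) = (α - w) * (α + w) by ring,
    show (α ^ 2 - x ^ 2 : ℂ) = (α - x) * (α + x) by ring]
  generalize (‖((α : ℂ) - x) * (α + x)‖ : ℂ) = N
  by_cases hB : B = 0
  · simp [hB]
  by_cases hN : N = 0
  · simp [hN]
  field_simp

/-! ### The line-charge potentials and their `ξ`-derivatives -/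

section

variable {re ri ε k : ℝ}

lemma tau_pos (hk : 1 < k) : 0 < tau k := div_pos (by linarith) (by linarith)

lemma tau_lt_one (hk : 1 < k) : tau k < 1 := by
  rw [tau, div_lt_one (by linarith)]; linarith

lemma beta_eq (hk : 1 < k) : beta re ri ε k = -Real.log (tau k) * (rStar re ri / (4 * √ε)) := by
  rw [beta, abs_of_pos (tau_pos hk)]; ring

lemma beta_pos (hri : 0 < ri) (hre : ri < re) (hε : 0 < ε) (hk : 1 < k) :
    0 < beta re ri ε k := by
  have h1 : 0 < -Real.log (tau k) := neg_pos.2 (Real.log_neg (tau_pos hk) (tau_lt_one hk))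
  have h2 := rStar_pos hri hre
  rw [beta_eq hk]; positivity

variable (h : TwoCircles re ri (alpha re ri ε) (cI re ri ε) (cE re ri ε))

include h

lemma exp_xiI (b : ℝ) : Real.exp (2 * b * xiI re ri ε)
    = ((cI re ri ε + alpha re ri ε) / (cI re ri ε - alpha re ri ε)) ^ b := by
  have h1 := sub_pos.2 h.alpha_lt_ci
  have h2 := h.ci_pos; have h3 := h.alpha_pos
  rw [Real.rpow_def_of_pos (by positivity), xiI]
  congr 1; ring

lemma psiPlus_eq {s : ℝ} (hs : alpha re ri ε ≤ s) :
    psiPlus re ri ε k s = eta (alpha re ri ε) (cI re ri ε) s ^ beta re ri ε k := by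
  have h1 := sub_pos.2 h.alpha_lt_ci
  have h2 := h.ci_pos; have h3 := h.alpha_pos
  have h4 := sub_nonneg.2 hs
  have h5 : 0 < s + alpha re ri ε := by linarith
  rw [psiPlus, exp_xiI h, eta, Real.mul_rpow (by positivity) (by positivity)]

lemma hasDerivAt_eta_rpow {s : ℝ} (hs : s ∈ Ioo (alpha re ri ε) (cI re ri ε)) :
    HasDerivAt (fun t => eta (alpha re ri ε) (cI re ri ε) t ^ beta re ri ε k)
      (phiPlus re ri ε k s) s := by
  have h1 := sub_pos.2 h.alpha_lt_ci
  have h2 := h.ci_pos; have h3 := h.alpha_pos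
  have h4 := sub_pos.2 hs.1
  have h5 : 0 < s + alpha re ri ε := by linarith [hs.1]
  have h6 := eta_pos h3 h.alpha_lt_ci ⟨hs.1, hs.2.le⟩
  refine ((hasDerivAt_eta h3 hs.1.le).rpow_const (p := beta re ri ε k)
    (Or.inl h6.ne')).congr_deriv ?_
  rw [phiPlus, exp_xiI h, eta]
  set α := alpha re ri ε
  set c := cI re ri ε
  set b := beta re ri ε k
  have hl : 0 < (c + α) / (c - α) := by positivity
  rw [Real.mul_rpow hl.le (by positivity), Real.div_rpow h4.le h5.le, Real.rpow_sub_one hl.ne',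
    Real.rpow_sub_one h5.ne', Real.rpow_add_one h5.ne']
  have : (s + α) ^ b ≠ 0 := (Real.rpow_pos_of_pos h5 _).ne'
  field_simp

lemma phiPlus_nonneg (hb : 0 < beta re ri ε k) {s : ℝ}
    (hs : s ∈ Ioo (alpha re ri ε) (cI re ri ε)) : 0 ≤ phiPlus re ri ε k s := by
  have h3 := h.alpha_pos
  have h4 := sub_pos.2 hs.1
  have h5 : 0 < s + alpha re ri ε := by linarith [hs.1]
  rw [phiPlus]; positivity

lemma vStar_eq (hb : 0 < beta re ri ε k) {C₁ C₂ : ℝ} {x : ℂ}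
    (hx : ∀ t ∈ Icc (alpha re ri ε) (cI re ri ε), (x - (1 * t : ℝ) : ℂ) ≠ 0) :
    vStar re ri ε k C₁ C₂ x = -(rStar re ri ^ 2 * tau k) *
      linePot (alpha re ri ε) (cI re ri ε) (beta re ri ε k) 1 C₁ C₂ x := by
  rw [vStar, linePot, ← integral_log_mul_deriv h.alpha_pos h.alpha_lt_ci hb hx
    (fun t ht => hasDerivAt_eta_rpow h ht) (fun t ht => phiPlus_nonneg h hb ht),
    ← integral_dLog_mul h.alpha_pos h.alpha_lt_ci hb hx]
  simp only [one_mul]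
  congr 3
  refine intervalIntegral.integral_congr fun t ht => ?_
  rw [uIcc_of_le h.alpha_lt_ci.le] at ht
  simp only [psiPlus_eq h ht.1]

lemma vStarTilde_eq (hb : 0 < beta re ri ε k) {C₁ C₂ : ℝ} {x : ℂ}
    (hx : ∀ t ∈ Icc (alpha re ri ε) (cI re ri ε), (x - (-1 * t : ℝ) : ℂ) ≠ 0) :
    vStarTilde re ri ε k C₁ C₂ x = (rStar re ri ^ 2 * tau k) *
      linePot (alpha re ri ε) (cI re ri ε) (beta re ri ε k) (-1) C₁ C₂ x := by
  rw [vStarTilde, linePot, ← integral_log_mul_deriv h.alpha_pos h.alpha_lt_ci hb hx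
    (fun t ht => hasDerivAt_eta_rpow h ht) (fun t ht => phiPlus_nonneg h hb ht),
    ← integral_dLog_mul h.alpha_pos h.alpha_lt_ci hb hx, ← intervalIntegral.integral_comp_neg,
    ← intervalIntegral.integral_comp_neg]
  have e1 : ∫ t in (alpha re ri ε)..(cI re ri ε), Real.log ‖x - ((-t : ℝ) : ℂ)‖ *
      phiMinus re ri ε k (-t) = -∫ t in (alpha re ri ε)..(cI re ri ε),
        Real.log ‖x - ((-1 * t : ℝ) : ℂ)‖ * phiPlus re ri ε k t := by
    rw [← intervalIntegral.integral_neg]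
    refine intervalIntegral.integral_congr fun t _ => ?_
    simp only [phiMinus, phiPlus, neg_neg, neg_one_mul]
    ring
  have e2 : ∫ t in (alpha re ri ε)..(cI re ri ε), dLog (-t) x * psiMinus re ri ε k (-t)
      = -∫ t in (alpha re ri ε)..(cI re ri ε), dLog (-1 * t) x *
        eta (alpha re ri ε) (cI re ri ε) t ^ beta re ri ε k := by
    rw [← intervalIntegral.integral_neg]
    refine intervalIntegral.integral_congr fun t ht => ?_
    rw [uIcc_of_le h.alpha_lt_ci.le] at ht
    simp only [← psiPlus_eq h ht.1, psiMinus, psiPlus, neg_neg, neg_one_mul]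
    ring
  rw [e1, e2]
  ring

lemma sub_ne_zero_of_mem {x : ℂ} (hx : x ∈ Omega re ri ε \ closure (Incl re ri ε)) {t : ℝ}
    (ht : t ∈ Icc (alpha re ri ε) (cI re ri ε)) : (x - (1 * t : ℝ) : ℂ) ≠ 0 := by
  intro h0
  rw [one_mul] at h0
  refine hx.2 (subset_closure ?_)
  rw [sub_eq_zero.1 h0, Incl, mem_ball_iff_norm', ← Complex.ofReal_sub, Complex.norm_real,
    Real.norm_of_nonneg (sub_nonneg.2 ht.2)]
  have h1 := sub_pos.2 h.alpha_lt_ci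
  nlinarith [h.sq_i, h.ri_pos, ht.1, h.alpha_pos, h.ci_pos]

lemma add_ne_zero_of_mem {x : ℂ} (hx : x ∈ Omega re ri ε) {t : ℝ}
    (ht : t ∈ Icc (alpha re ri ε) (cI re ri ε)) : (x - (-1 * t : ℝ) : ℂ) ≠ 0 := by
  intro h0
  have h1 := h.re_pos_of_mem (ball_subset_closedBall hx)
  have := congrArg Complex.re h0
  simp at this
  linarith [ht.1, h.alpha_pos]

/-- The first term is the field of the point charge left at the centre of `D` by the integration by
parts. The second has the form reached from the image series, with `C₁ - C₂ i` in the place of `f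
0`; the conjugation that moves the integral from `-x` to `x` turns `C₁ + C₂ i` into it. -/
lemma hasGradientAt_vStar (hb : 0 < beta re ri ε k) {C₁ C₂ : ℝ} {x : ℂ}
    (hx : x ∈ Omega re ri ε \ closure (Incl re ri ε)) :
    ∃ G : ℂ, HasGradientAt (vStar re ri ε k C₁ C₂) G x ∧
      inner ℝ (xiDir (alpha re ri ε) x) G
        = -(rStar re ri ^ 2 * tau k * C₁ * (xiDir (alpha re ri ε) x / (x - cI re ri ε)).re)
          + rStar re ri ^ 2 * tau k / (2 * alpha re ri ε) * (xiDir (alpha re ri ε) x *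
            ((C₁ - C₂ * Complex.I) * flowInt (alpha re ri ε)
              (reflPar (alpha re ri ε) (cI re ri ε) x) (beta re ri ε k) x)).re := by
  have hα := h.alpha_pos
  have hci := h.alpha_lt_ci
  have hopen : IsOpen (Omega re ri ε \ closure (Incl re ri ε)) :=
    isOpen_ball.sdiff isClosed_closure
  have hg := hasGradientAt_linePot (C₁ := C₁) (C₂ := C₂) hα hci hb
    (fun t ht => sub_ne_zero_of_mem h hx ht)
  have hg' := (hasGradientAt_const_mul hg (-(rStar re ri ^ 2 * tau k))).congr_of_eventuallyEq
    (f₁ := vStar re ri ε k C₁ C₂) (by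
      filter_upwards [hopen.mem_nhds hx] with w hw
      exact vStar_eq h hb fun t ht => sub_ne_zero_of_mem h hw ht)
  refine ⟨_, hg', ?_⟩
  have hz0 := h.re_pos_of_mem (ball_subset_closedBall hx.1)
  have hxD : x ∉ ball (cI re ri ε : ℂ) ri := fun h1 => hx.2 (subset_closure h1)
  have hQ := h.sub_ne_zero_of_notMem hxD
  have hP : (alpha re ri ε + x : ℂ) ≠ 0 := fun h0 => by
    have := congrArg Complex.re h0
    simp at this; linarith
  have hI := integral_eta_rpow_div_sq (x := -x) hα hci hb (fun t ht => by
    have := sub_ne_zero_of_mem h hx ht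
    rw [one_mul] at this
    rwa [← neg_ne_zero, neg_add, neg_neg, ← sub_eq_add_neg])
  have hI' : ∫ t in (alpha re ri ε)..(cI re ri ε),
      ((eta (alpha re ri ε) (cI re ri ε) t ^ beta re ri ε k : ℝ) : ℂ) / (x - (1 * t : ℝ)) ^ 2
      = ∫ t in (alpha re ri ε)..(cI re ri ε),
        ((eta (alpha re ri ε) (cI re ri ε) t ^ beta re ri ε k : ℝ) : ℂ) / (-x + t) ^ 2 := by
    refine intervalIntegral.integral_congr fun t _ => ?_
    simp only [one_mul]
    congr 1; ring
  have hconj := conj_xiDir_mul_flowInt (b := beta re ri ε k) hα hci hP hQ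
  rw [hI', hI, inner_smul_right, Complex.inner, ← map_mul, Complex.conj_re]
  set u := xiDir (alpha re ri ε) x
  set J := flowInt (alpha re ri ε) ((cI re ri ε - alpha re ri ε) / (cI re ri ε + alpha re ri ε))
    (beta re ri ε k) (-x)
  have e1 : (u * ((C₁ - C₂ * Complex.I) * flowInt (alpha re ri ε)
      (reflPar (alpha re ri ε) (cI re ri ε) x) (beta re ri ε k) x)).re
      = ((C₁ + C₂ * Complex.I) * (u * J)).re := by
    rw [mul_left_comm, ← hconj, ← Complex.conj_re]
    simp
  have e2 : ((C₁ / (x - (1 * cI re ri ε : ℝ)) - ((1 : ℝ) * C₁ + C₂ * Complex.I) *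
      (1 / (2 * alpha re ri ε) * J)) * u : ℂ)
      = C₁ * (u / (x - cI re ri ε))
        - (1 / (2 * alpha re ri ε) : ℝ) * ((C₁ + C₂ * Complex.I) * (u * J)) := by
    push_cast; ring
  rw [e1, e2, Complex.sub_re, Complex.re_ofReal_mul, Complex.re_ofReal_mul]
  ring

/-- For charges on the left segment the substitution gives the integral at `x` itself, with constant
starting parameter, and no conjugation is needed; the point charge sits at `-cᵢ`. -/
lemma hasGradientAt_vStarTilde (hb : 0 < beta re ri ε k) {C₁ C₂ : ℝ} {x : ℂ}
    (hx : x ∈ Omega re ri ε \ closure (Incl re ri ε)) :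
    ∃ G : ℂ, HasGradientAt (vStarTilde re ri ε k C₁ C₂) G x ∧
      inner ℝ (xiDir (alpha re ri ε) x) G
        = rStar re ri ^ 2 * tau k * C₁ * (xiDir (alpha re ri ε) x / (x + cI re ri ε)).re
          + rStar re ri ^ 2 * tau k / (2 * alpha re ri ε) * (xiDir (alpha re ri ε) x *
            ((C₁ - C₂ * Complex.I) * flowInt (alpha re ri ε)
              ((cI re ri ε - alpha re ri ε) / (cI re ri ε + alpha re ri ε))
                (beta re ri ε k) x)).re := by
  have hα := h.alpha_pos
  have hci := h.alpha_lt_ci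
  have hg := hasGradientAt_linePot (C₁ := C₁) (C₂ := C₂) hα hci hb
    (fun t ht => add_ne_zero_of_mem h hx.1 ht)
  have hg' := (hasGradientAt_const_mul hg (rStar re ri ^ 2 * tau k)).congr_of_eventuallyEq
    (f₁ := vStarTilde re ri ε k C₁ C₂) (by
      filter_upwards [isOpen_ball.mem_nhds hx.1] with w hw
      exact vStarTilde_eq h hb fun t ht => add_ne_zero_of_mem h hw ht)
  refine ⟨_, hg', ?_⟩
  have hI := integral_eta_rpow_div_sq (x := x) hα hci hb (fun t ht => by
    have := add_ne_zero_of_mem h hx.1 ht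
    simpa using this)
  have hI' : ∫ t in (alpha re ri ε)..(cI re ri ε),
      ((eta (alpha re ri ε) (cI re ri ε) t ^ beta re ri ε k : ℝ) : ℂ) / (x - (-1 * t : ℝ)) ^ 2
      = ∫ t in (alpha re ri ε)..(cI re ri ε),
        ((eta (alpha re ri ε) (cI re ri ε) t ^ beta re ri ε k : ℝ) : ℂ) / (x + t) ^ 2 := by
    refine intervalIntegral.integral_congr fun t _ => ?_
    simp
  rw [hI', hI, inner_smul_right, Complex.inner, ← map_mul, Complex.conj_re]
  set u := xiDir (alpha re ri ε) x
  set J := flowInt (alpha re ri ε) ((cI re ri ε - alpha re ri ε) / (cI re ri ε + alpha re ri ε))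
    (beta re ri ε k) x
  have e2 : ((C₁ / (x - (-1 * cI re ri ε : ℝ)) - ((-1 : ℝ) * C₁ + C₂ * Complex.I) *
      (1 / (2 * alpha re ri ε) * J)) * u : ℂ)
      = C₁ * (u / (x + cI re ri ε))
        + (1 / (2 * alpha re ri ε) : ℝ) * (u * ((C₁ - C₂ * Complex.I) * J)) := by
    push_cast; ring
  rw [e2, Complex.add_re, Complex.re_ofReal_mul, Complex.re_ofReal_mul]
  ring

end

/-! ### Uniform bound of the remainder -/

variable {re ri : ℝ} {g : ℂ → ℝ} {F f : ℂ → ℂ} {M : ℝ}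

/-- The derivative of the solution along the bipolar coordinate, minus that of the dipoles. -/
def xiRemainder (re ri ε k : ℝ) (f : ℂ → ℂ) (s : ℝ) (z : ℂ) : ℝ :=
  inner ℝ (xiDir (alpha re ri ε) z) ((starRingEnd ℂ) (outerPotD (alpha re ri ε)
      (kap (alpha re ri ε) (cI re ri ε) (cE re ri ε)) (tau k) (cE re ri ε - re)
      (cI re ri ε) ri f z))
    - rStar re ri ^ 2 * tau k / (2 * alpha re ri ε) * (xiDir (alpha re ri ε) z *
        (f 0 * flowInt (alpha re ri ε) s (beta re ri ε k) z)).re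

lemma re_xiDir_mul_le (α : ℝ) (z w : ℂ) : |(xiDir α z * w).re| ≤ ‖w‖ := by
  refine (Complex.abs_re_le_norm _).trans ?_
  rw [norm_mul]
  exact mul_le_of_le_one_left (norm_nonneg _) (norm_xiDir_le α z)

lemma IsHolomorphicExtension.norm_zero_le (hF : IsHolomorphicExtension re g F f M) (hre : 0 < re) :
    ‖f 0‖ ≤ M := by
  refine hF.norm_le 0 ?_
  rw [mem_closedBall_iff_norm', sub_zero, Complex.norm_real, Real.norm_of_nonneg hre.le]

lemma exists_xiRemainder_bound_of_le (hri : 0 < ri) (hre : ri < re)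
    (hF : IsHolomorphicExtension re g F f M) :
    ∃ C : ℝ, ∀ ε k : ℝ, 0 < ε → ε ≤ (re - ri) / 2 → 1 < k →
      ∀ z ∈ Omega re ri ε \ closure (Incl re ri ε), ∀ s : ℝ,
        s = reflPar (alpha re ri ε) (cI re ri ε) z ∨
          s = (cI re ri ε - alpha re ri ε) / (cI re ri ε + alpha re ri ε) →
        |xiRemainder re ri ε k f s z| ≤ C := by
  have hL : 0 < re - ri := by linarith
  have hre0 : 0 < re := hri.trans hre
  have hM := hF.M_nonneg hre0
  have hM0 := hF.norm_zero_le hre0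
  have hr := rStar_pos hri hre
  -- Since `ce - ci ≥ (re - ri)/2`, the ceiling meets the condition of `kap_pow_le`. The `+ 1`
  -- ensures `κ^m ≤ κ ≤ σ(z)`.
  set m : ℕ := ⌈4 * re ^ 4 / (ri ^ 2 * (re - ri) ^ 2)⌉₊ + 1 with hm
  set A₁ := 3 / 2 + √(re - ri) / (2 * rStar re ri) * (4 * ri * re / (re - ri) ^ 2 + 3)
  set A₂ := √(re - ri) * (20 * ri * re / (re - ri) ^ 2 + 4) / (2 * rStar re ri)
  refine ⟨2 * (M * (2 * re + 16 * (re ^ 2 / (re - ri))))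
    + M * (19 + 10 * m + 8 * A₁ + 2 * rStar re ri ^ 2 * (A₁ + A₂) * (2 * re / ri ^ 2)), ?_⟩
  intro ε k hε hε' hk z hz s hs
  have hε'' : ε < re - ri := by linarith
  have h := twoCircles hri hre hε hε''
  have hzD : z ∉ ball (cI re ri ε : ℂ) ri := fun h1 => hz.2 (subset_closure h1)
  have hz' : z ∈ closedBall (cE re ri ε : ℂ) re := ball_subset_closedBall hz.1
  have hα := h.alpha_pos
  have hz0 := (h.re_pos_of_mem hz').le
  have hκ := h.kap_pos
  have hκ1 := h.kap_lt_one
  have hτ0 := tau_pos hk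
  have hτ := tau_lt_one hk
  have hτ' : |tau k| < 1 := by rwa [abs_of_pos hτ0]
  have hd : (re - ri) / 2 ≤ cE re ri ε - cI re ri ε := by rw [cE_sub_cI]; linarith
  have hw : 0 < √ε := Real.sqrt_pos.2 hε
  have b1 := abs_one_div_log_kap_sub_le hri hre hε hε'
  have b2 : |1 / (-Real.log (kap (alpha re ri ε) (cI re ri ε) (cE re ri ε)))
      - rStar re ri / (4 * √ε)| ≤ A₁ + A₂ :=
    (abs_sub_le _ _ _).trans (add_le_add b1 (abs_rStar_sq_div_alpha_sub_le hri hre hε hε'))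
  have b3 := h.neg_log_kap_le
  have b4 : alpha re ri ε / (1 - kap (alpha re ri ε) (cI re ri ε) (cE re ri ε))
      ≤ re ^ 2 / (re - ri) := by
    refine h.alpha_div_one_sub_kap_le.trans ?_
    gcongr
    linarith
  have hi0 := h.ci_pos
  have hi := sub_pos.2 h.alpha_lt_ci
  have hm1 : kap (alpha re ri ε) (cI re ri ε) (cE re ri ε) ^ m
      ≤ kap (alpha re ri ε) (cI re ri ε) (cE re ri ε) :=
    pow_le_of_le_one hκ.le hκ1.le (by omega)
  have hσ0 := hm1.trans (h.kap_le_reflPar hzD hz')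
  have hσ := h.reflPar_le_one hzD
  have hs0 : kap (alpha re ri ε) (cI re ri ε) (cE re ri ε) ^ m ≤ s := by
    rcases hs with rfl | rfl
    · exact hσ0
    · refine h.kap_pow_le ?_
      calc re ^ 4 / (ri ^ 2 * (cE re ri ε - cI re ri ε) ^ 2)
          ≤ re ^ 4 / (ri ^ 2 * ((re - ri) / 2) ^ 2) := by gcongr
        _ = 4 * re ^ 4 / (ri ^ 2 * (re - ri) ^ 2) := by field_simp; ring
        _ ≤ m := by
            rw [hm]; push_cast
            exact (Nat.le_ceil _).trans (by linarith)
  have hs1 : s ≤ 1 := by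
    rcases hs with rfl | rfl
    · exact hσ
    · rw [div_le_one (by positivity)]; linarith
  have c1 := h.norm_imgSum_sub_le hF hτ0 hτ one_pos le_rfl hz'
  have c2 := h.norm_imgSum_sub_le hF hτ0 hτ (h.reflPar_pos hzD hz') hσ hz'
  have c3 := norm_flowSum_add_sub_flowInt_le hα hz0 hκ hκ1 hτ0 hτ hs0 hs1 hσ0 hσ
    (r2 := rStar re ri ^ 2) (Y := rStar re ri / (4 * √ε)) (by positivity) (by positivity) b1 b2 b3
  rw [← beta_eq hk] at c3
  rw [xiRemainder, h.inner_xiDir_outerPotD hτ' hz.1 hzD]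
  set α := alpha re ri ε
  set κ := kap α (cI re ri ε) (cE re ri ε)
  set σ := reflPar α (cI re ri ε) z
  set τ := tau k
  set x₀ := cE re ri ε - re
  set I := flowInt α s (beta re ri ε k) z
  have e : (xiDir α z * (imgSum α κ τ x₀ f 1 z + τ * imgSum α κ τ x₀ f σ z)).re
      - rStar re ri ^ 2 * τ / (2 * α) * (xiDir α z * (f 0 * I)).re
      = (xiDir α z * ((imgSum α κ τ x₀ f 1 z - f 0 * flowSum α κ τ 1 z)
        + τ * (imgSum α κ τ x₀ f σ z - f 0 * flowSum α κ τ σ z)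
        + f 0 * (flowSum α κ τ 1 z + τ * flowSum α κ τ σ z
          - (rStar re ri ^ 2 * τ / (2 * α) : ℝ) * I))).re := by
    rw [← Complex.re_ofReal_mul, ← Complex.sub_re]
    congr 1
    ring
  rw [e]
  refine (re_xiDir_mul_le _ _ _).trans ?_
  have n1 : ‖(τ : ℂ)‖ ≤ 1 := by rw [Complex.norm_real, Real.norm_of_nonneg hτ0.le]; exact hτ.le
  have b4' : M * (2 * re + 16 * (α / (1 - κ))) ≤ M * (2 * re + 16 * (re ^ 2 / (re - ri))) := by
    gcongr
  have c2' : ‖(τ : ℂ) * (imgSum α κ τ x₀ f σ z - f 0 * flowSum α κ τ σ z)‖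
      ≤ M * (2 * re + 16 * (re ^ 2 / (re - ri))) := by
    rw [norm_mul]
    exact (mul_le_of_le_one_left (norm_nonneg _) n1).trans (c2.trans b4')
  have c3' : ‖f 0 * (flowSum α κ τ 1 z + τ * flowSum α κ τ σ z
      - (rStar re ri ^ 2 * τ / (2 * α) : ℝ) * I)‖
      ≤ M * (19 + 10 * m + 8 * A₁ + 2 * rStar re ri ^ 2 * (A₁ + A₂) * (2 * re / ri ^ 2)) := by
    rw [norm_mul]
    exact mul_le_mul hM0 c3 (norm_nonneg _) hM
  refine (norm_add_le_of_le (norm_add_le_of_le (c1.trans b4') c2') c3').trans (le_of_eq ?_)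
  ring

/-- No cancellation is needed away from contact: `α` and `α (ce - ci)` are bounded below, so the
solution and the integral are bounded separately. -/
lemma exists_xiRemainder_bound_of_ge (hri : 0 < ri) (hre : ri < re)
    (hF : IsHolomorphicExtension re g F f M) {ε₀ : ℝ} (hε₀ : 0 < ε₀) :
    ∃ C : ℝ, ∀ ε k : ℝ, ε₀ ≤ ε → ε < re - ri → 1 < k →
      ∀ z ∈ Omega re ri ε \ closure (Incl re ri ε), ∀ s : ℝ,
        s = reflPar (alpha re ri ε) (cI re ri ε) z ∨
          s = (cI re ri ε - alpha re ri ε) / (cI re ri ε + alpha re ri ε) →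
        |xiRemainder re ri ε k f s z| ≤ C := by
  have hL : 0 < re - ri := by linarith
  have hre0 : 0 < re := hri.trans hre
  have hM := hF.M_nonneg hre0
  have hM0 := hF.norm_zero_le hre0
  have hr := rStar_pos hri hre
  set A := √(ε₀ * (2 * ri) * re * (re - ri)) with hA
  have hA0 : 0 < A := by positivity
  refine ⟨8 * M * (re ^ 2 / A) + rStar re ri ^ 2 * 1 / (2 * (A / 2 / (re - ri))) * (M * 4), ?_⟩
  intro ε k hε hε' hk z hz s hs
  have hε0 := hε₀.trans_le hε
  have h := twoCircles hri hre hε0 hε'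
  have hzD : z ∉ ball (cI re ri ε : ℂ) ri := fun h1 => hz.2 (subset_closure h1)
  have hz' : z ∈ closedBall (cE re ri ε : ℂ) re := ball_subset_closedBall hz.1
  have hα := h.alpha_pos
  have hz0 := (h.re_pos_of_mem hz').le
  have hτ0 := tau_pos hk
  have hτ := tau_lt_one hk
  have hτ' : |tau k| < 1 := by rwa [abs_of_pos hτ0]
  have hi0 := h.ci_pos
  have hi := sub_pos.2 h.alpha_lt_ci
  have hσ := h.reflPar_le_one hzD
  have hs0 : 0 ≤ s := by
    rcases hs with rfl | rfl
    · exact (h.reflPar_pos hzD hz').le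
    · positivity
  have hs1 : s ≤ 1 := by
    rcases hs with rfl | rfl
    · exact hσ
    · rw [div_le_one (by positivity)]; linarith
  have hb := beta_pos hri hre hε0 hk
  have hαA : A / 2 / (re - ri) ≤ alpha re ri ε := by
    rw [div_le_iff₀ hL]
    refine (le_alpha_mul hri hε₀ hε hε').trans ?_
    rw [cE_sub_cI]
    exact mul_le_mul_of_nonneg_left (by linarith) hα.le
  have b1 : ‖outerPotD (alpha re ri ε) (kap (alpha re ri ε) (cI re ri ε) (cE re ri ε)) (tau k)
      (cE re ri ε - re) (cI re ri ε) ri f z‖ ≤ 8 * M * (re ^ 2 / A) := by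
    refine (h.norm_outerPotD_le hτ' (fun w hw => h.norm_innerPotD_le' hF hτ'
      (ball_subset_closedBall hw)) hz.1 hzD).trans ?_
    have h1 := one_div_one_sub_kap_bound hri hre hε₀ hε hε'
    have h1τ : 1 - tau k ≠ 0 := by linarith
    calc _ = 8 * M * (1 / (1 - kap (alpha re ri ε) (cI re ri ε) (cE re ri ε))) := by
          field_simp; ring
      _ ≤ _ := by gcongr
  have b2 := norm_flowInt_le hα hz0 hs0 hs1 hb
  have b3 : ‖f 0 * flowInt (alpha re ri ε) s (beta re ri ε k) z‖ ≤ M * 4 := by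
    rw [norm_mul]
    refine mul_le_mul hM0 (b2.trans (div_le_self (by norm_num) (by linarith))) (norm_nonneg _) hM
  rw [xiRemainder]
  refine (abs_sub _ _).trans (add_le_add ?_ ?_)
  · refine (abs_real_inner_le_norm _ _).trans ?_
    rw [RCLike.norm_conj]
    exact (mul_le_of_le_one_left (norm_nonneg _) (norm_xiDir_le _ _)).trans b1
  · rw [abs_mul, abs_of_nonneg (by positivity)]
    have := (re_xiDir_mul_le (alpha re ri ε) z
      (f 0 * flowInt (alpha re ri ε) s (beta re ri ε k) z)).trans b3
    gcongr

lemma exists_xiRemainder_bound (hri : 0 < ri) (hre : ri < re)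
    (hF : IsHolomorphicExtension re g F f M) :
    ∃ C : ℝ, ∀ ε k : ℝ, 0 < ε → ε < re - ri → 1 < k →
      ∀ z ∈ Omega re ri ε \ closure (Incl re ri ε), ∀ s : ℝ,
        s = reflPar (alpha re ri ε) (cI re ri ε) z ∨
          s = (cI re ri ε - alpha re ri ε) / (cI re ri ε + alpha re ri ε) →
        |xiRemainder re ri ε k f s z| ≤ C := by
  obtain ⟨A, hA⟩ := exists_xiRemainder_bound_of_le hri hre hF
  obtain ⟨B, hB⟩ := exists_xiRemainder_bound_of_ge hri hre hF (ε₀ := (re - ri) / 2) (by linarith)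
  refine ⟨max A B, fun ε k hε hε' hk z hz s hs => ?_⟩
  rcases le_total ε ((re - ri) / 2) with h1 | h1
  · exact (hA ε k hε h1 hk z hz s hs).trans (le_max_left _ _)
  · exact (hB ε k h1 hε' hk z hz s hs).trans (le_max_right _ _)

lemma abs_charge_term_le {t a c d α : ℝ} {z w : ℂ} (ht0 : 0 ≤ t) (ht : t ≤ 1) (ha : |a| ≤ c)
    (hd : 0 < d) (hw : d ≤ ‖w‖) (r : ℝ) :
    |r ^ 2 * t * a * (xiDir α z / w).re| ≤ r ^ 2 * c / d := by
  have h1 : |(xiDir α z / w).re| ≤ 1 / d := by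
    refine (Complex.abs_re_le_norm _).trans ?_
    rw [norm_div]
    exact div_le_div₀ zero_le_one (norm_xiDir_le α z) hd hw
  rw [abs_mul, abs_mul, abs_of_nonneg (by positivity)]
  have hc := (abs_nonneg _).trans ha
  calc r ^ 2 * t * |a| * |(xiDir α z / w).re| ≤ r ^ 2 * 1 * c * (1 / d) := by gcongr
    _ = _ := by ring

section Remainder

variable {ε k : ℝ} {v r : ℂ → ℝ} {x : ℂ} {C : ℝ}

/-- The remainder `v - w` has a bounded derivative along the bipolar coordinate if `w` is the
potential of dipoles with a controlled remainder, up to the term `c` of a point charge. -/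
lemma inner_eXi_gradient_sub (h : TwoCircles re ri (alpha re ri ε) (cI re ri ε) (cE re ri ε))
    (hF : IsHolomorphicExtension re g F f M) (hk : 1 < k)
    (hv : IsDirichletSolution re ri ε k g v) (hx : x ∈ Omega re ri ε \ closure (Incl re ri ε))
    {w : ℂ → ℝ} {G : ℂ} {s c : ℝ} (hG : HasGradientAt w G x)
    (hGc : inner ℝ (xiDir (alpha re ri ε) x) G
      = c + rStar re ri ^ 2 * tau k / (2 * alpha re ri ε) * (xiDir (alpha re ri ε) x *
        (f 0 * flowInt (alpha re ri ε) s (beta re ri ε k) x)).re)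
    (hr : ∀ x, r x = v x - w x) {B : ℝ} (hB : |xiRemainder re ri ε k f s x| ≤ B)
    (hc : |c| ≤ C) :
    DifferentiableAt ℝ r x ∧
      |inner ℝ (eXi (alpha re ri ε) x) (gradient r x)| ≤ B + C := by
  obtain rfl : r = fun x => v x - w x := funext hr
  have hzD : x ∉ ball (cI re ri ε : ℂ) ri := fun h1 => hx.2 (subset_closure h1)
  have hQ := h.sub_ne_zero_of_notMem hzD
  have hz0 := h.re_pos_of_mem (ball_subset_closedBall hx.1)
  have hα := h.alpha_pos
  have hP : (alpha re ri ε + x : ℂ) ≠ 0 := fun h0 => by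
    have := congrArg Complex.re h0
    simp at this; linarith
  have hgv := hasGradientAt_outer h hF (by linarith) hv hx
  have hgr := hgv.hasFDerivAt.sub hG.hasFDerivAt
  rw [← map_sub] at hgr
  have hgr' := hasGradientAt_iff_hasFDerivAt.2 hgr
  refine ⟨hgr.differentiableAt, ?_⟩
  have e : gradient (fun x => v x - w x) x = _ := hgr'.gradient
  rw [e, eXi_eq_xiDir hα hP hQ, inner_sub_right, hGc]
  rw [xiRemainder] at hB
  rw [sub_add_eq_sub_sub_swap]
  exact (abs_sub _ _).trans (add_le_add hB hc)

end Remainder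

end

end ImageCharge

theorem mainTheorem1 (re ri : ℝ) (hri : 0 < ri) (hre : ri < re)
    (δ : ℝ≥0) (hδ : 1 / 2 < δ) (g : ℂ → ℝ)
    (hg : ImageCharge.C2HolderOnCircle (re : ℂ) re δ g)
    (hmean : ∫ t in (0 : ℝ)..(2 * Real.pi), g (circleMap (re : ℂ) re t) = 0) :
    -- the problem is solvable
    (∀ ε k : ℝ, 0 < ε → ε < re - ri → 0 < k →
      ∃ v : ℂ → ℝ, ImageCharge.IsDirichletSolution re ri ε k g v) ∧
    -- the gradient is bounded in the inclusion, uniformly in all parameters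
    (∃ C : ℝ, ∀ ε k : ℝ, 0 < ε → ε < re - ri → 0 < k →
      ∀ v : ℂ → ℝ, ImageCharge.IsDirichletSolution re ri ε k g v →
        ∀ x ∈ ImageCharge.Incl re ri ε, ‖gradient v x‖ ≤ C) ∧
    -- outside the inclusion it is bounded as long as `k` stays bounded
    (∀ K : ℝ, ∃ C : ℝ, ∀ ε k : ℝ, 0 < ε → ε < re - ri → 0 < k → k ≤ K →
      ∀ v : ℂ → ℝ, ImageCharge.IsDirichletSolution re ri ε k g v →
        ∀ x ∈ ImageCharge.Omega re ri ε \ closure (ImageCharge.Incl re ri ε),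
          ‖gradient v x‖ ≤ C) ∧
    -- and as long as `ε` stays away from zero
    (∀ ε₀ : ℝ, 0 < ε₀ → ∃ C : ℝ, ∀ ε k : ℝ, ε₀ ≤ ε → ε < re - ri → 0 < k →
      ∀ v : ℂ → ℝ, ImageCharge.IsDirichletSolution re ri ε k g v →
        ∀ x ∈ ImageCharge.Omega re ri ε \ closure (ImageCharge.Incl re ri ε),
          ‖gradient v x‖ ≤ C) ∧
    -- `(C₁, C₂)` is the gradient of `H_d` at the boundary point `(0, 0)`
    ∃ C₁ C₂ : ℝ,
      Tendsto (fun x : ℂ => fderiv ℝ (ImageCharge.Hd re g) x 1)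
        (𝓝[ball (re : ℂ) re] 0) (𝓝 C₁) ∧
      Tendsto (fun x : ℂ => fderiv ℝ (ImageCharge.Hd re g) x Complex.I)
        (𝓝[ball (re : ℂ) re] 0) (𝓝 C₂) ∧
      -- `v = v_* + r`
      (∃ C : ℝ, ∀ ε k : ℝ, 0 < ε → ε < re - ri → 1 < k →
        ∀ v : ℂ → ℝ, ImageCharge.IsDirichletSolution re ri ε k g v →
          ∀ r : ℂ → ℝ, (∀ x, r x = v x - ImageCharge.vStar re ri ε k C₁ C₂ x) →
            ∀ x ∈ ImageCharge.Omega re ri ε \ closure (ImageCharge.Incl re ri ε),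
              DifferentiableAt ℝ r x ∧
              |inner ℝ (ImageCharge.eXi (ImageCharge.alpha re ri ε) x) (gradient r x)| ≤ C) ∧
      -- `v = ṽ_* + r̃`
      (∃ C : ℝ, ∀ ε k : ℝ, 0 < ε → ε < re - ri → 1 < k →
        ∀ v : ℂ → ℝ, ImageCharge.IsDirichletSolution re ri ε k g v →
          ∀ r : ℂ → ℝ, (∀ x, r x = v x - ImageCharge.vStarTilde re ri ε k C₁ C₂ x) →
            ∀ x ∈ ImageCharge.Omega re ri ε \ closure (ImageCharge.Incl re ri ε),
              DifferentiableAt ℝ r x ∧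
              |inner ℝ (ImageCharge.eXi (ImageCharge.alpha re ri ε) x) (gradient r x)| ≤ C) := by
  have hre0 : 0 < re := hri.trans hre
  obtain ⟨F, f, M, hF⟩ := ImageCharge.exists_isHolomorphicExtension hre0 hδ hg hmean
  have hM := hF.M_nonneg hre0
  refine ⟨fun ε k hε hε' hk => ?_, ⟨M * (6 + 4 * re), ?_⟩,
    fun K => ⟨M * (6 + 4 * re) * (K + 1), ?_⟩, fun ε₀ hε₀ => ?_, ?_⟩
  · exact ⟨_, ImageCharge.isDirichletSolution_imageSol
      (ImageCharge.twoCircles hri hre hε hε') hF hk⟩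
  · intro ε k hε hε' hk v hv x hx
    exact ImageCharge.norm_gradient_inner_le (ImageCharge.twoCircles hri hre hε hε') hF hk hv hx
  · intro ε k hε hε' hk hK v hv x hx
    refine (ImageCharge.norm_gradient_outer_le (ImageCharge.twoCircles hri hre hε hε')
      hF hk hv hx).1.trans ?_
    gcongr
  · refine ⟨8 * M * (re ^ 2 / √(ε₀ * (2 * ri) * re * (re - ri))), ?_⟩
    intro ε k hε hε' hk v hv x hx
    refine (ImageCharge.norm_gradient_outer_le
      (ImageCharge.twoCircles hri hre (hε₀.trans_le hε) hε') hF hk hv hx).2.trans ?_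
    exact mul_le_mul_of_nonneg_left
      (ImageCharge.one_div_one_sub_kap_bound hri hre hε₀ hε hε') (by positivity)
  · obtain ⟨B, hB⟩ := ImageCharge.exists_xiRemainder_bound hri hre hF
    have hf0 := hF.norm_zero_le hre0
    have hC₁ : |(f 0).re| ≤ M := (Complex.abs_re_le_norm _).trans hf0
    -- The gradient of `Re F` is `(Re f, -Im f)`, hence `f 0 = C₁ - C₂ i`.
    have hc : ((f 0).re - (-(f 0).im : ℝ) * Complex.I : ℂ) = f 0 := by
      rw [Complex.ofReal_neg, neg_mul, sub_neg_eq_add, Complex.re_add_im]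
    refine ⟨(f 0).re, -(f 0).im, ?_, ?_, ⟨B + ImageCharge.rStar re ri ^ 2 * M / ri, ?_⟩,
      ⟨B + ImageCharge.rStar re ri ^ 2 * M / ri, ?_⟩⟩
    · simpa using ImageCharge.tendsto_fderiv_Hd hre0 hF 1
    · simpa using ImageCharge.tendsto_fderiv_Hd hre0 hF Complex.I
    · intro ε k hε hε' hk v hv r hr x hx
      have h := ImageCharge.twoCircles hri hre hε hε'
      obtain ⟨G, hG, hGc⟩ := ImageCharge.hasGradientAt_vStar h
        (ImageCharge.beta_pos hri hre hε hk) (C₁ := (f 0).re) (C₂ := -(f 0).im) hx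
      rw [hc] at hGc
      refine ImageCharge.inner_eXi_gradient_sub h hF hk hv hx hG hGc hr
        (hB ε k hε hε' hk x hx _ (Or.inl rfl)) ?_
      rw [abs_neg]
      refine ImageCharge.abs_charge_term_le (ImageCharge.tau_pos hk).le
        (ImageCharge.tau_lt_one hk).le hC₁ hri ?_ _
      have hxD : x ∉ ball (ImageCharge.cI re ri ε : ℂ) ri := fun h1 => hx.2 (subset_closure h1)
      rwa [mem_ball_iff_norm, not_lt] at hxD
    · intro ε k hε hε' hk v hv r hr x hx
      have h := ImageCharge.twoCircles hri hre hε hε'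
      obtain ⟨G, hG, hGc⟩ := ImageCharge.hasGradientAt_vStarTilde h
        (ImageCharge.beta_pos hri hre hε hk) (C₁ := (f 0).re) (C₂ := -(f 0).im) hx
      rw [hc] at hGc
      refine ImageCharge.inner_eXi_gradient_sub h hF hk hv hx hG hGc hr
        (hB ε k hε hε' hk x hx _ (Or.inr rfl)) ?_
      refine ImageCharge.abs_charge_term_le (ImageCharge.tau_pos hk).le
        (ImageCharge.tau_lt_one hk).le hC₁ hri ?_ _
      have hz0 := h.re_pos_of_mem (ball_subset_closedBall hx.1)
      have h1 := Complex.re_le_norm (x + ImageCharge.cI re ri ε)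
      rw [Complex.add_re, Complex.ofReal_re] at h1
      -- The charge at `-cᵢ` is at distance at least `cᵢ` from the right half-plane, and `cᵢ > rᵢ`.
      nlinarith [h.sq_i, h.ci_pos, h.alpha_pos]
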